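/- Let $T>0$ and $N>4$ be real numbers and let $\mathfrak{E}=C^\infty([0,T]\times[0,1])$ be the space of real-valued functions $u(t,x)$ that are smooth up to the boundary. Put $$\mathfrak{E}_{[0]}=\{u\in\mathfrak{E} : u=0 \text{ for } 5/6\le x\le 1\},\qquad \mathfrak{E}_{[1]}=\{u\in\mathfrak{E} : u=0 \text{ for } 0\le x\le 1/6\},$$ each with its $C^\infty$ topology (uniform convergence of all derivatives $\partial_t^j\partial_x^k u$). Let $$\triangle_{[0]}=x\frac{d^2}{dx^2}+\frac52\frac{d}{dx},\qquad \triangle_{[1]}=X\frac{d^2}{dX^2}+\frac N2\frac{d}{dX}\quad (X=1-x),$$ $$\|g\|_{[0]}=\Big(\int_0^1|g|^2x^{3/2}\,dx\Big)^{1/2},\qquad \|g\|_{[1]}=\Big(\int_0^1|g|^2(1-x)^{N/2-1}\,dx\Big)^{1/2},$$ and for $\mu=0,1$, $n=0,1,2,\dots$ and $u\in\mathfrak{E}_{[\mu]}$ let $$\|u\|^{(\infty)}_{[\mu]n}=\sup_{j+k\le n}\|(-\partial_t^2)^j(-\triangle_{[\mu]})^k u\|_{L^\infty},\qquad \|u\|^{(2)}_{[\mu]n}=\Big(\sum_{j+k\le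 n}\int_0^T\|(-\partial_t^2)^j(-\triangle_{[\mu]})^k u\|_{[\mu]}^2\,dt\Big)^{1/2}.$$ Then, for $\mu=0$ and for $\mu=1$: (i) The gradings $(\|\cdot\|^{(\infty)}_{[\mu]n})_n$ and $(\|\cdot\|^{(2)}_{[\mu]n})_n$ are tamely equivalent: there are $r,b\ge 0$ such that for every $n\ge b$ there is a constant $C$ with $\|u\|^{(\infty)}_{[\mu]n}\le C\|u\|^{(2)}_{[\mu],n+r}$ and $\|u\|^{(2)}_{[\mu]n}\le C\|u\|^{(\infty)}_{[\mu],n+r}$ for all $u\in\mathfrak{E}_{[\mu]}$. (ii) With either grading, $\mathfrak{E}_{[\mu]}$ is a tame Fréchet space in the sense of Hamilton. That is, the grading is an increasing sequence of seminorms that defines the topology of the Fréchet space $\mathfrak{E}_{[\mu]}$, and there are a real Banach space $B$ and linear maps $L:\mathfrak{E}_{[\mu]}\to\Sigma(B)$, $M:\Sigma(B)\to\mathfrak{E}_{[\mu]}$ with $ML=\mathrm{Id}$, both tame. Here $\Sigma(B)$ is the space of sequences $f=(f_k)_{k\ge0}$ in $B$ with $\|f\|_n=\sum_{k\ge 0}e^{nk}\|f_k\|_B<\infty$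 for all $n\ge0$, graded by these norms, and a linear map $A:V\to W$ of spaces with gradings $(\|\cdot\|_n)_n$ is tame if there are $r,b\ge 0$ such that for every $n\ge b$ there is a constant $C$ with $\|Av\|_n\le C\|v\|_{n+r}$ for all $v\in V$. -/

import Mathlib

open Set Filter Topology

noncomputable section

namespace HamiltonTame

/-! ### Graded Fréchet spaces and tame spaces, in the sense of Hamilton -/

/-- `p` is a grading on the real topological vector space `V`, and `V` is a Fréchet space:
the `p n` are seminorms, they increase with `n`, they define the given topology of `V`, and `V` is
Hausdorff and complete.  (The topology being defined by countably many seminorms,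
completeness is completeness for Cauchy sequences.) -/
structure IsGradedFrechet {V : Type*} [AddCommGroup V] [Module ℝ V] [TopologicalSpace V]
    (p : ℕ → V → ℝ) : Prop where
  defines_topology : ∃ P : SeminormFamily ℝ V ℕ, (∀ n v, P n v = p n v) ∧ WithSeminorms P
  mono : ∀ (m n : ℕ) (v : V), m ≤ n → p m v ≤ p n v
  hausdorff : T2Space V
  complete : ∀ f : ℕ → V,
    (∀ n : ℕ, ∀ ε > 0, ∃ K : ℕ, ∀ i ≥ K, ∀ j ≥ K, p n (f i - f j) < ε) →
    ∃ v : V, ∀ n : ℕ, Tendsto (fun i => p n (f i - v)) atTop (𝓝 0)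

/-- Tame equivalence of two gradings: each is estimated by the other, with some degree `r` and
some base `b` (the constants may depend on `n`). -/
def TamelyEquivalent {V : Type*} (p q : ℕ → V → ℝ) : Prop :=
  ∃ r b : ℕ, ∀ n ≥ b, ∃ C : ℝ, ∀ v : V, p n v ≤ C * q (n + r) v ∧ q n v ≤ C * p (n + r) v

/-- Tame linear maps between spaces with gradings `p` and `q`. -/
def IsTameMap {V W : Type*} [AddCommGroup V] [Module ℝ V] [AddCommGroup W] [Module ℝ W]
    (p : ℕ → V → ℝ) (q : ℕ → W → ℝ) (L : V →ₗ[ℝ] W) : Prop :=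
  ∃ r b : ℕ, ∀ n ≥ b, ∃ C : ℝ, ∀ v : V, q n (L v) ≤ C * p (n + r) v

/-- `V` (with `p`) is a tame direct summand of `W` (with `q`). -/
def IsTameDirectSummand {V W : Type*} [AddCommGroup V] [Module ℝ V] [AddCommGroup W] [Module ℝ W]
    (p : ℕ → V → ℝ) (q : ℕ → W → ℝ) : Prop :=
  ∃ (L : V →ₗ[ℝ] W) (M : W →ₗ[ℝ] V), IsTameMap p q L ∧ IsTameMap q p M ∧
    M ∘ₗ L = LinearMap.id

/-- The space `Σ(B)` of exponentially decreasing sequences in `B`. -/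
def ExpSeq (B : Type*) [NormedAddCommGroup B] [NormedSpace ℝ B] : Submodule ℝ (ℕ → B) where
  carrier := {f | ∀ n : ℕ, Summable fun k : ℕ => Real.exp (n * k) * ‖f k‖}
  zero_mem' := fun n => by simp
  add_mem' := by
    intro f g hf hg n
    refine Summable.of_nonneg_of_le (fun k => by positivity) (fun k => ?_) ((hf n).add (hg n))
    rw [← mul_add]
    exact mul_le_mul_of_nonneg_left (norm_add_le _ _) (Real.exp_pos _).le
  smul_mem' := by
    intro c f hf n
    refine ((hf n).mul_left ‖c‖).congr (fun k => ?_)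
    simp only [Pi.smul_apply, norm_smul]
    ring

/-- The grading `‖f‖ₙ = ∑ₖ exp (n k) ‖fₖ‖` of `Σ(B)`. -/
def expSeqNorm (B : Type*) [NormedAddCommGroup B] [NormedSpace ℝ B] (n : ℕ) (f : ExpSeq B) : ℝ :=
  ∑' k : ℕ, Real.exp (n * k) * ‖(f : ℕ → B) k‖

/-- `V` with the grading `p` is a tame (Fréchet) space: it is a graded Fréchet space and a tame
direct summand of `Σ(B)` for some real Banach space `B`. -/
def IsTameSpace {V : Type*} [AddCommGroup V] [Module ℝ V] [TopologicalSpace V]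
    (p : ℕ → V → ℝ) : Prop :=
  IsGradedFrechet p ∧
    ∃ (B : Type) (_ : NormedAddCommGroup B) (_ : NormedSpace ℝ B) (_ : CompleteSpace B),
      IsTameDirectSummand p (expSeqNorm B)

end HamiltonTame

namespace SingularGrading

/-! ### Smooth functions of `(t, x)` on `[0, T] × [0, 1]` -/

/-- The rectangle `[0, T] × [0, 1]`; points are written `(t, x)`. -/
def rect (T : ℝ) : Set (ℝ × ℝ) := Icc 0 T ×ˢ Icc 0 1

/-- The derivative in `t` (one-sided at the ends of `[0, T]`). -/
def dt (T : ℝ) (u : ℝ × ℝ → ℝ) : ℝ × ℝ → ℝ :=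
  fun p => derivWithin (fun s => u (s, p.2)) (Icc 0 T) p.1

/-- The derivative in `x` (one-sided at the ends of `[0, 1]`). -/
def dx (u : ℝ × ℝ → ℝ) : ℝ × ℝ → ℝ :=
  fun p => derivWithin (fun y => u (p.1, y)) (Icc 0 1) p.2

/-- The part of `[0, 1]` on which the functions of the space with index `μ` vanish. -/
def vanishingSet : Fin 2 → Set ℝ
  | 0 => Icc (5 / 6) 1
  | 1 => Icc 0 (1 / 6)

/-- The smooth functions on `[0, T] × [0, 1]` (up to the boundary) that vanish for
`5/6 ≤ x ≤ 1` (if `μ = 0`), or for `0 ≤ x ≤ 1/6` (if `μ = 1`).  A function on the rectangle is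
represented by its extension by zero to `ℝ × ℝ`. -/
def smoothSubmodule (T : ℝ) (μ : Fin 2) : Submodule ℝ (ℝ × ℝ → ℝ) where
  carrier := {u | ContDiffOn ℝ (⊤ : ℕ∞) u (rect T) ∧ (∀ p, p ∉ rect T → u p = 0) ∧
    ∀ p ∈ rect T, p.2 ∈ vanishingSet μ → u p = 0}
  zero_mem' := ⟨contDiffOn_const, fun _ _ => rfl, fun _ _ _ => rfl⟩
  add_mem' := by
    rintro u v ⟨hu, hu', hu''⟩ ⟨hv, hv', hv''⟩
    exact ⟨hu.add hv, fun p hp => by simp [hu' p hp, hv' p hp],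
      fun p hp hx => by simp [hu'' p hp hx, hv'' p hp hx]⟩
  smul_mem' := by
    rintro c u ⟨hu, hu', hu''⟩
    exact ⟨contDiffOn_const.smul hu, fun p hp => by simp [hu' p hp],
      fun p hp hx => by simp [hu'' p hp hx]⟩

/-- The space `𝔈_[μ]`. It is a copy of the type of elements of `smoothSubmodule T μ`, so that it
does not carry the topology of pointwise convergence. -/
def E (T : ℝ) (μ : Fin 2) : Type := smoothSubmodule T μ

instance (T : ℝ) (μ : Fin 2) : AddCommGroup (E T μ) :=
  inferInstanceAs (AddCommGroup (smoothSubmodule T μ))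

instance (T : ℝ) (μ : Fin 2) : Module ℝ (E T μ) :=
  inferInstanceAs (Module ℝ (smoothSubmodule T μ))

/-- The function represented by an element of `𝔈_[μ]`. -/
def E.toFun {T : ℝ} {μ : Fin 2} (u : E T μ) : ℝ × ℝ → ℝ := u.1

/-- The `C^∞` topology of `𝔈_[μ]`: uniform convergence on the rectangle of every derivative
`∂_t^j ∂_x^k u`. -/
instance (T : ℝ) (μ : Fin 2) : TopologicalSpace (E T μ) :=
  TopologicalSpace.induced
    (fun (u : E T μ) (i : ℕ × ℕ) =>
      UniformFun.ofFun fun p : rect T => (dt T)^[i.1] (dx^[i.2] u.toFun) (p : ℝ × ℝ))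
    inferInstance

/-! ### The two gradings -/

/-- The operator `-∂_t²`. -/
def negDtt (T : ℝ) (u : ℝ × ℝ → ℝ) : ℝ × ℝ → ℝ := fun p => -(dt T (dt T u) p)

/-- The derivative in the variable `X = 1 - x`. -/
def dX (u : ℝ × ℝ → ℝ) : ℝ × ℝ → ℝ := fun p => -(dx u p)

/-- The operator `Δ_[0] = x d²/dx² + (5/2) d/dx`, and
the operator `Δ_[1] = X d²/dX² + (N/2) d/dX` with `X = 1 - x`. -/
def lap (N : ℝ) : Fin 2 → (ℝ × ℝ → ℝ) → ℝ × ℝ → ℝ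
  | 0, u => fun p => p.2 * dx (dx u) p + 5 / 2 * dx u p
  | 1, u => fun p => (1 - p.2) * dX (dX u) p + N / 2 * dX u p

/-- The operator `-Δ_[μ]`. -/
def negLap (N : ℝ) (μ : Fin 2) (u : ℝ × ℝ → ℝ) : ℝ × ℝ → ℝ := fun p => -(lap N μ u p)

/-- `(-∂_t²)^j (-Δ_[μ])^k u`. -/
def powOp (T N : ℝ) (μ : Fin 2) (j k : ℕ) (u : ℝ × ℝ → ℝ) : ℝ × ℝ → ℝ :=
  (negDtt T)^[j] ((negLap N μ)^[k] u)

/-- The pairs `(j, k)` with `j + k ≤ n`. -/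
def indices (n : ℕ) : Finset (ℕ × ℕ) :=
  (Finset.range (n + 1) ×ˢ Finset.range (n + 1)).filter fun i => i.1 + i.2 ≤ n

/-- The `L^∞` norm on the rectangle of a continuous function. -/
def linfNorm (T : ℝ) (f : ℝ × ℝ → ℝ) : ℝ := ⨆ p : rect T, |f p|

/-- The weight `x^(3/2)` for `μ = 0`, and `(1 - x)^(N/2 - 1)` for `μ = 1`. -/
def weight (N : ℝ) : Fin 2 → ℝ → ℝ
  | 0, x => x ^ (3 / 2 : ℝ)
  | 1, x => (1 - x) ^ (N / 2 - 1)

/-- The weighted `L²` norm `‖·‖_[μ]` of a function on `[0, 1]`. -/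
def weightedNorm (N : ℝ) (μ : Fin 2) (g : ℝ → ℝ) : ℝ :=
  Real.sqrt (∫ x in (0 : ℝ)..1, |g x| ^ 2 * weight N μ x)

/-- `‖u‖_[μ]n^(∞)`, the supremum over `j + k ≤ n` of `‖(-∂_t²)^j (-Δ_[μ])^k u‖_{L^∞}`. -/
def supGrading (T N : ℝ) (μ : Fin 2) (n : ℕ) (u : E T μ) : ℝ :=
  ⨆ i : indices n, linfNorm T (powOp T N μ i.1.1 i.1.2 u.toFun)

/-- `‖u‖_[μ]n^(2)`, the square root of the sum over `j + k ≤ n` of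
`∫₀ᵀ ‖(-∂_t²)^j (-Δ_[μ])^k u(t, ·)‖_[μ]² dt`. -/
def l2Grading (T N : ℝ) (μ : Fin 2) (n : ℕ) (u : E T μ) : ℝ :=
  Real.sqrt (∑ i ∈ indices n,
    ∫ t in (0 : ℝ)..T, weightedNorm N μ (fun x => powOp T N μ i.1 i.2 u.toFun (t, x)) ^ 2)

end SingularGrading

end

/-!
The operator `Λ_a = x ∂ₓ² + a ∂ₓ` is the radial part, in `x = r²`, of a quarter of the Laplacian in
dimension `2 a`.  The reflection `x ↦ 1 - x` (`flipX`, `side`, `toVanish`) turns `𝔈_[1]` and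
`△_[1]` into the space `vanishX T` of smooth functions vanishing for `x ≥ 5/6` and an operator
`Λ_a`, so that both cases concern `vanishX T` and some `a ≥ 1`.

*The parameter `a` can be changed.*  The identity `∂ₓ Λ_a = Λ_{a+1} ∂ₓ` together with the estimate
`sup |∂ₓ u| ≤ a⁻¹ sup |Λ_a u|` shows that the norms `sup |Λ_a ^ k u|` for different `a > 0` are
equivalent without any loss (`exists_supN_Lap_pow_le`, `exists_supG_le`), and that the supremum
grading defines the `C^∞` topology (`exists_derivN_le`, `exists_supG_le_derivN`).  One may therefore
take `a = 1/2`, for which `Λ_a = ¼ ∂_r²`: smooth functions of `x ≥ 0` are the smooth even functions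
of `r` (`contDiffOn_comp_sqrt`, `Op_fold`), and the singularity has disappeared.

*The tame splitting for `a = 1/2`.*  There is a Schwartz function supported in `[0, ∞)`, with
integral one, all of whose higher moments vanish (`exists_kernel`).  Averages over `p + δ v` with
this kernel approximate a smooth function to every order in `δ` (`abs_average_sub_le`), they only use
the values on a quadrant with corner `p`, and every derivative of them costs a factor `δ⁻¹`.  A
function in `vanishX T` is cut off in `t` and pulled back to the `(t, r)`-plane, with a weight `θ(r)`
such that `θ(r) + θ(-r) = 1` (`unfold`); no smooth extension beyond the rectangle is needed, because
the kernel is one-sided, the functions vanish for large `r`, and cutting off in `t` makes them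
vanish for `t` near `T`.  With the mollifications `S_k` at scale `exp (-k / 2)` the
series `∑ (S_{k+1} + S_k) (S_{k+1} - S_k)` telescopes to the identity; the second factors decrease
faster than any `exp (-n k)` and the first ones grow like `exp (n k)`, which is what a tame direct
summand of `Σ(B)` requires (`isTameDirectSummand_of_operators`).  Folding back (`foldMoll`) gives
smooth functions of `x`, and the reflection `t ↦ T - t` supplies the part removed by the cut-off
(`isTameDirectSummand_supG_half`).

*The `L²` grading.*  As `Λ_a = x^{1-a} ∂ₓ (x^a ∂ₓ)`, the weighted `L²` norm of `Λ_a v` bounds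
`x^{a/2} |∂ₓ v|`.  The identity `∂ₓ Λ_a = Λ_{a+1} ∂ₓ` carries this over to high derivatives, and
integration from `x = 1`, where the functions vanish, removes the weight
(`exists_sq_le_integral_Lap_pow`).  A Sobolev inequality in `t` concludes (`exists_supG_le_l2G`).
-/

noncomputable section

namespace SingularGrading

open MeasureTheory HamiltonTame
open scoped SchwartzMap BoundedContinuousFunction

section

/-! ### Differentiability from continuous partial derivatives -/

/-- A function on a product of two sets, the first one convex, is differentiable at a point if both
partial derivatives exist and the first one is continuous there. -/
theorem hasFDerivWithinAt_of_partial {I J : Set ℝ} (hI : Convex ℝ I) {f f₁ : ℝ × ℝ → ℝ}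
    {b : ℝ} {p : ℝ × ℝ} (hp : p ∈ I ×ˢ J)
    (h₁ : ∀ q ∈ I ×ˢ J, HasDerivWithinAt (fun s => f (s, q.2)) (f₁ q) I q.1)
    (h₂ : HasDerivWithinAt (fun y => f (p.1, y)) b J p.2)
    (c₁ : ContinuousWithinAt f₁ (I ×ˢ J) p) :
    HasFDerivWithinAt f (f₁ p • ContinuousLinearMap.fst ℝ ℝ ℝ + b • ContinuousLinearMap.snd ℝ ℝ ℝ)
      (I ×ˢ J) p := by
  rw [hasFDerivWithinAt_iff_isLittleO, Asymptotics.isLittleO_iff]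
  intro c hc
  rw [hasDerivWithinAt_iff_isLittleO, Asymptotics.isLittleO_iff] at h₂
  have h₂' := h₂ (half_pos hc)
  rw [Metric.continuousWithinAt_iff] at c₁
  obtain ⟨δ, hδ, hc₁⟩ := c₁ (c / 2) (half_pos hc)
  have hsnd : Tendsto Prod.snd (𝓝[I ×ˢ J] p) (𝓝[J] p.2) :=
    tendsto_nhdsWithin_iff.2 ⟨continuous_snd.continuousAt.mono_left nhdsWithin_le_nhds,
      eventually_nhdsWithin_of_forall fun q hq => hq.2⟩
  have hball : ∀ᶠ q in 𝓝[I ×ˢ J] p, q ∈ Metric.ball p δ :=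
    mem_nhdsWithin_of_mem_nhds (Metric.ball_mem_nhds p hδ)
  filter_upwards [hsnd.eventually h₂', hball, self_mem_nhdsWithin] with q hq₂ hqb hq
  -- The first variable is moved at the height of `q`, the second one at the abscissa of `p`.
  have hseg : ∀ s ∈ segment ℝ p.1 q.1, s ∈ I ∧ dist (s, q.2) p < δ := by
    intro s hs
    refine ⟨hI.segment_subset hp.1 hq.1 hs, ?_⟩
    have h1 : dist s p.1 ≤ dist q.1 p.1 := by
      have := segment_subset_closedBall_left p.1 q.1 hs
      rw [Metric.mem_closedBall] at this
      rwa [dist_comm q.1]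
    have h2 : dist q p < δ := hqb
    rw [Prod.dist_eq] at h2 ⊢
    exact lt_of_le_of_lt (max_le_max h1 le_rfl) h2
  have hA : ‖(f (q.1, q.2) - f₁ p * q.1) - (f (p.1, q.2) - f₁ p * p.1)‖ ≤ c / 2 * ‖q.1 - p.1‖ := by
    refine Convex.norm_image_sub_le_of_norm_hasDerivWithin_le
      (f := fun s => f (s, q.2) - f₁ p * s) (f' := fun s => f₁ (s, q.2) - f₁ p)
      (s := segment ℝ p.1 q.1) ?_ ?_ (convex_segment _ _) (left_mem_segment _ _ _)
      (right_mem_segment _ _ _)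
    · intro s hs
      have := (h₁ (s, q.2) ⟨(hseg s hs).1, hq.2⟩).mono (hI.segment_subset hp.1 hq.1)
      exact (this.sub ((hasDerivWithinAt_id s _).const_mul (f₁ p))).congr_deriv (by simp)
    · intro s hs
      have := hc₁ (x := (s, q.2)) ⟨(hseg s hs).1, hq.2⟩ (hseg s hs).2
      rw [dist_eq_norm] at this
      exact this.le
  have hn1 : ‖q.1 - p.1‖ ≤ ‖q - p‖ := norm_fst_le (q - p)
  have hn2 : ‖q.2 - p.2‖ ≤ ‖q - p‖ := norm_snd_le (q - p)
  have e : f q - f p - (f₁ p • ContinuousLinearMap.fst ℝ ℝ ℝ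
        + b • ContinuousLinearMap.snd ℝ ℝ ℝ) (q - p) =
      ((f (q.1, q.2) - f₁ p * q.1) - (f (p.1, q.2) - f₁ p * p.1)) +
      (f (p.1, q.2) - f (p.1, p.2) - (q.2 - p.2) • b) := by
    simp only [_root_.add_apply, _root_.smul_apply,
      ContinuousLinearMap.coe_fst', ContinuousLinearMap.coe_snd', Prod.fst_sub, Prod.snd_sub,
      smul_eq_mul]
    ring
  rw [e]
  refine (norm_add_le _ _).trans ?_
  nlinarith [hA, hq₂]

/-- A class of continuous functions on a product of two intervals each of whose members has both
partial derivatives in the class consists of smooth functions. -/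
theorem contDiffOn_of_partials {I J : Set ℝ} (hI : Convex ℝ I)
    (P : (ℝ × ℝ → ℝ) → Prop) (hcont : ∀ f, P f → ContinuousOn f (I ×ˢ J))
    (hpart : ∀ f, P f → ∃ f₁ f₂, P f₁ ∧ P f₂ ∧
      (∀ q ∈ I ×ˢ J, HasDerivWithinAt (fun s => f (s, q.2)) (f₁ q) I q.1) ∧
      (∀ q ∈ I ×ˢ J, HasDerivWithinAt (fun y => f (q.1, y)) (f₂ q) J q.2))
    {f : ℝ × ℝ → ℝ} (hf : P f) : ContDiffOn ℝ (⊤ : ℕ∞) f (I ×ˢ J) := by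
  have key : ∀ n : ℕ, ∀ f, P f → ContDiffOn ℝ n f (I ×ˢ J) := by
    intro n
    induction n with
    | zero => intro f hf; exact contDiffOn_zero.2 (hcont f hf)
    | succ n ih =>
      intro f hf
      obtain ⟨f₁, f₂, hf₁, hf₂, hd₁, hd₂⟩ := hpart f hf
      intro p hp
      push_cast
      refine (contDiffWithinAt_succ_iff_hasFDerivWithinAt (by simp)).2
        ⟨I ×ˢ J, by rw [insert_eq_of_mem hp]; exact self_mem_nhdsWithin, by simp,
        fun q => f₁ q • ContinuousLinearMap.fst ℝ ℝ ℝ + f₂ q • ContinuousLinearMap.snd ℝ ℝ ℝ,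
        fun q hq => hasFDerivWithinAt_of_partial hI hq hd₁ (hd₂ q hq) (hcont f₁ hf₁ q hq), ?_⟩
      exact (((ih f₁ hf₁).smul contDiffOn_const).add ((ih f₂ hf₂).smul contDiffOn_const)) p hp
  exact contDiffOn_infty.2 fun n => key n f hf

/-! ### The partial derivatives of smooth functions on the rectangle -/

variable {T : ℝ}

theorem uniqueDiffOn_rect (hT : 0 < T) : UniqueDiffOn ℝ (rect T) :=
  (uniqueDiffOn_Icc hT).prod (uniqueDiffOn_Icc one_pos)

theorem isCompact_rect : IsCompact (rect T) := isCompact_Icc.prod isCompact_Icc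

theorem dt_congr {f g : ℝ × ℝ → ℝ} (h : EqOn f g (rect T)) : EqOn (dt T f) (dt T g) (rect T) :=
  fun _ hp => derivWithin_congr (fun _ hs => h ⟨hs, hp.2⟩) (h hp)

theorem dx_congr {f g : ℝ × ℝ → ℝ} (h : EqOn f g (rect T)) : EqOn (dx f) (dx g) (rect T) :=
  fun _ hp => derivWithin_congr (fun _ hs => h ⟨hp.1, hs⟩) (h hp)

theorem hasDerivWithinAt_fst {I J : Set ℝ} {f : ℝ × ℝ → ℝ} {p : ℝ × ℝ} (hp : p ∈ I ×ˢ J)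
    (hf : DifferentiableWithinAt ℝ f (I ×ˢ J) p) :
    HasDerivWithinAt (fun s => f (s, p.2)) (fderivWithin ℝ f (I ×ˢ J) p (1, 0)) I p.1 := by
  have h := hf.hasFDerivWithinAt
  have hc : HasDerivWithinAt (fun s : ℝ => (s, p.2)) ((1 : ℝ), (0 : ℝ)) I p.1 :=
    (hasDerivWithinAt_id _ _).prodMk (hasDerivWithinAt_const _ _ _)
  exact HasFDerivWithinAt.comp_hasDerivWithinAt (x := p.1) h hc (fun s hs => ⟨hs, hp.2⟩)

theorem hasDerivWithinAt_snd {I J : Set ℝ} {f : ℝ × ℝ → ℝ} {p : ℝ × ℝ} (hp : p ∈ I ×ˢ J)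
    (hf : DifferentiableWithinAt ℝ f (I ×ˢ J) p) :
    HasDerivWithinAt (fun s => f (p.1, s)) (fderivWithin ℝ f (I ×ˢ J) p (0, 1)) J p.2 := by
  have h := hf.hasFDerivWithinAt
  have hc : HasDerivWithinAt (fun s : ℝ => (p.1, s)) ((0 : ℝ), (1 : ℝ)) J p.2 :=
    (hasDerivWithinAt_const _ _ _).prodMk (hasDerivWithinAt_id _ _)
  exact HasFDerivWithinAt.comp_hasDerivWithinAt (x := p.2) h hc (fun s hs => ⟨hp.1, hs⟩)

theorem dt_eq_fderivWithin (hT : 0 < T) {f : ℝ × ℝ → ℝ} {p : ℝ × ℝ} (hp : p ∈ rect T)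
    (hf : DifferentiableWithinAt ℝ f (rect T) p) :
    dt T f p = fderivWithin ℝ f (rect T) p (1, 0) :=
  (hasDerivWithinAt_fst hp hf).derivWithin (uniqueDiffOn_Icc hT p.1 hp.1)

theorem dx_eq_fderivWithin {f : ℝ × ℝ → ℝ} {p : ℝ × ℝ} (hp : p ∈ rect T)
    (hf : DifferentiableWithinAt ℝ f (rect T) p) :
    dx f p = fderivWithin ℝ f (rect T) p (0, 1) :=
  (hasDerivWithinAt_snd hp hf).derivWithin (uniqueDiffOn_Icc one_pos p.2 hp.2)

theorem hasDerivWithinAt_dt {f : ℝ × ℝ → ℝ} (hf : ContDiffOn ℝ (⊤ : ℕ∞) f (rect T))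
    (hT : 0 < T) {p : ℝ × ℝ} (hp : p ∈ rect T) :
    HasDerivWithinAt (fun s => f (s, p.2)) (dt T f p) (Icc 0 T) p.1 := by
  have hd := (hf p hp).differentiableWithinAt (by simp)
  rw [dt_eq_fderivWithin hT hp hd]
  exact hasDerivWithinAt_fst hp hd

theorem hasDerivWithinAt_dx {f : ℝ × ℝ → ℝ} (hf : ContDiffOn ℝ (⊤ : ℕ∞) f (rect T))
    {p : ℝ × ℝ} (hp : p ∈ rect T) :
    HasDerivWithinAt (fun y => f (p.1, y)) (dx f p) (Icc 0 1) p.2 := by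
  have hd := (hf p hp).differentiableWithinAt (by simp)
  rw [dx_eq_fderivWithin hp hd]
  exact hasDerivWithinAt_snd hp hd

theorem contDiffOn_dt {f : ℝ × ℝ → ℝ} (hf : ContDiffOn ℝ (⊤ : ℕ∞) f (rect T))
    (hT : 0 < T) : ContDiffOn ℝ (⊤ : ℕ∞) (dt T f) (rect T) := by
  have h := (hf.fderivWithin (m := (⊤ : ℕ∞)) (uniqueDiffOn_rect hT) (by simp)).clm_apply
    (contDiffOn_const (c := ((1 : ℝ), (0 : ℝ))))
  exact h.congr fun p hp => dt_eq_fderivWithin hT hp ((hf p hp).differentiableWithinAt (by simp))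

theorem contDiffOn_dx {f : ℝ × ℝ → ℝ} (hf : ContDiffOn ℝ (⊤ : ℕ∞) f (rect T))
    (hT : 0 < T) : ContDiffOn ℝ (⊤ : ℕ∞) (dx f) (rect T) := by
  have h := (hf.fderivWithin (m := (⊤ : ℕ∞)) (uniqueDiffOn_rect hT) (by simp)).clm_apply
    (contDiffOn_const (c := ((0 : ℝ), (1 : ℝ))))
  exact h.congr fun p hp => dx_eq_fderivWithin hp ((hf p hp).differentiableWithinAt (by simp))

theorem dt_dx_comm {f : ℝ × ℝ → ℝ} (hf : ContDiffOn ℝ (⊤ : ℕ∞) f (rect T))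
    (hT : 0 < T) : EqOn (dt T (dx f)) (dx (dt T f)) (rect T) := by
  intro p hp
  have hU := uniqueDiffOn_rect hT
  have hd : ∀ q ∈ rect T, DifferentiableWithinAt ℝ f (rect T) q :=
    fun q hq => (hf q hq).differentiableWithinAt (by simp)
  have h2 : ContDiffOn ℝ (⊤ : ℕ∞) (fderivWithin ℝ f (rect T)) (rect T) :=
    hf.fderivWithin hU (by simp)
  have hd2 : DifferentiableWithinAt ℝ (fderivWithin ℝ f (rect T)) (rect T) p :=
    (h2 p hp).differentiableWithinAt (by simp)
  have hsymm : IsSymmSndFDerivWithinAt ℝ f (rect T) p := by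
    refine ((hf p hp).of_le (m := 2) ?_).isSymmSndFDerivWithinAt (by simp) hU ?_ hp
    · exact WithTop.coe_le_coe.2 (le_top : (2 : ℕ∞) ≤ ⊤)
    · rw [rect, interior_prod_eq, interior_Icc, interior_Icc, closure_prod_eq,
        closure_Ioo hT.ne, closure_Ioo one_ne_zero.symm]
      exact hp
  have e1 : dt T (dx f) p = fderivWithin ℝ (fderivWithin ℝ f (rect T)) (rect T) p (1, 0) (0, 1) := by
    rw [dt_congr (fun q hq => dx_eq_fderivWithin hq (hd q hq)) hp,
      dt_eq_fderivWithin hT hp (hd2.clm_apply (differentiableWithinAt_const _)),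
      fderivWithin_clm_apply (hU p hp) hd2 (differentiableWithinAt_const _)]
    simp
  have e2 : dx (dt T f) p = fderivWithin ℝ (fderivWithin ℝ f (rect T)) (rect T) p (0, 1) (1, 0) := by
    rw [dx_congr (fun q hq => dt_eq_fderivWithin hT hq (hd q hq)) hp,
      dx_eq_fderivWithin hp (hd2.clm_apply (differentiableWithinAt_const _)),
      fderivWithin_clm_apply (hU p hp) hd2 (differentiableWithinAt_const _)]
    simp
  rw [e1, e2, hsymm]

end

section

variable {T : ℝ}

/-! ### The algebra of differential operators on the rectangle -/

/-- The smooth functions on the rectangle `rect T`, extended by zero. -/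
def Smooth (T : ℝ) : Submodule ℝ (ℝ × ℝ → ℝ) where
  carrier := {u | ContDiffOn ℝ (⊤ : ℕ∞) u (rect T) ∧ ∀ p, p ∉ rect T → u p = 0}
  zero_mem' := ⟨contDiffOn_const, fun _ _ => rfl⟩
  add_mem' := by
    rintro u v ⟨hu, hu'⟩ ⟨hv, hv'⟩
    exact ⟨hu.add hv, fun p hp => by simp [hu' p hp, hv' p hp]⟩
  smul_mem' := by
    rintro c u ⟨hu, hu'⟩
    exact ⟨contDiffOn_const.smul hu, fun p hp => by simp [hu' p hp]⟩

/-- The element of `Smooth T` which agrees on the rectangle with a given smooth function. -/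
def Smooth.mk {f : ℝ × ℝ → ℝ} (hf : ContDiffOn ℝ (⊤ : ℕ∞) f (rect T)) : Smooth T :=
  ⟨(rect T).indicator f, hf.congr fun _ hp => indicator_of_mem hp f,
    fun _ hp => indicator_of_notMem hp f⟩

theorem Smooth.mk_apply {f : ℝ × ℝ → ℝ} (hf : ContDiffOn ℝ (⊤ : ℕ∞) f (rect T)) {p : ℝ × ℝ}
    (hp : p ∈ rect T) : (Smooth.mk hf : ℝ × ℝ → ℝ) p = f p := indicator_of_mem hp f

theorem Smooth.ext {u v : Smooth T} (h : ∀ p ∈ rect T, (u : ℝ × ℝ → ℝ) p = (v : ℝ × ℝ → ℝ) p) :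
    u = v := by
  apply Subtype.ext
  funext p
  by_cases hp : p ∈ rect T
  · exact h p hp
  · rw [u.2.2 p hp, v.2.2 p hp]

theorem dt_add (hT : 0 < T) (u v : Smooth T) {p : ℝ × ℝ} (hp : p ∈ rect T) :
    dt T (u + v : Smooth T) p = dt T u p + dt T v p :=
  ((hasDerivWithinAt_dt u.2.1 hT hp).add (hasDerivWithinAt_dt v.2.1 hT hp)).derivWithin
    (uniqueDiffOn_Icc hT p.1 hp.1)

theorem dt_smul (hT : 0 < T) (c : ℝ) (u : Smooth T) {p : ℝ × ℝ} (hp : p ∈ rect T) :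
    dt T (c • u : Smooth T) p = c * dt T u p :=
  ((hasDerivWithinAt_dt u.2.1 hT hp).const_mul c).derivWithin (uniqueDiffOn_Icc hT p.1 hp.1)

theorem dx_add (u v : Smooth T) {p : ℝ × ℝ} (hp : p ∈ rect T) :
    dx (u + v : Smooth T) p = dx u p + dx v p :=
  ((hasDerivWithinAt_dx u.2.1 hp).add (hasDerivWithinAt_dx v.2.1 hp)).derivWithin
    (uniqueDiffOn_Icc one_pos p.2 hp.2)

theorem dx_smul (c : ℝ) (u : Smooth T) {p : ℝ × ℝ} (hp : p ∈ rect T) :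
    dx (c • u : Smooth T) p = c * dx u p :=
  ((hasDerivWithinAt_dx u.2.1 hp).const_mul c).derivWithin
    (uniqueDiffOn_Icc one_pos p.2 hp.2)

/-- Multiplication by `x`. -/
def Xop : Module.End ℝ (Smooth T) where
  toFun u := ⟨fun p => p.2 * (u : ℝ × ℝ → ℝ) p, contDiff_snd.contDiffOn.mul u.2.1,
    fun p hp => by simp [u.2.2 p hp]⟩
  map_add' u v := by ext p; simp [mul_add]
  map_smul' c u := by ext p; simp; ring

theorem Xop_apply (u : Smooth T) (p : ℝ × ℝ) :
    (Xop u : ℝ × ℝ → ℝ) p = p.2 * (u : ℝ × ℝ → ℝ) p := rfl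

theorem abs_apply_le_linfNorm (u : Smooth T) {p : ℝ × ℝ} (hp : p ∈ rect T) :
    |(u : ℝ × ℝ → ℝ) p| ≤ linfNorm T u := by
  have hb : BddAbove (range fun p : rect T => |(u : ℝ × ℝ → ℝ) p|) := by
    have h := isCompact_rect.bddAbove_image (u.2.1.continuousOn.abs)
    refine h.mono ?_
    rintro _ ⟨q, rfl⟩
    exact ⟨q, q.2, rfl⟩
  exact le_ciSup hb (⟨p, hp⟩ : rect T)

/-- If `|x f' + a f| ≤ C` on `[0, 1]`, then `|f| ≤ C / a`: the left-hand side is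
`x ^ (1 - a) (x ^ a f)'`. -/
theorem abs_le_of_euler_bound {f f' : ℝ → ℝ} {a C : ℝ} (ha : 0 < a)
    (hf : ∀ x ∈ Icc (0 : ℝ) 1, HasDerivWithinAt f (f' x) (Icc 0 1) x)
    (hC : ∀ x ∈ Icc (0 : ℝ) 1, |x * f' x + a * f x| ≤ C) {x : ℝ} (hx : x ∈ Icc (0 : ℝ) 1) :
    |f x| ≤ C / a := by
  -- One-sided bound; the other one follows by applying it to `-f`.
  have key : ∀ g g' : ℝ → ℝ, (∀ x ∈ Icc (0 : ℝ) 1, HasDerivWithinAt g (g' x) (Icc 0 1) x) →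
      (∀ x ∈ Icc (0 : ℝ) 1, x * g' x + a * g x ≤ C) → g x ≤ C / a := by
    intro g g' hg hgC
    rcases eq_or_lt_of_le hx.1 with h0 | h0
    · have := hgC x hx
      rw [← h0, zero_mul, zero_add, h0] at this
      rw [le_div_iff₀ ha]; linarith
    have hanti : AntitoneOn (fun s => s ^ a * (g s - C / a)) (Icc 0 1) := by
      have hcont : ContinuousOn (fun s => s ^ a * (g s - C / a)) (Icc 0 1) :=
        (Real.continuous_rpow_const ha.le).continuousOn.mul
          (ContinuousOn.sub (fun s hs => (hg s hs).continuousWithinAt) continuousOn_const)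
      have hder : ∀ s ∈ interior (Icc (0 : ℝ) 1), HasDerivAt (fun s => s ^ a * (g s - C / a))
          (a * s ^ (a - 1) * (g s - C / a) + s ^ a * g' s) s := by
        intro s hs
        rw [interior_Icc] at hs
        have h1 := (hg s ⟨hs.1.le, hs.2.le⟩).hasDerivAt (Icc_mem_nhds hs.1 hs.2)
        exact (Real.hasDerivAt_rpow_const (p := a) (Or.inl hs.1.ne')).mul (h1.sub_const _)
      refine antitoneOn_of_deriv_nonpos (convex_Icc 0 1) hcont
        (fun s hs => (hder s hs).differentiableAt.differentiableWithinAt) fun s hs => ?_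
      rw [(hder s hs).deriv]
      rw [interior_Icc] at hs
      have h2 : s ^ a = s ^ (a - 1) * s := by
        rw [← Real.rpow_add_one hs.1.ne', sub_add_cancel]
      have h3 := hgC s ⟨hs.1.le, hs.2.le⟩
      have h4 : a * s ^ (a - 1) * (g s - C / a) + s ^ a * g' s
          = s ^ (a - 1) * (s * g' s + a * g s - C) := by
        rw [h2]; field_simp; ring
      rw [h4]
      exact mul_nonpos_of_nonneg_of_nonpos (Real.rpow_nonneg hs.1.le _) (by linarith)
    have h5 := hanti (left_mem_Icc.2 zero_le_one) hx hx.1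
    simp only [Real.zero_rpow ha.ne', zero_mul] at h5
    have h6 := Real.rpow_pos_of_pos h0 a
    by_contra hcon
    push Not at hcon
    have := mul_pos h6 (sub_pos.2 hcon)
    linarith
  rw [abs_le]
  constructor
  · have := key (fun s => -f s) (fun s => -f' s) (fun s hs => (hf s hs).neg)
      (fun s hs => by have := (abs_le.1 (hC s hs)).1; linarith)
    linarith
  · exact key f f' hf fun s hs => (abs_le.1 (hC s hs)).2

/-- A Landau inequality: a first derivative is controlled by the function and its second
derivative. -/
theorem abs_deriv_le_of_bounds {h h' h'' : ℝ → ℝ} {A B : ℝ} (hT : 0 < T)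
    (d₁ : ∀ t ∈ Icc 0 T, HasDerivWithinAt h (h' t) (Icc 0 T) t)
    (d₂ : ∀ t ∈ Icc 0 T, HasDerivWithinAt h' (h'' t) (Icc 0 T) t)
    (hA : ∀ t ∈ Icc 0 T, |h t| ≤ A) (hB : ∀ t ∈ Icc 0 T, |h'' t| ≤ B) {t : ℝ} (ht : t ∈ Icc 0 T) :
    |h' t| ≤ 2 / T * A + T * B := by
  obtain ⟨c, hc, hc'⟩ := exists_hasDerivAt_eq_slope h h' hT
    (fun s hs => (d₁ s hs).continuousWithinAt)
    (fun s hs => (d₁ s ⟨hs.1.le, hs.2.le⟩).hasDerivAt (Icc_mem_nhds hs.1 hs.2))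
  have h0 := hA 0 ⟨le_rfl, hT.le⟩
  have h1 := hA T ⟨hT.le, le_rfl⟩
  have hcb : |h' c| ≤ 2 / T * A := by
    rw [hc', sub_zero, abs_div, abs_of_pos hT, div_mul_eq_mul_div]
    gcongr
    exact (abs_sub _ _).trans (by linarith)
  have hm := (convex_Icc 0 T).norm_image_sub_le_of_norm_hasDerivWithin_le d₂ hB
    ⟨hc.1.le, hc.2.le⟩ ht
  have hB0 : 0 ≤ B := (abs_nonneg _).trans (hB t ht)
  have h3 : ‖t - c‖ ≤ T := by
    rw [Real.norm_eq_abs, abs_le]; constructor <;> linarith [ht.1, ht.2, hc.1, hc.2]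
  have h4 : |h' t - h' c| ≤ T * B := by
    rw [mul_comm]; exact hm.trans (mul_le_mul_of_nonneg_left h3 hB0)
  calc |h' t| = |h' c + (h' t - h' c)| := by ring_nf
    _ ≤ |h' c| + |h' t - h' c| := abs_add_le _ _
    _ ≤ _ := add_le_add hcb h4

variable [hT : Fact (0 < T)]

/-- The derivative in `t`. -/
def Dt : Module.End ℝ (Smooth T) where
  toFun u := Smooth.mk (contDiffOn_dt u.2.1 hT.out)
  map_add' u v := Smooth.ext fun _ hp => (Smooth.mk_apply _ hp).trans
    ((dt_add hT.out u v hp).trans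
      (congrArg₂ (· + ·) (Smooth.mk_apply _ hp).symm (Smooth.mk_apply _ hp).symm))
  map_smul' c u := Smooth.ext fun _ hp => (Smooth.mk_apply _ hp).trans
    ((dt_smul hT.out c u hp).trans (congrArg (c * ·) (Smooth.mk_apply _ hp).symm))

/-- The derivative in `x`. -/
def Dx : Module.End ℝ (Smooth T) where
  toFun u := Smooth.mk (contDiffOn_dx u.2.1 hT.out)
  map_add' u v := Smooth.ext fun _ hp => (Smooth.mk_apply _ hp).trans
    ((dx_add u v hp).trans
      (congrArg₂ (· + ·) (Smooth.mk_apply _ hp).symm (Smooth.mk_apply _ hp).symm))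
  map_smul' c u := Smooth.ext fun _ hp => (Smooth.mk_apply _ hp).trans
    ((dx_smul c u hp).trans (congrArg (c * ·) (Smooth.mk_apply _ hp).symm))

theorem Dt_apply (u : Smooth T) {p : ℝ × ℝ} (hp : p ∈ rect T) :
    (Dt u : ℝ × ℝ → ℝ) p = dt T u p :=
  Smooth.mk_apply (contDiffOn_dt u.2.1 hT.out) hp

theorem Dx_apply (u : Smooth T) {p : ℝ × ℝ} (hp : p ∈ rect T) :
    (Dx u : ℝ × ℝ → ℝ) p = dx u p :=
  Smooth.mk_apply (contDiffOn_dx u.2.1 hT.out) hp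

theorem hasDerivWithinAt_Dt (u : Smooth T) {p : ℝ × ℝ} (hp : p ∈ rect T) :
    HasDerivWithinAt (fun s => (u : ℝ × ℝ → ℝ) (s, p.2)) ((Dt u : ℝ × ℝ → ℝ) p) (Icc 0 T) p.1 := by
  rw [Dt_apply u hp]; exact hasDerivWithinAt_dt u.2.1 hT.out hp

theorem hasDerivWithinAt_Dx (u : Smooth T) {p : ℝ × ℝ} (hp : p ∈ rect T) :
    HasDerivWithinAt (fun y => (u : ℝ × ℝ → ℝ) (p.1, y)) ((Dx u : ℝ × ℝ → ℝ) p) (Icc 0 1) p.2 := by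
  rw [Dx_apply u hp]; exact hasDerivWithinAt_dx u.2.1 hp

theorem Dt_eq_of_hasDerivWithinAt {u : Smooth T} {p : ℝ × ℝ} (hp : p ∈ rect T) {d : ℝ}
    (h : HasDerivWithinAt (fun s => (u : ℝ × ℝ → ℝ) (s, p.2)) d (Icc 0 T) p.1) :
    (Dt u : ℝ × ℝ → ℝ) p = d := by
  rw [Dt_apply u hp]; exact h.derivWithin (uniqueDiffOn_Icc hT.out p.1 hp.1)

theorem Dx_eq_of_hasDerivWithinAt {u : Smooth T} {p : ℝ × ℝ} (hp : p ∈ rect T) {d : ℝ}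
    (h : HasDerivWithinAt (fun y => (u : ℝ × ℝ → ℝ) (p.1, y)) d (Icc 0 1) p.2) :
    (Dx u : ℝ × ℝ → ℝ) p = d := by
  rw [Dx_apply u hp]; exact h.derivWithin (uniqueDiffOn_Icc one_pos p.2 hp.2)

theorem commute_Dt_Dx : Commute (Dt : Module.End ℝ (Smooth T)) Dx := by
  refine LinearMap.ext fun u => Smooth.ext fun p hp => ?_
  simp only [Module.End.mul_apply]
  rw [Dt_apply _ hp, Dx_apply _ hp, dt_congr (fun q hq => Dx_apply u hq) hp,
    dx_congr (fun q hq => Dt_apply u hq) hp]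
  exact dt_dx_comm u.2.1 hT.out hp

theorem Dt_mul_Xop : (Dt * Xop : Module.End ℝ (Smooth T)) = Xop * Dt := by
  refine LinearMap.ext fun u => Smooth.ext fun p hp => ?_
  exact Dt_eq_of_hasDerivWithinAt hp ((hasDerivWithinAt_Dt u hp).const_mul p.2)

theorem Dx_mul_Xop : (Dx * Xop : Module.End ℝ (Smooth T)) = Xop * Dx + 1 := by
  refine LinearMap.ext fun u => Smooth.ext fun p hp => ?_
  refine (Dx_eq_of_hasDerivWithinAt (u := Xop u) hp
    ((hasDerivWithinAt_id _ _).mul (hasDerivWithinAt_Dx u hp))).trans ?_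
  simp [Xop_apply]
  ring

/-- The operator `Λ_a = x ∂ₓ² + a ∂ₓ`. -/
def Lap (a : ℝ) : Module.End ℝ (Smooth T) := Xop * Dx * Dx + a • Dx

theorem Lap_apply (a : ℝ) (u : Smooth T) (p : ℝ × ℝ) :
    (Lap a u : ℝ × ℝ → ℝ) p =
      p.2 * (Dx (Dx u) : ℝ × ℝ → ℝ) p + a * (Dx u : ℝ × ℝ → ℝ) p := by
  simp [Lap, Xop_apply]

theorem Dx_mul_Lap (a : ℝ) : (Dx * Lap a : Module.End ℝ (Smooth T)) = Lap (a + 1) * Dx := by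
  have h := Dx_mul_Xop (T := T)
  simp only [Lap, mul_add, add_mul, ← mul_assoc, h, add_smul, one_smul, mul_smul_comm,
    smul_mul_assoc, one_mul]
  abel

theorem Dx_mul_Lap_pow (a : ℝ) (k : ℕ) :
    (Dx * Lap a ^ k : Module.End ℝ (Smooth T)) = Lap (a + 1) ^ k * Dx := by
  induction k with
  | zero => simp
  | succ k ih => rw [pow_succ, ← mul_assoc, ih, mul_assoc, Dx_mul_Lap, ← mul_assoc, pow_succ]

theorem commute_Dt_Lap (a : ℝ) : Commute (Dt : Module.End ℝ (Smooth T)) (Lap a) := by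
  have h1 := commute_Dt_Dx (T := T)
  have h2 : Commute (Dt : Module.End ℝ (Smooth T)) Xop := Dt_mul_Xop
  exact ((h2.mul_right h1).mul_right h1).add_right (h1.smul_right a)

theorem Lap_eq_add (a b : ℝ) : (Lap b : Module.End ℝ (Smooth T)) = Lap a + (b - a) • Dx := by
  rw [Lap, Lap]; module

/-! ### Supremum norm estimates -/

theorem rect_nonempty : Nonempty (rect T) :=
  ⟨⟨(0, 0), ⟨⟨le_rfl, hT.out.le⟩, ⟨le_rfl, zero_le_one⟩⟩⟩⟩

theorem linfNorm_le {f : ℝ × ℝ → ℝ} {C : ℝ} (h : ∀ p ∈ rect T, |f p| ≤ C) : linfNorm T f ≤ C := by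
  have := rect_nonempty (T := T)
  exact ciSup_le fun p => h p p.2

/-- The supremum norm on smooth functions. -/
def supN : Seminorm ℝ (Smooth T) :=
  Seminorm.of (fun u => linfNorm T u)
    (fun u v => linfNorm_le fun p hp => (abs_add_le _ _).trans
      (add_le_add (abs_apply_le_linfNorm u hp) (abs_apply_le_linfNorm v hp)))
    (fun c u => by
      have h1 : ∀ (c : ℝ) (u : Smooth T), linfNorm T (c • u : Smooth T) ≤ ‖c‖ * linfNorm T u :=
        fun c u => linfNorm_le fun p hp => by
          have : ((c • u : Smooth T) : ℝ × ℝ → ℝ) p = c * (u : ℝ × ℝ → ℝ) p := rfl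
          rw [this, abs_mul]
          exact mul_le_mul_of_nonneg_left (abs_apply_le_linfNorm u hp) (abs_nonneg c)
      refine le_antisymm (h1 c u) ?_
      rcases eq_or_ne c 0 with rfl | hc
      · rw [norm_zero, zero_mul]
        exact Real.iSup_nonneg fun _ => abs_nonneg _
      · have := h1 c⁻¹ (c • u)
        rw [inv_smul_smul₀ hc, norm_inv] at this
        rwa [← le_inv_mul_iff₀ (norm_pos_iff.2 hc)])

theorem supN_eq (u : Smooth T) : supN u = linfNorm T u := rfl

theorem abs_apply_le (u : Smooth T) {p : ℝ × ℝ} (hp : p ∈ rect T) :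
    |(u : ℝ × ℝ → ℝ) p| ≤ supN u := abs_apply_le_linfNorm u hp

theorem supN_le {u : Smooth T} {C : ℝ} (h : ∀ p ∈ rect T, |(u : ℝ × ℝ → ℝ) p| ≤ C) : supN u ≤ C :=
  linfNorm_le h

theorem supN_Dx_le {a : ℝ} (ha : 0 < a) (u : Smooth T) : supN (Dx u) ≤ a⁻¹ * supN (Lap a u) := by
  refine supN_le fun p hp => ?_
  have hp' : ∀ x ∈ Icc (0 : ℝ) 1, (p.1, x) ∈ rect T := fun x hx => ⟨hp.1, hx⟩
  have := abs_le_of_euler_bound (f := fun x => (Dx u : ℝ × ℝ → ℝ) (p.1, x))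
    (f' := fun x => (Dx (Dx u) : ℝ × ℝ → ℝ) (p.1, x)) (C := supN (Lap a u)) ha
    (fun x hx => hasDerivWithinAt_Dx (Dx u) (hp' x hx))
    (fun x hx => by
      have := abs_apply_le (Lap a u) (hp' x hx)
      rwa [Lap_apply] at this) hp.2
  rw [div_eq_inv_mul] at this
  exact this

/-- The powers of `Λ_a` control the derivatives in `x`, because `∂ₓ Λ_a = Λ_{a+1} ∂ₓ`. -/
theorem exists_supN_Dx_pow_le (k : ℕ) {a : ℝ} (ha : 0 < a) :
    ∃ C : ℝ, 0 ≤ C ∧ ∀ u : Smooth T, supN ((Dx ^ k) u) ≤ C * supN ((Lap a ^ k) u) := by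
  induction k generalizing a with
  | zero => exact ⟨1, zero_le_one, fun u => by simp⟩
  | succ k ih =>
    obtain ⟨C, hC, h⟩ := ih (a := a + 1) (by linarith)
    refine ⟨C * a⁻¹, by positivity, fun u => ?_⟩
    have e : (Lap (a + 1) ^ k) (Dx u) = Dx ((Lap a ^ k) u) := by
      rw [← Module.End.mul_apply, ← Dx_mul_Lap_pow, Module.End.mul_apply]
    calc supN ((Dx ^ (k + 1)) u) = supN ((Dx ^ k) (Dx u)) := by rw [pow_succ]; rfl
      _ ≤ C * supN ((Lap (a + 1) ^ k) (Dx u)) := h _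
      _ ≤ C * (a⁻¹ * supN (Lap a ((Lap a ^ k) u))) := by
          rw [e]; exact mul_le_mul_of_nonneg_left (supN_Dx_le ha _) hC
      _ = C * a⁻¹ * supN ((Lap a ^ (k + 1)) u) := by rw [pow_succ', mul_assoc]; rfl

/-- The powers of the operators `Λ_a` for different `a > 0` control each other, without loss. -/
theorem exists_supN_Lap_pow_le (k : ℕ) {a b : ℝ} (ha : 0 < a) (hb : 0 < b) :
    ∃ C : ℝ, 0 ≤ C ∧ ∀ u : Smooth T, supN ((Lap b ^ k) u) ≤ C * supN ((Lap a ^ k) u) := by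
  induction k generalizing a b with
  | zero => exact ⟨1, zero_le_one, fun u => by simp⟩
  | succ k ih =>
    obtain ⟨C, hC, h⟩ := ih ha hb
    obtain ⟨C', hC', h'⟩ := ih (a := a + 1) (by linarith) ha
    refine ⟨C * (1 + |b - a| * (C' * a⁻¹)), by positivity, fun u => ?_⟩
    have e1 : (Lap b ^ (k + 1)) u = (Lap b ^ k) (Lap b u) := by rw [pow_succ]; rfl
    have e2 : (Lap a ^ k) (Lap b u) = (Lap a ^ (k + 1)) u + (b - a) • (Lap a ^ k) (Dx u) := by
      rw [Lap_eq_add a b, pow_succ]; simp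
    have e3 : (Lap (a + 1) ^ k) (Dx u) = Dx ((Lap a ^ k) u) := by
      rw [← Module.End.mul_apply, ← Dx_mul_Lap_pow, Module.End.mul_apply]
    have h3 : supN ((Lap a ^ k) (Dx u)) ≤ C' * a⁻¹ * supN ((Lap a ^ (k + 1)) u) := by
      refine (h' _).trans ?_
      rw [e3, mul_assoc, pow_succ']
      exact mul_le_mul_of_nonneg_left (supN_Dx_le ha _) hC'
    calc supN ((Lap b ^ (k + 1)) u) ≤ C * supN ((Lap a ^ k) (Lap b u)) := by rw [e1]; exact h _
      _ ≤ C * (supN ((Lap a ^ (k + 1)) u) + |b - a| * supN ((Lap a ^ k) (Dx u))) := by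
          refine mul_le_mul_of_nonneg_left ?_ hC
          rw [e2]
          refine (map_add_le_add _ _ _).trans ?_
          rw [map_smul_eq_mul, Real.norm_eq_abs]
      _ ≤ C * (supN ((Lap a ^ (k + 1)) u)
            + |b - a| * (C' * a⁻¹ * supN ((Lap a ^ (k + 1)) u))) := by gcongr
      _ = _ := by ring

/-- Conversely, the derivatives in `x` of order at most `2 k` control `Λ_a ^ k u`. -/
theorem supN_Lap_pow_le (k : ℕ) (a : ℝ) : ∃ C : ℝ, 0 ≤ C ∧ ∀ u : Smooth T,
    supN ((Lap a ^ k) u) ≤ C * ∑ i ∈ Finset.range (2 * k + 1), supN ((Dx ^ i) u) := by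
  have hX : ∀ v : Smooth T, supN (Xop v) ≤ supN v := fun v => supN_le fun p hp => by
    rw [Xop_apply, abs_mul, abs_of_nonneg hp.2.1]
    exact (mul_le_of_le_one_left (abs_nonneg _) hp.2.2).trans (abs_apply_le v hp)
  have hL : ∀ (a : ℝ) (v : Smooth T), supN (Lap a v) ≤ supN (Dx (Dx v)) + |a| * supN (Dx v) := by
    intro a v
    refine (map_add_le_add supN (Xop (Dx (Dx v))) (a • Dx v)).trans ?_
    rw [map_smul_eq_mul, Real.norm_eq_abs]
    gcongr
    exact hX _
  induction k generalizing a with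
  | zero => exact ⟨1, zero_le_one, fun u => by simp⟩
  | succ k ih =>
    obtain ⟨C, hC, h⟩ := ih a
    have hD : ∀ (i : ℕ), ((Dx ^ i * Lap a : Module.End ℝ (Smooth T))) = Lap (a + i) * Dx ^ i := by
      intro i
      induction i with
      | zero => simp
      | succ i ih =>
        rw [pow_succ', mul_assoc, ih, ← mul_assoc, Dx_mul_Lap, mul_assoc]
        push_cast; rw [add_assoc]
    refine ⟨C * ∑ i ∈ Finset.range (2 * k + 1), (1 + |a + i|), by positivity, fun u => ?_⟩
    rw [pow_succ, Module.End.mul_apply, mul_assoc]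
    refine (h _).trans (mul_le_mul_of_nonneg_left ?_ hC)
    rw [Finset.sum_mul]
    refine Finset.sum_le_sum fun i hi => ?_
    rw [← Module.End.mul_apply, hD]
    refine (hL _ _).trans ?_
    rw [Finset.mem_range] at hi
    have hS : ∀ j, j < 2 * (k + 1) + 1 →
        supN ((Dx ^ j) u) ≤ ∑ i ∈ Finset.range (2 * (k + 1) + 1), supN ((Dx ^ i) u) := fun j hj =>
      Finset.single_le_sum (f := fun i => supN ((Dx ^ i) u)) (fun _ _ => apply_nonneg _ _)
        (Finset.mem_range.2 hj)
    have h1 := hS (i + 1) (by omega)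
    have h2 := hS (i + 2) (by omega)
    rw [pow_succ'] at h1
    rw [pow_succ', pow_succ'] at h2
    rw [add_mul, one_mul]
    exact add_le_add h2 (mul_le_mul_of_nonneg_left h1 (abs_nonneg _))

theorem supN_Dt_le (u : Smooth T) :
    supN (Dt u) ≤ 2 / T * supN u + T * supN (Dt (Dt u)) :=
  supN_le fun p hp => by
    have hp' : ∀ s ∈ Icc 0 T, (s, p.2) ∈ rect T := fun x hx => ⟨hx, hp.2⟩
    exact abs_deriv_le_of_bounds hT.out (h := fun s => (u : ℝ × ℝ → ℝ) (s, p.2))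
      (fun s hs => hasDerivWithinAt_Dt u (hp' s hs))
      (fun s hs => hasDerivWithinAt_Dt (Dt u) (hp' s hs))
      (fun s hs => abs_apply_le u (hp' s hs)) (fun s hs => abs_apply_le _ (hp' s hs)) hp.1

end

section

variable {T : ℝ}

/-! ### The supremum gradings and the derivatives in `t` and `x` -/

theorem mem_indices {n : ℕ} {i : ℕ × ℕ} : i ∈ indices n ↔ i.1 + i.2 ≤ n := by
  simp only [indices, Finset.mem_filter, Finset.mem_product, Finset.mem_range]
  omega

theorem indices_mono {m n : ℕ} (h : m ≤ n) : indices m ⊆ indices n := fun i hi => by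
  rw [mem_indices] at hi ⊢; omega

variable [hT : Fact (0 < T)]

/-- The operator `∂_t ^ (2 j) Λ_a ^ k`. -/
def Op (a : ℝ) (j k : ℕ) : Module.End ℝ (Smooth T) := Dt ^ (2 * j) * Lap a ^ k

/-- The grading by the supremum norms of `∂_t ^ (2 j) Λ_a ^ k u`, `j + k ≤ n`. -/
def supG (a : ℝ) (n : ℕ) : Seminorm ℝ (Smooth T) :=
  (indices n).sup fun i => supN.comp (Op a i.1 i.2)

/-- The operator `∂_t ^ j ∂ₓ ^ k`. -/
def derivOp (i : ℕ × ℕ) : Module.End ℝ (Smooth T) := Dt ^ i.1 * Dx ^ i.2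

/-- The seminorms `sup |∂_t ^ j ∂ₓ ^ k u|`, which define the `C^∞` topology. -/
def derivN (i : ℕ × ℕ) : Seminorm ℝ (Smooth T) := supN.comp (derivOp i)

theorem supN_Op_le_supG (a : ℝ) {n j k : ℕ} (h : j + k ≤ n) (u : Smooth T) :
    supN (Op a j k u) ≤ supG a n u :=
  Seminorm.le_def.1 (Finset.le_sup (f := fun i : ℕ × ℕ => supN.comp (Op (T := T) a i.1 i.2))
    (mem_indices.2 h : ((j, k) : ℕ × ℕ) ∈ indices n)) u

theorem supG_le {a : ℝ} {n : ℕ} {u : Smooth T} {C : ℝ} (hC : 0 ≤ C)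
    (h : ∀ j k, j + k ≤ n → supN (Op a j k u) ≤ C) : supG a n u ≤ C :=
  Seminorm.finset_sup_apply_le hC fun i hi => h i.1 i.2 (mem_indices.1 hi)

theorem supG_mono (a : ℝ) {m n : ℕ} (h : m ≤ n) (u : Smooth T) : supG a m u ≤ supG a n u :=
  supG_le (apply_nonneg _ _) fun _ _ hjk => supN_Op_le_supG a (hjk.trans h) u

theorem supG_zero (a : ℝ) (u : Smooth T) : supG a 0 u = supN u := by
  refine le_antisymm (supG_le (apply_nonneg _ _) fun j k h => ?_) ?_
  · obtain ⟨rfl, rfl⟩ : j = 0 ∧ k = 0 := by omega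
    simp [Op]
  · simpa [Op] using supN_Op_le_supG a (n := 0) (j := 0) (k := 0) le_rfl u

/-- The gradings with different positive parameters are equivalent without any loss. -/
theorem exists_supG_le (n : ℕ) {a b : ℝ} (ha : 0 < a) (hb : 0 < b) :
    ∃ C : ℝ, 0 ≤ C ∧ ∀ u : Smooth T, supG b n u ≤ C * supG a n u := by
  choose C hC h using fun k => exists_supN_Lap_pow_le (T := T) k ha hb
  refine ⟨∑ k ∈ Finset.range (n + 1), C k, Finset.sum_nonneg fun k _ => hC k, fun u => ?_⟩
  refine supG_le (mul_nonneg (Finset.sum_nonneg fun k _ => hC k) (apply_nonneg _ _)) ?_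
  intro j k hjk
  have e : ∀ c : ℝ, Op c j k u = (Lap c ^ k) ((Dt ^ (2 * j)) u) := fun c => by
    rw [Op, ((commute_Dt_Lap c).pow_pow _ _).eq]; rfl
  rw [e]
  refine (h k _).trans ?_
  rw [← e]
  refine mul_le_mul ?_ (supN_Op_le_supG a hjk u) (apply_nonneg _ _)
    (Finset.sum_nonneg fun k _ => hC k)
  exact Finset.single_le_sum (f := C) (fun k _ => hC k) (Finset.mem_range.2 (by omega))

/-- Derivatives in `t` of odd order are controlled at the cost of one degree. -/
theorem exists_supN_Dt_pow_Lap_le (a : ℝ) {m k n : ℕ} (h : m / 2 + k + 1 ≤ n) :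
    ∃ C : ℝ, 0 ≤ C ∧ ∀ u : Smooth T, supN ((Dt ^ m) ((Lap a ^ k) u)) ≤ C * supG a n u := by
  have hT' := hT.out
  have he : ∀ (j : ℕ) (u : Smooth T), j + k ≤ n →
      supN ((Dt ^ (2 * j)) ((Lap a ^ k) u)) ≤ supG a n u := fun j u hj => supN_Op_le_supG a hj u
  obtain ⟨i, hi | hi⟩ := Nat.even_or_odd' m
  · exact ⟨1, zero_le_one, fun u => by rw [one_mul, hi]; exact he i u (by omega)⟩
  · refine ⟨2 / T + T, by positivity, fun u => ?_⟩
    have h1 := supN_Dt_le ((Dt ^ (2 * i)) ((Lap a ^ k) u))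
    have h2 := he (i + 1) u (by omega)
    rw [show 2 * (i + 1) = 2 * i + 1 + 1 by ring, pow_succ', pow_succ'] at h2
    rw [hi, pow_succ', add_mul]
    refine h1.trans (add_le_add ?_ ?_)
    · exact mul_le_mul_of_nonneg_left (he i u (by omega)) (by positivity)
    · exact mul_le_mul_of_nonneg_left h2 hT'.le

theorem exists_derivN_le {a : ℝ} (ha : 0 < a) (i : ℕ × ℕ) :
    ∃ C : ℝ, 0 ≤ C ∧ ∀ u : Smooth T, derivN i u ≤ C * supG a (i.1 / 2 + i.2 + 1) u := by
  obtain ⟨C, hC, h⟩ := exists_supN_Dx_pow_le (T := T) i.2 ha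
  obtain ⟨C', hC', h'⟩ := exists_supN_Dt_pow_Lap_le (T := T) a (le_refl (i.1 / 2 + i.2 + 1))
  refine ⟨C * C', by positivity, fun u => ?_⟩
  have e1 : derivN i u = supN ((Dx ^ i.2) ((Dt ^ i.1) u)) := by
    rw [derivN, Seminorm.comp_apply, derivOp,
      ((commute_Dt_Dx (T := T)).pow_pow i.1 i.2).eq]; rfl
  have e2 : (Lap a ^ i.2) ((Dt ^ i.1) u) = (Dt ^ i.1) ((Lap a ^ i.2) u) := by
    rw [← Module.End.mul_apply, ← ((commute_Dt_Lap a).pow_pow _ _).eq]; rfl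
  rw [e1, mul_assoc]
  refine (h _).trans (mul_le_mul_of_nonneg_left ?_ hC)
  rw [e2]
  exact h' u

theorem exists_supG_le_derivN (a : ℝ) (n : ℕ) : ∃ (s : Finset (ℕ × ℕ)) (C : ℝ), 0 ≤ C ∧
    ∀ u : Smooth T, supG a n u ≤ C * ∑ i ∈ s, derivN i u := by
  choose C hC h using fun k => supN_Lap_pow_le (T := T) k a
  have hC0 : 0 ≤ ∑ k ∈ Finset.range (n + 1), C k := Finset.sum_nonneg fun k _ => hC k
  refine ⟨Finset.range (2 * n + 1) ×ˢ Finset.range (2 * n + 1),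
    ∑ k ∈ Finset.range (n + 1), C k, hC0, fun u => ?_⟩
  have hD : ∀ i : ℕ × ℕ, 0 ≤ derivN i u := fun i => apply_nonneg _ _
  refine supG_le (mul_nonneg hC0 (Finset.sum_nonneg fun i _ => hD i)) ?_
  intro j k hjk
  rw [Op, ((commute_Dt_Lap a).pow_pow _ _).eq]
  refine (h k _).trans (mul_le_mul ?_ ?_ (Finset.sum_nonneg fun i _ => apply_nonneg _ _) hC0)
  · exact Finset.single_le_sum (f := C) (fun k _ => hC k) (Finset.mem_range.2 (by omega))
  · have e : ∀ i, supN ((Dx ^ i) ((Dt ^ (2 * j)) u)) = derivN (2 * j, i) u := fun i => by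
      rw [derivN, Seminorm.comp_apply, derivOp,
        ((commute_Dt_Dx (T := T)).pow_pow (2 * j) i).eq]; rfl
    simp only [e]
    calc ∑ i ∈ Finset.range (2 * k + 1), derivN (2 * j, i) u
        = ∑ x ∈ ({2 * j} : Finset ℕ) ×ˢ Finset.range (2 * k + 1), derivN x u := by
          rw [Finset.sum_product, Finset.sum_singleton]
      _ ≤ _ := Finset.sum_le_sum_of_subset_of_nonneg
          (Finset.product_subset_product
            (Finset.singleton_subset_iff.2 (Finset.mem_range.2 (by omega)))
            (Finset.range_subset_range.2 (by omega))) fun i _ _ => hD i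

/-! ### Completeness -/

theorem hasDerivWithinAt_of_uniform_limit {s : Set ℝ} (hs : Convex ℝ s) {F F' : ℕ → ℝ → ℝ}
    {g g' : ℝ → ℝ} (hF : ∀ m, ∀ x ∈ s, HasDerivWithinAt (F m) (F' m x) s x)
    (hlim : ∀ x ∈ s, Tendsto (fun m => F m x) atTop (𝓝 (g x)))
    (hunif : ∀ ε > 0, ∃ K, ∀ m ≥ K, ∀ x ∈ s, |F' m x - g' x| ≤ ε) {x : ℝ} (hx : x ∈ s) :
    HasDerivWithinAt g (g' x) s x := by
  rw [hasDerivWithinAt_iff_isLittleO, Asymptotics.isLittleO_iff]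
  intro c hc
  obtain ⟨m, hm⟩ := hunif (c / 4) (by positivity)
  have hFm := hF m x hx
  rw [hasDerivWithinAt_iff_isLittleO, Asymptotics.isLittleO_iff] at hFm
  filter_upwards [hFm (show 0 < c / 4 by positivity), self_mem_nhdsWithin] with y hy hys
  have h1 : |(g y - F m y) - (g x - F m x)| ≤ c / 2 * |y - x| := by
    refine le_of_tendsto ((((hlim y hys).sub_const (F m y)).sub
      ((hlim x hx).sub_const (F m x))).abs) ?_
    filter_upwards [eventually_ge_atTop m] with i hi
    refine hs.norm_image_sub_le_of_norm_hasDerivWithin_le (f := fun z => F i z - F m z)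
      (fun z hz => (hF i z hz).sub (hF m z hz)) (fun z hz => ?_) hx hys
    have a1 := abs_le.1 (hm i hi z hz)
    have a2 := abs_le.1 (hm m le_rfl z hz)
    rw [Real.norm_eq_abs, abs_le]
    constructor <;> linarith [a1.1, a1.2, a2.1, a2.2]
  have h2 : |(y - x) * (F' m x - g' x)| ≤ c / 4 * |y - x| := by
    rw [abs_mul, mul_comm]
    exact mul_le_mul_of_nonneg_right (hm m le_rfl x hx) (abs_nonneg _)
  simp only [Real.norm_eq_abs, smul_eq_mul] at hy ⊢
  have e : g y - g x - (y - x) * g' x = ((g y - F m y) - (g x - F m x)) +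
      (F m y - F m x - (y - x) * F' m x) + (y - x) * (F' m x - g' x) := by ring
  rw [e]
  refine (abs_add_three _ _ _).trans ?_
  linarith

/-- Sequences of smooth functions all of whose derivatives are uniformly Cauchy converge. -/
theorem exists_smooth_limit (f : ℕ → Smooth T)
    (hf : ∀ i : ℕ × ℕ, ∀ ε > 0, ∃ K, ∀ m ≥ K, ∀ n ≥ K, derivN i (f m - f n) < ε) :
    ∃ v : Smooth T, ∀ i : ℕ × ℕ, Tendsto (fun m => derivN i (f m - v)) atTop (𝓝 0) := by
  set D : ℕ × ℕ → ℕ → ℝ × ℝ → ℝ := fun i m => (derivOp i (f m) : Smooth T) with hD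
  have hsub : ∀ (i : ℕ × ℕ) (m n : ℕ), ∀ p ∈ rect T, |D i m p - D i n p| ≤ derivN i (f m - f n) := by
    intro i m n p hp
    have := abs_apply_le (derivOp i (f m - f n)) hp
    rw [map_sub] at this
    rwa [derivN, Seminorm.comp_apply, map_sub]
  have hlim : ∀ (i : ℕ × ℕ) (p : ℝ × ℝ), ∃ l, p ∈ rect T → Tendsto (fun m => D i m p) atTop (𝓝 l) := by
    intro i p
    by_cases hp : p ∈ rect T
    · have hc : CauchySeq fun m => D i m p := by
        rw [Metric.cauchySeq_iff]
        intro ε hε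
        obtain ⟨K, hK⟩ := hf i ε hε
        exact ⟨K, fun m hm n hn => by
          rw [Real.dist_eq]
          exact lt_of_le_of_lt (hsub i m n p hp) (hK m hm n hn)⟩
      obtain ⟨l, hl⟩ := cauchySeq_tendsto_of_complete hc
      exact ⟨l, fun _ => hl⟩
    · exact ⟨0, fun h => absurd h hp⟩
  choose l hl using hlim
  have hunif : ∀ i, ∀ ε > 0, ∃ K, ∀ m ≥ K, ∀ p ∈ rect T, |D i m p - l i p| ≤ ε := by
    intro i ε hε
    obtain ⟨K, hK⟩ := hf i ε hε
    refine ⟨K, fun m hm p hp => ?_⟩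
    refine le_of_tendsto ((tendsto_const_nhds.sub (hl i p hp)).abs) ?_
    filter_upwards [eventually_ge_atTop K] with n hn
    exact (hsub i m n p hp).trans (hK m hm n hn).le
  have hcont : ∀ i, ContinuousOn (l i) (rect T) := by
    intro i
    have hu : TendstoUniformlyOn (D i) (l i) atTop (rect T) := by
      rw [Metric.tendstoUniformlyOn_iff]
      intro ε hε
      obtain ⟨K, hK⟩ := hunif i (ε / 2) (half_pos hε)
      filter_upwards [eventually_ge_atTop K] with m hm p hp
      rw [dist_comm, Real.dist_eq]
      exact lt_of_le_of_lt (hK m hm p hp) (half_lt_self hε)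
    exact hu.continuousOn (Frequently.of_forall fun m => (derivOp i (f m)).2.1.continuousOn)
  have hdt : ∀ (i : ℕ × ℕ), ∀ q ∈ rect T,
      HasDerivWithinAt (fun s => l i (s, q.2)) (l (i.1 + 1, i.2) q) (Icc 0 T) q.1 := by
    intro i q hq
    have hq' : ∀ s ∈ Icc 0 T, (s, q.2) ∈ rect T := fun s hs => ⟨hs, hq.2⟩
    refine hasDerivWithinAt_of_uniform_limit (convex_Icc 0 T) (F := fun m s => D i m (s, q.2))
      (F' := fun m s => D (i.1 + 1, i.2) m (s, q.2)) (g' := fun s => l (i.1 + 1, i.2) (s, q.2))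
      ?_ (fun s hs => hl i _ (hq' s hs)) ?_ hq.1
    · intro m s hs
      have := hasDerivWithinAt_Dt (derivOp i (f m)) (hq' s hs)
      simp only [hD, derivOp, pow_succ', mul_assoc]
      exact this
    · intro ε hε
      obtain ⟨K, hK⟩ := hunif (i.1 + 1, i.2) ε hε
      exact ⟨K, fun m hm s hs => hK m hm _ (hq' s hs)⟩
  have hdx : ∀ (i : ℕ × ℕ), ∀ q ∈ rect T,
      HasDerivWithinAt (fun y => l i (q.1, y)) (l (i.1, i.2 + 1) q) (Icc 0 1) q.2 := by
    intro i q hq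
    have hq' : ∀ s ∈ Icc (0 : ℝ) 1, (q.1, s) ∈ rect T := fun s hs => ⟨hq.1, hs⟩
    refine hasDerivWithinAt_of_uniform_limit (convex_Icc 0 1) (F := fun m s => D i m (q.1, s))
      (F' := fun m s => D (i.1, i.2 + 1) m (q.1, s)) (g' := fun s => l (i.1, i.2 + 1) (q.1, s))
      ?_ (fun s hs => hl i _ (hq' s hs)) ?_ hq.2
    · intro m s hs
      have := hasDerivWithinAt_Dx (derivOp i (f m)) (hq' s hs)
      simp only [hD, derivOp, pow_succ' (Dx : Module.End ℝ (Smooth T)), ← mul_assoc]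
      rw [((commute_Dt_Dx (T := T)).pow_left i.1).eq, mul_assoc]
      exact this
    · intro ε hε
      obtain ⟨K, hK⟩ := hunif (i.1, i.2 + 1) ε hε
      exact ⟨K, fun m hm s hs => hK m hm _ (hq' s hs)⟩
  have hsmooth : ContDiffOn ℝ (⊤ : ℕ∞) (l (0, 0)) (rect T) :=
    contDiffOn_of_partials (convex_Icc 0 T) (fun g => ∃ i, g = l i)
      (by rintro _ ⟨i, rfl⟩; exact hcont i)
      (by rintro _ ⟨i, rfl⟩; exact ⟨_, _, ⟨_, rfl⟩, ⟨_, rfl⟩, hdt i, hdx i⟩) ⟨(0, 0), rfl⟩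
  have hvx : ∀ k, ∀ p ∈ rect T, ((Dx ^ k) (Smooth.mk hsmooth) : ℝ × ℝ → ℝ) p = l (0, k) p := by
    intro k
    induction k with
    | zero => intro p hp; exact Smooth.mk_apply hsmooth hp
    | succ k ih =>
      intro p hp
      rw [pow_succ']
      exact Dx_eq_of_hasDerivWithinAt hp ((hdx (0, k) p hp).congr
        (fun y hy => ih (p.1, y) ⟨hp.1, hy⟩) (ih p hp))
  have hv : ∀ j k, ∀ p ∈ rect T,
      (derivOp (j, k) (Smooth.mk hsmooth) : ℝ × ℝ → ℝ) p = l (j, k) p := by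
    intro j k
    induction j with
    | zero => intro p hp; simpa [derivOp] using hvx k p hp
    | succ j ih =>
      intro p hp
      rw [derivOp, pow_succ', mul_assoc]
      exact Dt_eq_of_hasDerivWithinAt hp ((hdt (j, k) p hp).congr
        (fun s hs => ih (s, p.2) ⟨hs, hp.2⟩) (ih p hp))
  refine ⟨Smooth.mk hsmooth, fun i => ?_⟩
  rw [Metric.tendsto_atTop]
  intro ε hε
  obtain ⟨K, hK⟩ := hunif i (ε / 2) (half_pos hε)
  refine ⟨K, fun m hm => ?_⟩
  rw [Real.dist_eq, sub_zero, abs_of_nonneg (apply_nonneg _ _)]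
  refine lt_of_le_of_lt (supN_le fun p hp => ?_) (half_lt_self hε)
  rw [map_sub (derivOp i)]
  refine le_trans (le_of_eq ?_) (hK m hm p hp)
  rw [← hv i.1 i.2 p hp]
  rfl

end

/-! ### A rapidly decreasing kernel on the half-line without moments -/

/-- The coefficients `a₀ = 1`, `a_{k+1} = -a_k / (4^{k+1} - 1)`. They satisfy
`∑ a_k 4^{kn} = 0` for all `n ≥ 1`. -/
def dilationCoeff : ℕ → ℝ
  | 0 => 1
  | k + 1 => -dilationCoeff k / (4 ^ (k + 1) - 1)

theorem four_pow_sub_one_ge (k : ℕ) : (3 : ℝ) ≤ 4 ^ (k + 1) - 1 := by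
  have : (1 : ℝ) ≤ 4 ^ k := one_le_pow₀ (by norm_num)
  rw [pow_succ]; linarith

theorem summable_dilationCoeff (n : ℕ) : Summable fun k => |dilationCoeff k| * ((4 : ℝ) ^ k) ^ n := by
  refine summable_of_ratio_norm_eventually_le (r := 1 / 2) (by norm_num) ?_
  filter_upwards [eventually_ge_atTop n] with k hk
  have h3 := four_pow_sub_one_ge k
  have h1 : (4 : ℝ) ^ n ≤ 4 ^ k := pow_le_pow_right₀ (by norm_num) hk
  have h2 : (1 : ℝ) ≤ 4 ^ k := one_le_pow₀ (by norm_num)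
  simp only [Real.norm_eq_abs, abs_mul, abs_abs, abs_pow, dilationCoeff, abs_div, abs_neg]
  rw [abs_of_pos (show (0 : ℝ) < 4 by norm_num), abs_of_pos (by linarith : (0 : ℝ) < 4 ^ (k + 1) - 1),
    pow_succ 4 k, mul_pow, ← pow_succ 4 k, div_mul_eq_mul_div, div_le_iff₀ (by linarith)]
  have h4 : (4 : ℝ) ^ n ≤ 1 / 2 * (4 ^ (k + 1) - 1) := by rw [pow_succ]; linarith
  calc |dilationCoeff k| * ((4 ^ k) ^ n * 4 ^ n)
      = |dilationCoeff k| * (4 ^ k) ^ n * 4 ^ n := by ring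
    _ ≤ |dilationCoeff k| * (4 ^ k) ^ n * (1 / 2 * (4 ^ (k + 1) - 1)) := by gcongr
    _ = _ := by ring

theorem summable_dilationCoeff' (n : ℕ) : Summable fun k => dilationCoeff k * ((4 : ℝ) ^ k) ^ n :=
  Summable.of_norm (by
    refine (summable_dilationCoeff n).congr fun k => ?_
    rw [norm_mul, Real.norm_eq_abs, Real.norm_eq_abs, abs_of_pos (by positivity : (0 : ℝ) < (4 ^ k) ^ n)])

/-- The moments `τ_n` of the coefficients satisfy `τ_{n+1} = (1 - 4 ^ n) τ_n`. -/
theorem tsum_dilationCoeff_succ (n : ℕ) : ∑' k, dilationCoeff k * ((4 : ℝ) ^ k) ^ (n + 1) =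
    (1 - 4 ^ n) * ∑' k, dilationCoeff k * ((4 : ℝ) ^ k) ^ n := by
  have s0 := summable_dilationCoeff' n
  have s1 := summable_dilationCoeff' (n + 1)
  have h : ∑' k, dilationCoeff k * ((4 : ℝ) ^ k) ^ (n + 1) - ∑' k, dilationCoeff k * ((4 : ℝ) ^ k) ^ n
      = -(4 ^ n * ∑' k, dilationCoeff k * ((4 : ℝ) ^ k) ^ n) := by
    rw [← s1.tsum_sub s0, (s1.sub s0).tsum_eq_zero_add]
    simp only [pow_zero, one_pow, mul_one, sub_self, zero_add]
    rw [← tsum_mul_left, ← tsum_neg]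
    refine tsum_congr fun k => ?_
    have h3 := four_pow_sub_one_ge k
    have h4 : (4 : ℝ) ^ (k + 1) - 1 ≠ 0 := by linarith
    rw [dilationCoeff, pow_succ _ n]
    have : -dilationCoeff k / (4 ^ (k + 1) - 1) * ((4 ^ (k + 1)) ^ n * 4 ^ (k + 1)) -
        -dilationCoeff k / (4 ^ (k + 1) - 1) * (4 ^ (k + 1)) ^ n
        = -dilationCoeff k * (4 ^ (k + 1)) ^ n := by field_simp; ring
    rw [this, pow_succ 4 k, mul_pow]
    ring
  linarith

theorem tsum_dilationCoeff_eq_zero (n : ℕ) :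
    ∑' k, dilationCoeff k * ((4 : ℝ) ^ k) ^ (n + 1) = 0 := by
  induction n with
  | zero => rw [tsum_dilationCoeff_succ]; simp
  | succ n ih => rw [tsum_dilationCoeff_succ, ih, mul_zero]

/-- The kernel can be normalized: since `|a_k| ≤ 3 ^ (-k)`, the terms with `k ≥ 1` sum to at most
`1/2` in absolute value. -/
theorem tsum_dilationCoeff_pos : 0 < ∑' k, dilationCoeff k := by
  have s0 : Summable dilationCoeff := by simpa using summable_dilationCoeff' 0
  have hb : ∀ k, |dilationCoeff k| ≤ (1 / 3) ^ k := by
    intro k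
    induction k with
    | zero => simp [dilationCoeff]
    | succ k ih =>
      have h3 := four_pow_sub_one_ge k
      rw [dilationCoeff, abs_div, abs_neg, abs_of_pos (by linarith : (0 : ℝ) < 4 ^ (k + 1) - 1),
        div_le_iff₀ (by linarith), pow_succ]
      have : (0 : ℝ) ≤ (1 / 3) ^ k := by positivity
      nlinarith
  have hg : HasSum (fun k : ℕ => (1 / 3 : ℝ) ^ (k + 1)) (1 / 2) := by
    have := (hasSum_geometric_of_lt_one (r := (1 / 3 : ℝ)) (by norm_num) (by norm_num)).mul_left (1 / 3)
    have e : (fun k : ℕ => (1 / 3 : ℝ) ^ (k + 1)) = fun k => 1 / 3 * (1 / 3) ^ k := by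
      funext k; rw [pow_succ']
    rw [e, show (1 / 2 : ℝ) = 1 / 3 * (1 - 1 / 3)⁻¹ by norm_num]
    exact this
  have h2 : ‖∑' k, dilationCoeff (k + 1)‖ ≤ 1 / 2 := tsum_of_norm_bounded hg fun k => hb (k + 1)
  rw [Real.norm_eq_abs, abs_le] at h2
  rw [s0.tsum_eq_zero_add]
  simp only [dilationCoeff] at h2 ⊢
  linarith [h2.1]

/-- There is a Schwartz function on the line which vanishes on `(-∞, 0]`, has integral one, and all
of whose moments of positive order vanish. It is a sum `∑ a_k 4^{-k} ψ(4^{-k} y)` of dilates of a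
bump function. -/
theorem exists_kernel : ∃ K : 𝓢(ℝ, ℝ), (∀ y ≤ 0, K y = 0) ∧ ∫ y, K y = 1 ∧
    ∀ n : ℕ, ∫ y, y ^ (n + 1) * K y = 0 := by
  set bump : ContDiffBump (3 / 2 : ℝ) := ⟨1 / 4, 1 / 2, by norm_num, by norm_num⟩ with hbump
  set ψ : ℝ → ℝ := bump.normed volume with hψ
  have hψs : ContDiff ℝ (⊤ : ℕ∞) ψ := bump.contDiff_normed
  have hψt : tsupport ψ = Metric.closedBall (3 / 2 : ℝ) (1 / 2) := bump.tsupport_normed_eq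
  have hψc : HasCompactSupport ψ := bump.hasCompactSupport_normed
  have hψ0 : ∀ n y, y ∉ Icc (1 : ℝ) 2 → iteratedFDeriv ℝ n ψ y = 0 := by
    intro n y hy
    by_contra hne
    have := support_iteratedFDeriv_subset (𝕜 := ℝ) (f := ψ) n (Function.mem_support.2 hne)
    rw [hψt, Real.closedBall_eq_Icc] at this
    norm_num at this
    exact hy this
  have hψ0' : ∀ y, y ∉ Icc (1 : ℝ) 2 → ψ y = 0 := by
    intro y hy
    have := congrArg norm (hψ0 0 y hy)
    rwa [norm_iteratedFDeriv_zero, norm_zero, norm_eq_zero] at this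
  have hM : ∀ n, ∃ M, ∀ y, ‖iteratedFDeriv ℝ n ψ y‖ ≤ M := by
    intro n
    obtain ⟨M, hM⟩ := (hψc.iteratedFDeriv (𝕜 := ℝ) n).exists_bound_of_continuous
      (hψs.continuous_iteratedFDeriv (by exact_mod_cast le_top))
    exact ⟨M, hM⟩
  choose M hM using hM
  have hM0 : ∀ n, 0 ≤ M n := fun n => (norm_nonneg _).trans (hM n 0)
  set g : ℕ → ℝ → ℝ := fun k y => dilationCoeff k * (4 ^ k)⁻¹ * ψ ((4 ^ k)⁻¹ * y) with hg
  have hgs : ∀ k, ContDiff ℝ (⊤ : ℕ∞) (g k) := fun k =>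
    contDiff_const.mul (hψs.comp (contDiff_const.mul contDiff_id))
  have hgd : ∀ n k y, ‖iteratedFDeriv ℝ n (g k) y‖ =
      |dilationCoeff k * (4 ^ k)⁻¹| * ((4 ^ k)⁻¹ ^ n * ‖iteratedFDeriv ℝ n ψ ((4 ^ k)⁻¹ * y)‖) := by
    intro n k y
    have hn : ContDiff ℝ n ψ := hψs.of_le (by exact_mod_cast le_top)
    rw [norm_iteratedFDeriv_eq_norm_iteratedDeriv, norm_iteratedFDeriv_eq_norm_iteratedDeriv, hg]
    simp only []
    rw [iteratedDeriv_const_mul_field, iteratedDeriv_comp_const_mul hn]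
    beta_reduce
    rw [norm_mul, norm_mul (_ ^ _), norm_pow, Real.norm_eq_abs, Real.norm_eq_abs (_⁻¹),
      abs_of_pos (show (0 : ℝ) < (4 ^ k)⁻¹ by positivity)]
  -- The weighted bound which gives both the smoothness and the decay of the sum, since
  -- `y ≤ 2 · 4 ^ k` on the support of `g k`.
  have hbound : ∀ m n k y, ‖y‖ ^ m * ‖iteratedFDeriv ℝ n (g k) y‖ ≤
      |dilationCoeff k| * ((4 : ℝ) ^ k) ^ m * (2 ^ m * M n) := by
    intro m n k y
    have h4 : (1 : ℝ) ≤ 4 ^ k := one_le_pow₀ (by norm_num)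
    have h4' : ((4 : ℝ) ^ k)⁻¹ ≤ 1 := inv_le_one_of_one_le₀ h4
    by_cases hy : (4 ^ k)⁻¹ * y ∈ Icc (1 : ℝ) 2
    · have hy2 : y ≤ 2 * 4 ^ k := by
        have := hy.2
        rwa [inv_mul_le_iff₀ (by positivity), mul_comm] at this
      have hy0 : 0 ≤ y := by
        by_contra hneg
        push Not at hneg
        have := mul_neg_of_pos_of_neg (show (0 : ℝ) < (4 ^ k)⁻¹ by positivity) hneg
        linarith [hy.1]
      have h5 : ‖iteratedFDeriv ℝ n (g k) y‖ ≤ |dilationCoeff k| * M n := by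
        rw [hgd, abs_mul, abs_of_pos (show (0 : ℝ) < (4 ^ k)⁻¹ by positivity), mul_assoc]
        refine mul_le_mul_of_nonneg_left ?_ (abs_nonneg _)
        refine (mul_le_of_le_one_left (by positivity) h4').trans ?_
        refine (mul_le_of_le_one_left (norm_nonneg _) (pow_le_one₀ (by positivity) h4')).trans (hM _ _)
      calc ‖y‖ ^ m * ‖iteratedFDeriv ℝ n (g k) y‖ ≤ (2 * 4 ^ k) ^ m * (|dilationCoeff k| * M n) := by
            rw [Real.norm_eq_abs, abs_of_nonneg hy0]
            gcongr
        _ = _ := by rw [mul_pow]; ring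
    · rw [hgd, hψ0 n _ hy]
      simp only [norm_zero, mul_zero]
      have := hM0 n
      positivity
  have hsum : ∀ m n, Summable fun k => |dilationCoeff k| * ((4 : ℝ) ^ k) ^ m * (2 ^ m * M n) :=
    fun m n => (summable_dilationCoeff m).mul_right _
  have hv : ∀ n : ℕ, (n : ℕ∞) ≤ ⊤ → Summable fun k => |dilationCoeff k| * ((4 : ℝ) ^ k) ^ 0 * (2 ^ 0 * M n) :=
    fun n _ => hsum 0 n
  have hvb : ∀ (n : ℕ) (k : ℕ) (y : ℝ), (n : ℕ∞) ≤ ⊤ → ‖iteratedFDeriv ℝ n (g k) y‖ ≤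
      |dilationCoeff k| * ((4 : ℝ) ^ k) ^ 0 * (2 ^ 0 * M n) := fun n k y _ => by
    simpa using hbound 0 n k y
  set τ : ℝ := ∑' k, dilationCoeff k with hτ
  have hτ0 : τ ≠ 0 := tsum_dilationCoeff_pos.ne'
  let K₀ : 𝓢(ℝ, ℝ) :=
    { toFun := fun y => ∑' k, g k y
      smooth' := contDiff_tsum hgs hv hvb
      decay' := by
        intro m n
        refine ⟨∑' k, |dilationCoeff k| * ((4 : ℝ) ^ k) ^ m * (2 ^ m * M n), fun y => ?_⟩
        rw [iteratedFDeriv_tsum_apply hgs hv hvb (by exact le_top) y]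
        have hsm : Summable fun k => ‖iteratedFDeriv ℝ n (g k) y‖ :=
          Summable.of_nonneg_of_le (fun _ => norm_nonneg _) (fun k => hvb n k y le_top) (hv n le_top)
        calc ‖y‖ ^ m * ‖∑' k, iteratedFDeriv ℝ n (g k) y‖
            ≤ ‖y‖ ^ m * ∑' k, ‖iteratedFDeriv ℝ n (g k) y‖ := by
              gcongr
              exact norm_tsum_le_tsum_norm hsm
          _ = ∑' k, ‖y‖ ^ m * ‖iteratedFDeriv ℝ n (g k) y‖ := tsum_mul_left.symm
          _ ≤ _ := (hsm.mul_left _).tsum_le_tsum (fun k => hbound m n k y) (hsum m n) }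
  have hK₀ : ∀ y, K₀ y = ∑' k, g k y := fun y => rfl
  have hψi : ∀ n : ℕ, Integrable fun y => y ^ n * ψ y := fun n =>
    ((continuous_id.pow n).mul hψs.continuous).integrable_of_hasCompactSupport hψc.mul_left
  -- By dilation, the `n`-th moment of `g k` is `a_k 4 ^ (k n)` times that of `ψ`.
  have hmom : ∀ n : ℕ, ∫ y, y ^ n * K₀ y =
      (∑' k, dilationCoeff k * ((4 : ℝ) ^ k) ^ n) * ∫ y, y ^ n * ψ y := by
    intro n
    have e : ∀ k, (fun y => y ^ n * g k y) =
        fun y => (dilationCoeff k * (4 ^ k) ^ n * (4 ^ k)⁻¹) *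
          ((fun y => y ^ n * ψ y) ((4 ^ k)⁻¹ * y)) := by
      intro k
      ext y
      simp only [hg, mul_pow, inv_pow]
      have : ((4 : ℝ) ^ k) ^ n ≠ 0 := by positivity
      field_simp
    have hpos : ∀ k : ℕ, (0 : ℝ) < (4 ^ k)⁻¹ := fun k => by positivity
    have hint : ∀ k, Integrable fun y => y ^ n * g k y := by
      intro k
      rw [e k]
      exact ((hψi n).comp_mul_left' (hpos k).ne').const_mul _
    have hval : ∀ k, ∫ y, y ^ n * g k y = dilationCoeff k * (4 ^ k) ^ n * ∫ y, y ^ n * ψ y := by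
      intro k
      rw [e k, integral_const_mul, Measure.integral_comp_mul_left (fun y => y ^ n * ψ y), abs_of_pos (inv_pos.2 (hpos k)),
        inv_inv, smul_eq_mul]
      have : ((4 : ℝ) ^ k) ≠ 0 := by positivity
      field_simp
    have hnorm : ∀ k, ∫ y, ‖y ^ n * g k y‖ =
        |dilationCoeff k| * (4 ^ k) ^ n * ∫ y, ‖y ^ n * ψ y‖ := by
      intro k
      have e' : (fun y => ‖y ^ n * g k y‖) =
          fun y => (|dilationCoeff k| * (4 ^ k) ^ n * (4 ^ k)⁻¹) *
          ((fun y => ‖y ^ n * ψ y‖) ((4 ^ k)⁻¹ * y)) := by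
        ext y
        rw [congrFun (e k) y, norm_mul, norm_mul, norm_mul, Real.norm_eq_abs, Real.norm_eq_abs,
          Real.norm_eq_abs, abs_of_pos (hpos k), abs_of_pos (by positivity : (0 : ℝ) < (4 ^ k) ^ n)]
      rw [e', integral_const_mul, Measure.integral_comp_mul_left (fun y => ‖y ^ n * ψ y‖), abs_of_pos (inv_pos.2 (hpos k)),
        inv_inv, smul_eq_mul]
      have : ((4 : ℝ) ^ k) ≠ 0 := by positivity
      field_simp
    have hs := hasSum_integral_of_summable_integral_norm hint
      (by simp only [hnorm]; exact (summable_dilationCoeff n).mul_right _)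
    simp only [hval] at hs
    rw [← tsum_mul_right, hs.tsum_eq]
    congr 1
    ext y
    rw [hK₀, tsum_mul_left]
  have hτK : ∀ y, (τ⁻¹ • K₀) y = τ⁻¹ * K₀ y := fun _ => rfl
  refine ⟨τ⁻¹ • K₀, fun y hy => ?_, ?_, fun n => ?_⟩
  · have : ∀ k, g k y = 0 := by
      intro k
      simp only [hg]
      rw [hψ0', mul_zero]
      intro h
      have : (4 ^ k)⁻¹ * y ≤ 0 := mul_nonpos_of_nonneg_of_nonpos (by positivity) hy
      linarith [h.1]
    rw [hτK, hK₀]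
    simp [this]
  · have h0 := hmom 0
    simp only [pow_zero, one_mul, mul_one] at h0
    rw [bump.integral_normed, mul_one] at h0
    simp only [hτK]
    rw [integral_const_mul, h0, inv_mul_cancel₀ hτ0]
  · have h0 := hmom (n + 1)
    rw [tsum_dilationCoeff_eq_zero, zero_mul] at h0
    simp only [hτK]
    have : ∀ y : ℝ, y ^ (n + 1) * (τ⁻¹ * K₀ y) = τ⁻¹ * (y ^ (n + 1) * K₀ y) := fun y => by ring
    simp only [this]
    rw [integral_const_mul, h0, mul_zero]

/-! ### Mollification in the plane -/

/-- The derivative of a Schwartz function. -/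
def schwartzDeriv (K : 𝓢(ℝ, ℝ)) : 𝓢(ℝ, ℝ) := SchwartzMap.derivCLM ℝ ℝ K

theorem schwartzDeriv_apply (K : 𝓢(ℝ, ℝ)) (y : ℝ) : schwartzDeriv K y = deriv K y := rfl

theorem exists_schwartz_bound (K : 𝓢(ℝ, ℝ)) : ∃ C, 0 < C ∧ ∀ z, |K z| ≤ C * (1 + z ^ 2)⁻¹ := by
  obtain ⟨C₀, hC₀, h₀⟩ := K.decay 0 0
  obtain ⟨C₂, hC₂, h₂⟩ := K.decay 2 0
  refine ⟨C₀ + C₂, by positivity, fun z => ?_⟩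
  have e0 := h₀ z
  have e2 := h₂ z
  rw [norm_iteratedFDeriv_zero, Real.norm_eq_abs, Real.norm_eq_abs] at e0 e2
  rw [sq_abs] at e2
  rw [← div_eq_mul_inv, le_div_iff₀ (by positivity)]
  linarith

/-- The convolution of `f` with the kernel `K₁ ⊗ K₂` at scale `δ`; with this sign convention the
value at `p` involves the values of `f` at the points `p + δ v`. -/
def moll (K₁ K₂ : 𝓢(ℝ, ℝ)) (δ : ℝ) (f : ℝ × ℝ →ᵇ ℝ) (p : ℝ × ℝ) : ℝ :=
  ∫ v : ℝ × ℝ, f (p.1 + δ * v.1, p.2 + δ * v.2) * (K₁ v.1 * K₂ v.2)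

theorem integrable_kernel (K₁ K₂ : 𝓢(ℝ, ℝ)) :
    Integrable (fun v : ℝ × ℝ => K₁ v.1 * K₂ v.2) :=
  (K₁.integrable (μ := volume)).mul_prod (K₂.integrable (μ := volume))

theorem integrable_bcf_mul {k : ℝ × ℝ → ℝ} (hk : Integrable k) (f : ℝ × ℝ →ᵇ ℝ)
    {a : ℝ × ℝ → ℝ × ℝ} (ha : Continuous a) : Integrable fun v => f (a v) * k v := by
  refine (hk.norm.const_mul ‖f‖).mono'
    ((f.continuous.comp ha).aestronglyMeasurable.mul hk.aestronglyMeasurable)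
    (Eventually.of_forall fun v => ?_)
  rw [norm_mul]
  exact mul_le_mul_of_nonneg_right (f.norm_coe_le_norm _) (norm_nonneg _)

theorem integrable_moll (K₁ K₂ : 𝓢(ℝ, ℝ)) (δ : ℝ) (f : ℝ × ℝ →ᵇ ℝ) (p : ℝ × ℝ) :
    Integrable fun v : ℝ × ℝ => f (p.1 + δ * v.1, p.2 + δ * v.2) * (K₁ v.1 * K₂ v.2) :=
  integrable_bcf_mul (integrable_kernel K₁ K₂) f (by fun_prop)

/-- The `L¹` norm of the kernel `K₁ ⊗ K₂`. -/
def kernelMass (K₁ K₂ : 𝓢(ℝ, ℝ)) : ℝ := ∫ v : ℝ × ℝ, |K₁ v.1 * K₂ v.2|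

theorem kernelMass_nonneg (K₁ K₂ : 𝓢(ℝ, ℝ)) : 0 ≤ kernelMass K₁ K₂ :=
  integral_nonneg fun _ => abs_nonneg _

theorem abs_moll_le_of_bound (K₁ K₂ : 𝓢(ℝ, ℝ)) (δ : ℝ) (f : ℝ × ℝ →ᵇ ℝ) (p : ℝ × ℝ) {C : ℝ}
    (h : ∀ v : ℝ × ℝ, K₁ v.1 * K₂ v.2 ≠ 0 → |f (p.1 + δ * v.1, p.2 + δ * v.2)| ≤ C) :
    |moll K₁ K₂ δ f p| ≤ C * kernelMass K₁ K₂ := by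
  rw [kernelMass, ← integral_const_mul]
  refine (abs_integral_le_integral_abs).trans
    (integral_mono (integrable_moll K₁ K₂ δ f p).abs ((integrable_kernel K₁ K₂).abs.const_mul C) ?_)
  intro v
  change |_ * _| ≤ C * |_|
  rw [abs_mul]
  by_cases hv : K₁ v.1 * K₂ v.2 = 0
  · simp [hv]
  · exact mul_le_mul_of_nonneg_right (h v hv) (abs_nonneg _)

theorem abs_moll_le (K₁ K₂ : 𝓢(ℝ, ℝ)) (δ : ℝ) (f : ℝ × ℝ →ᵇ ℝ) (p : ℝ × ℝ) :
    |moll K₁ K₂ δ f p| ≤ ‖f‖ * kernelMass K₁ K₂ :=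
  abs_moll_le_of_bound K₁ K₂ δ f p fun _ _ => f.norm_coe_le_norm _

theorem continuous_moll (K₁ K₂ : 𝓢(ℝ, ℝ)) (δ : ℝ) (f : ℝ × ℝ →ᵇ ℝ) :
    Continuous (moll K₁ K₂ δ f) := by
  refine continuous_of_dominated (bound := fun v : ℝ × ℝ => ‖f‖ * ‖K₁ v.1 * K₂ v.2‖)
    (fun p => (integrable_moll K₁ K₂ δ f p).aestronglyMeasurable)
    (fun p => Eventually.of_forall fun v => ?_) ((integrable_kernel K₁ K₂).norm.const_mul _)
    (Eventually.of_forall fun v => by fun_prop)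
  rw [norm_mul]
  exact mul_le_mul_of_nonneg_right (f.norm_coe_le_norm _) (norm_nonneg _)

theorem hasDerivAt_moll_fst (K₁ K₂ : 𝓢(ℝ, ℝ)) {δ : ℝ} (hδ : 0 < δ) (f : ℝ × ℝ →ᵇ ℝ) (t r : ℝ) :
    HasDerivAt (fun s => moll K₁ K₂ δ f (s, r)) (-δ⁻¹ * moll (schwartzDeriv K₁) K₂ δ f (t, r)) t := by
  -- By translation invariance, the variable is moved to the kernel.
  have shift : ∀ (L : 𝓢(ℝ, ℝ)) (s : ℝ), moll L K₂ δ f (s, r) =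
      ∫ v : ℝ × ℝ, f (δ * v.1, r + δ * v.2) * (L (v.1 - δ⁻¹ * s) * K₂ v.2) := by
    intro L s
    rw [← integral_add_right_eq_self _ ((δ⁻¹ * s, 0) : ℝ × ℝ)]
    refine integral_congr_ae (Eventually.of_forall fun v => ?_)
    have e : δ * (v.1 + δ⁻¹ * s) = s + δ * v.1 := by field_simp; ring
    simp only [Prod.fst_add, Prod.snd_add, add_zero, add_sub_cancel_right, e]
  have hint : ∀ (L : 𝓢(ℝ, ℝ)) (s : ℝ),
      Integrable fun v : ℝ × ℝ => f (δ * v.1, r + δ * v.2) * (L (v.1 - δ⁻¹ * s) * K₂ v.2) := by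
    intro L s
    refine integrable_bcf_mul ?_ f (by fun_prop)
    exact ((L.integrable (μ := volume)).comp_sub_right _).mul_prod (K₂.integrable (μ := volume))
  obtain ⟨C, hC, hb⟩ := exists_schwartz_bound (schwartzDeriv K₁)
  have hmain := hasDerivAt_integral_of_dominated_loc_of_deriv_le (μ := volume)
    (F := fun s (v : ℝ × ℝ) => f (δ * v.1, r + δ * v.2) * (K₁ (v.1 - δ⁻¹ * s) * K₂ v.2))
    (F' := fun s (v : ℝ × ℝ) => f (δ * v.1, r + δ * v.2) *
      (-δ⁻¹ * schwartzDeriv K₁ (v.1 - δ⁻¹ * s) * K₂ v.2))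
    (x₀ := t) (s := Metric.ball t δ)
    (bound := fun v => ‖f‖ * (δ⁻¹ * (C * (3 * (1 + (v.1 - δ⁻¹ * t) ^ 2)⁻¹)) * |K₂ v.2|))
    (Metric.ball_mem_nhds t hδ)
    (Eventually.of_forall fun s => (hint K₁ s).aestronglyMeasurable) (hint K₁ t) ?_ ?_ ?_ ?_
  · have h2 := hmain.2
    simp only [← shift] at h2
    refine h2.congr_deriv ?_
    rw [shift, ← integral_const_mul]
    refine integral_congr_ae (Eventually.of_forall fun v => ?_)
    simp only []
    ring
  · refine ((hint (schwartzDeriv K₁) t).const_mul (-δ⁻¹)).aestronglyMeasurable.congr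
      (Eventually.of_forall fun v => ?_)
    simp only []
    ring
  · refine Eventually.of_forall fun v s hs => ?_
    rw [norm_mul, norm_mul, norm_mul, norm_neg, Real.norm_eq_abs δ⁻¹, abs_of_pos (inv_pos.2 hδ)]
    refine mul_le_mul (f.norm_coe_le_norm _) ?_ (by positivity) (norm_nonneg _)
    refine mul_le_mul_of_nonneg_right (mul_le_mul_of_nonneg_left ?_ (by positivity)) (norm_nonneg _)
    refine (hb _).trans (mul_le_mul_of_nonneg_left ?_ hC.le)
    -- For `|e| ≤ 1` one has `1 + (z + e) ^ 2 ≤ 3 (1 + z ^ 2)`.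
    have hs' : |δ⁻¹ * s - δ⁻¹ * t| ≤ 1 := by
      rw [← mul_sub, abs_mul, abs_of_pos (inv_pos.2 hδ), inv_mul_le_iff₀ hδ, mul_one]
      rw [Metric.mem_ball, Real.dist_eq] at hs
      exact hs.le
    rw [← div_eq_mul_inv, le_div_iff₀ (by positivity), inv_mul_le_iff₀ (by positivity)]
    have := (abs_le.1 hs')
    nlinarith [sq_nonneg ((v.1 - δ⁻¹ * s) - (δ⁻¹ * s - δ⁻¹ * t)),
      mul_nonneg (sub_nonneg.2 this.2) (by linarith [this.1] : 0 ≤ 1 + (δ⁻¹ * s - δ⁻¹ * t))]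
  · refine Integrable.const_mul ?_ _
    have h1 : Integrable fun x : ℝ => δ⁻¹ * (C * (3 * (1 + (x - δ⁻¹ * t) ^ 2)⁻¹)) :=
      (((integrable_inv_one_add_sq.comp_sub_right (δ⁻¹ * t)).const_mul 3).const_mul C).const_mul _
    exact h1.mul_prod (K₂.integrable (μ := volume)).abs
  · refine Eventually.of_forall fun v s _ => ?_
    have h1 : HasDerivAt (fun s => v.1 - δ⁻¹ * s) (-δ⁻¹) s := by
      simpa using ((hasDerivAt_id s).const_mul δ⁻¹).const_sub v.1
    have h2 := (K₁.hasDerivAt (v.1 - δ⁻¹ * s)).comp s h1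
    refine ((h2.mul_const (K₂ v.2)).const_mul (f (δ * v.1, r + δ * v.2))).congr_deriv ?_
    rw [schwartzDeriv_apply]
    ring

theorem moll_swap (K₁ K₂ : 𝓢(ℝ, ℝ)) (δ : ℝ) (f : ℝ × ℝ →ᵇ ℝ) (t r : ℝ) :
    moll K₁ K₂ δ f (t, r) =
      moll K₂ K₁ δ (f.compContinuous ⟨Prod.swap, continuous_swap⟩) (r, t) := by
  rw [moll, moll, Measure.volume_eq_prod, ← integral_prod_swap]
  refine integral_congr_ae (Eventually.of_forall fun v => ?_)
  simp [mul_comm (K₁ v.2)]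

theorem hasDerivAt_moll_snd (K₁ K₂ : 𝓢(ℝ, ℝ)) {δ : ℝ} (hδ : 0 < δ) (f : ℝ × ℝ →ᵇ ℝ) (t r : ℝ) :
    HasDerivAt (fun s => moll K₁ K₂ δ f (t, s)) (-δ⁻¹ * moll K₁ (schwartzDeriv K₂) δ f (t, r)) r := by
  simp only [moll_swap K₁]
  exact hasDerivAt_moll_fst K₂ K₁ hδ _ r t

theorem contDiff_moll (K₁ K₂ : 𝓢(ℝ, ℝ)) {δ : ℝ} (hδ : 0 < δ) (f : ℝ × ℝ →ᵇ ℝ) :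
    ContDiff ℝ (⊤ : ℕ∞) (moll K₁ K₂ δ f) := by
  rw [← contDiffOn_univ, ← univ_prod_univ]
  refine contDiffOn_of_partials convex_univ
    (fun g => ∃ (c : ℝ) (L₁ L₂ : 𝓢(ℝ, ℝ)), g = fun p => c * moll L₁ L₂ δ f p) ?_ ?_
    ⟨1, K₁, K₂, by simp⟩
  · rintro _ ⟨c, L₁, L₂, rfl⟩
    exact (continuous_const.mul (continuous_moll L₁ L₂ δ f)).continuousOn
  · rintro _ ⟨c, L₁, L₂, rfl⟩
    refine ⟨_, _, ⟨c * -δ⁻¹, schwartzDeriv L₁, L₂, rfl⟩, ⟨c * -δ⁻¹, L₁, schwartzDeriv L₂, rfl⟩,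
      fun q _ => ?_, fun q _ => ?_⟩
    · rw [mul_assoc]
      exact ((hasDerivAt_moll_fst L₁ L₂ hδ f q.1 q.2).const_mul c).hasDerivWithinAt
    · rw [mul_assoc]
      exact ((hasDerivAt_moll_snd L₁ L₂ hδ f q.1 q.2).const_mul c).hasDerivWithinAt

/-- The mollification as an operator on bounded continuous functions. -/
def mollOp (K : 𝓢(ℝ, ℝ)) (δ : ℝ) : (ℝ × ℝ →ᵇ ℝ) →ₗ[ℝ] (ℝ × ℝ →ᵇ ℝ) where
  toFun f := BoundedContinuousFunction.ofNormedAddCommGroup (moll K K δ f)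
    (continuous_moll K K δ f) (‖f‖ * kernelMass K K) (abs_moll_le K K δ f)
  map_add' f g := by
    ext p
    change moll K K δ (f + g) p = moll K K δ f p + moll K K δ g p
    rw [moll, moll, moll, ← integral_add (integrable_moll K K δ f p) (integrable_moll K K δ g p)]
    refine integral_congr_ae (Eventually.of_forall fun v => ?_)
    simp [add_mul]
  map_smul' c f := by
    ext p
    change moll K K δ (c • f) p = c * moll K K δ f p
    rw [moll, moll, ← integral_const_mul]
    refine integral_congr_ae (Eventually.of_forall fun v => ?_)
    simp [mul_assoc]

theorem mollOp_apply (K : 𝓢(ℝ, ℝ)) (δ : ℝ) (f : ℝ × ℝ →ᵇ ℝ) (p : ℝ × ℝ) :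
    mollOp K δ f p = moll K K δ f p := rfl

/-- Convolutions commute, by Fubini's theorem. -/
theorem mollOp_comm (K : 𝓢(ℝ, ℝ)) (δ ε : ℝ) (f : ℝ × ℝ →ᵇ ℝ) :
    mollOp K δ (mollOp K ε f) = mollOp K ε (mollOp K δ f) := by
  ext p
  have e : ∀ δ ε : ℝ, mollOp K δ (mollOp K ε f) p = ∫ v : ℝ × ℝ, ∫ w : ℝ × ℝ,
      f (p.1 + δ * v.1 + ε * w.1, p.2 + δ * v.2 + ε * w.2) *
        ((K v.1 * K v.2) * (K w.1 * K w.2)) := by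
    intro δ ε
    rw [mollOp_apply, moll]
    refine integral_congr_ae (Eventually.of_forall fun v => ?_)
    change moll K K ε f (p.1 + δ * v.1, p.2 + δ * v.2) * (K v.1 * K v.2) = _
    rw [moll, ← integral_mul_const]
    refine integral_congr_ae (Eventually.of_forall fun w => ?_)
    simp only []
    ring
  rw [e δ ε, e ε δ, integral_integral_swap]
  · refine integral_congr_ae (Eventually.of_forall fun w => ?_)
    refine integral_congr_ae (Eventually.of_forall fun v => ?_)
    simp only []
    rw [add_right_comm, add_right_comm p.2, mul_comm (K v.1 * K v.2)]
  · have hk := (integrable_kernel K K).mul_prod (integrable_kernel K K)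
    refine (hk.norm.const_mul ‖f‖).mono'
      (Continuous.aestronglyMeasurable (by fun_prop) |>.mul hk.aestronglyMeasurable)
      (Eventually.of_forall fun v => ?_)
    simp only [Function.uncurry, norm_mul]
    exact mul_le_mul_of_nonneg_right (f.norm_coe_le_norm _) (by positivity)

/-! ### Approximation of smooth functions -/

/-- A crude Taylor formula, for a function given with a chain of derivatives on a half-line. -/
theorem abs_taylor_remainder_le {n : ℕ} {h : ℕ → ℝ → ℝ} {M : ℝ} {t : ℝ} (hM : 0 ≤ M)
    (hd : ∀ i < n, ∀ s ≥ t, HasDerivWithinAt (h i) (h (i + 1) s) (Ici t) s)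
    (hb : ∀ s ≥ t, |h n s| ≤ M) {y : ℝ} (hy : 0 ≤ y) :
    |h 0 (t + y) - ∑ i ∈ Finset.range n, h i t / i.factorial * y ^ i| ≤ M * y ^ n := by
  induction n generalizing h y with
  | zero => simpa using hb (t + y) (by linarith)
  | succ n ih =>
    have hstep := fun s hs => ih (h := fun i => h (i + 1)) (fun i hi s hs => hd (i + 1) (by omega) s hs)
      hb (y := s) hs
    have hsub : ∀ s ∈ Icc 0 y, t + s ∈ Ici t := fun s hs => by
      simp only [mem_Ici]; linarith [hs.1]
    have hder : ∀ s ∈ Icc 0 y, HasDerivWithinAt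
        (fun s => h 0 (t + s) - ∑ i ∈ Finset.range (n + 1), h i t / i.factorial * s ^ i)
        (h 1 (t + s) - ∑ i ∈ Finset.range n, h (i + 1) t / i.factorial * s ^ i) (Icc 0 y) s := by
      intro s hs
      have h1 : HasDerivWithinAt (fun s => h 0 (t + s)) (h 1 (t + s)) (Icc 0 y) s := by
        have h2 : HasDerivWithinAt (fun s => t + s) 1 (Icc 0 y) s :=
          (hasDerivWithinAt_id s _).const_add t
        exact ((hd 0 (by omega) (t + s) (hsub s hs)).comp s h2 hsub).congr_deriv (mul_one _)
      refine h1.sub ?_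
      simp only [Finset.sum_range_succ', pow_zero]
      refine HasDerivWithinAt.add_const _ (HasDerivWithinAt.fun_sum fun i _ => ?_)
      refine ((hasDerivWithinAt_pow (i + 1) s).const_mul
        (h (i + 1) t / ((i + 1).factorial : ℝ))).congr_deriv ?_
      rw [Nat.factorial_succ]
      have h3 : ((i : ℝ) + 1) ≠ 0 := by positivity
      have h4 : (i.factorial : ℝ) ≠ 0 := by positivity
      push_cast
      field_simp
    have hm := (convex_Icc 0 y).norm_image_sub_le_of_norm_hasDerivWithin_le (C := M * y ^ n) hder
      (fun s hs => (hstep s hs.1).trans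
        (mul_le_mul_of_nonneg_left (pow_le_pow_left₀ hs.1 hs.2 n) hM))
      (left_mem_Icc.2 hy) (right_mem_Icc.2 hy)
    have h0 : ∑ i ∈ Finset.range (n + 1), h i t / (i.factorial : ℝ) * (0 : ℝ) ^ i = h 0 t := by
      rw [Finset.sum_range_succ']
      simp
    rw [add_zero, h0, sub_self, sub_zero, sub_zero, Real.norm_eq_abs, Real.norm_eq_abs,
      abs_of_nonneg hy] at hm
    rw [pow_succ, ← mul_assoc]
    exact hm

/-- Since the moments of `K` vanish, averages with respect to `K` at scale `δ` approximate a smooth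
function to every order in `δ`. -/
theorem abs_average_sub_le {K : 𝓢(ℝ, ℝ)} (hK0 : ∀ y ≤ 0, K y = 0) (hK1 : ∫ y, K y = 1)
    (hKm : ∀ n : ℕ, ∫ y, y ^ (n + 1) * K y = 0) {n : ℕ} (hn : 0 < n) {h : ℕ → ℝ → ℝ} {M : ℝ} {t : ℝ}
    (hM : 0 ≤ M) (hd : ∀ i < n, ∀ s ≥ t, HasDerivWithinAt (h i) (h (i + 1) s) (Ici t) s)
    (hb : ∀ s ≥ t, |h n s| ≤ M) {δ : ℝ} (hδ : 0 < δ)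
    (hint : Integrable fun y => h 0 (t + δ * y) * K y) :
    |(∫ y, h 0 (t + δ * y) * K y) - h 0 t| ≤ M * δ ^ n * ∫ y, |y| ^ n * |K y| := by
  have hpow : ∀ i : ℕ, Integrable fun y => y ^ i * K y := fun i =>
    (K.integrable_pow_mul volume i).mono (by fun_prop)
      (Eventually.of_forall fun y => by simp)
  have hpoly : ∀ i : ℕ, Integrable fun y => h i t / (i.factorial : ℝ) * (δ * y) ^ i * K y :=
    fun i => ((hpow i).const_mul (h i t / (i.factorial : ℝ) * δ ^ i)).congr
      (Eventually.of_forall fun y => by simp only [mul_pow]; ring)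
  -- The average of the Taylor polynomial is its constant term.
  have hmom : ∫ y, (∑ i ∈ Finset.range n, h i t / (i.factorial : ℝ) * (δ * y) ^ i * K y) = h 0 t := by
    rw [integral_finsetSum _ fun i _ => hpoly i]
    have e : ∀ i : ℕ, ∫ y, h i t / (i.factorial : ℝ) * (δ * y) ^ i * K y =
        h i t / (i.factorial : ℝ) * δ ^ i * ∫ y, y ^ i * K y := fun i => by
      rw [← integral_const_mul]
      refine integral_congr_ae (Eventually.of_forall fun y => ?_)
      simp only [mul_pow]; ring
    simp only [e]
    obtain ⟨m, rfl⟩ : ∃ m, n = m + 1 := ⟨n - 1, by omega⟩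
    rw [Finset.sum_range_succ']
    simp [hKm, hK1]
  have hsumint := integrable_finsetSum (Finset.range n) fun i _ => hpoly i
  conv_lhs => rw [← hmom]
  rw [← integral_sub hint hsumint, ← integral_const_mul]
  refine abs_integral_le_integral_abs.trans (integral_mono (hint.sub hsumint).abs ?_ fun y => ?_)
  · exact (K.integrable_pow_mul volume n).const_mul (M * δ ^ n)
  · simp only []
    rw [← Finset.sum_mul, ← sub_mul, abs_mul]
    rcases le_or_gt y 0 with hy | hy
    · simp [hK0 y hy]
    · have := abs_taylor_remainder_le hM hd hb (y := δ * y) (by positivity)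
      rw [← mul_assoc]
      refine mul_le_mul_of_nonneg_right (this.trans (le_of_eq ?_)) (abs_nonneg _)
      rw [abs_of_pos hy, mul_pow, mul_assoc]

section

/-! ### Smooth functions of `(t, r)`, even in `r`, as functions of `(t, r²)` -/

/-- The derivative in the first variable of a function on the plane. -/
def pd₁ (G : ℝ × ℝ → ℝ) : ℝ × ℝ → ℝ := fun p => fderiv ℝ G p (1, 0)

/-- The derivative in the second variable of a function on the plane. -/
def pd₂ (G : ℝ × ℝ → ℝ) : ℝ × ℝ → ℝ := fun p => fderiv ℝ G p (0, 1)

theorem contDiff_pd₁ {G : ℝ × ℝ → ℝ} (hG : ContDiff ℝ (⊤ : ℕ∞) G) : ContDiff ℝ (⊤ : ℕ∞) (pd₁ G) :=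
  (hG.fderiv_right (by simp)).clm_apply contDiff_const

theorem contDiff_pd₂ {G : ℝ × ℝ → ℝ} (hG : ContDiff ℝ (⊤ : ℕ∞) G) : ContDiff ℝ (⊤ : ℕ∞) (pd₂ G) :=
  (hG.fderiv_right (by simp)).clm_apply contDiff_const

theorem hasDerivAt_pd₁ {G : ℝ × ℝ → ℝ} (hG : ContDiff ℝ (⊤ : ℕ∞) G) (t r : ℝ) :
    HasDerivAt (fun s => G (s, r)) (pd₁ G (t, r)) t := by
  have h := (hG.differentiable (by simp) (t, r)).hasFDerivAt
  exact HasFDerivAt.comp_hasDerivAt t h ((hasDerivAt_id t).prodMk (hasDerivAt_const t r))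

theorem hasDerivAt_pd₂ {G : ℝ × ℝ → ℝ} (hG : ContDiff ℝ (⊤ : ℕ∞) G) (t r : ℝ) :
    HasDerivAt (fun s => G (t, s)) (pd₂ G (t, r)) r := by
  have h := (hG.differentiable (by simp) (t, r)).hasFDerivAt
  exact HasFDerivAt.comp_hasDerivAt r h ((hasDerivAt_const r t).prodMk (hasDerivAt_id r))

theorem hasDerivAt_integral_of_continuous {F F' : ℝ → ℝ → ℝ} (hF : Continuous (Function.uncurry F))
    (hF' : Continuous (Function.uncurry F')) (hd : ∀ x s, HasDerivAt (fun x => F x s) (F' x s) x)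
    (x : ℝ) : HasDerivAt (fun x => ∫ s in (0 : ℝ)..1, F x s) (∫ s in (0 : ℝ)..1, F' x s) x := by
  obtain ⟨C, hC⟩ := ((isCompact_closedBall x (1 : ℝ)).prod (isCompact_Icc (a := (0 : ℝ))
    (b := 1))).exists_bound_of_continuousOn hF'.continuousOn
  have hs : ∀ x, Continuous (F x) := fun x => hF.comp (Continuous.prodMk_right x)
  have hs' : ∀ x, Continuous (F' x) := fun x => hF'.comp (Continuous.prodMk_right x)
  refine (intervalIntegral.hasDerivAt_integral_of_dominated_loc_of_deriv_le (μ := volume)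
    (bound := fun _ => C) (Metric.closedBall_mem_nhds x one_pos)
    (Eventually.of_forall fun y => (hs y).aestronglyMeasurable) ((hs x).intervalIntegrable _ _)
    (hs' x).aestronglyMeasurable (Eventually.of_forall fun s hs y hy => ?_)
    intervalIntegrable_const (Eventually.of_forall fun s _ y _ => hd y s)).2
  rw [uIoc_of_le zero_le_one] at hs
  exact hC (y, s) ⟨hy, ⟨hs.1.le, hs.2⟩⟩

/-- The average `∫₀¹ s ^ m G(t, s r) ds`. -/
def radialAvg (m : ℕ) (G : ℝ × ℝ → ℝ) (p : ℝ × ℝ) : ℝ := ∫ s in (0 : ℝ)..1, s ^ m * G (p.1, s * p.2)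

theorem contDiff_radialAvg (m : ℕ) {G : ℝ × ℝ → ℝ} (hG : ContDiff ℝ (⊤ : ℕ∞) G) :
    ContDiff ℝ (⊤ : ℕ∞) (radialAvg m G) := by
  rw [← contDiffOn_univ, ← univ_prod_univ]
  refine contDiffOn_of_partials convex_univ
    (fun h => ∃ (m : ℕ) (G : ℝ × ℝ → ℝ), ContDiff ℝ (⊤ : ℕ∞) G ∧ h = radialAvg m G) ?_ ?_
    ⟨m, G, hG, rfl⟩
  · rintro _ ⟨m, G, hG, rfl⟩
    have hc := hG.continuous
    exact (intervalIntegral.continuous_parametric_intervalIntegral_of_continuous'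
      (by fun_prop) 0 1).continuousOn
  · rintro _ ⟨m, G, hG, rfl⟩
    have hc := hG.continuous
    have hc₁ := (contDiff_pd₁ hG).continuous
    have hc₂ := (contDiff_pd₂ hG).continuous
    refine ⟨_, _, ⟨m, pd₁ G, contDiff_pd₁ hG, rfl⟩, ⟨m + 1, pd₂ G, contDiff_pd₂ hG, rfl⟩,
      fun q _ => HasDerivAt.hasDerivWithinAt ?_, fun q _ => HasDerivAt.hasDerivWithinAt ?_⟩
    · exact hasDerivAt_integral_of_continuous (F := fun t s => s ^ m * G (t, s * q.2))
        (F' := fun t s => s ^ m * pd₁ G (t, s * q.2)) (by fun_prop) (by fun_prop)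
        (fun t s => (hasDerivAt_pd₁ hG t _).const_mul _) q.1
    · refine hasDerivAt_integral_of_continuous (F := fun r s => s ^ m * G (q.1, s * r))
        (F' := fun r s => s ^ (m + 1) * pd₂ G (q.1, s * r)) (by fun_prop) (by fun_prop)
        (fun r s => ?_) q.2
      have h1 : HasDerivAt (fun r => s * r) s r := by simpa using (hasDerivAt_id r).const_mul s
      refine (((hasDerivAt_pd₂ hG q.1 (s * r)).comp r h1).const_mul (s ^ m)).congr_deriv ?_
      rw [pow_succ]; ring

/-- The smooth functions of `(t, r)` in the plane which are even in `r`. -/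
def EvenSmooth : Submodule ℝ (ℝ × ℝ → ℝ) where
  carrier := {G | ContDiff ℝ (⊤ : ℕ∞) G ∧ ∀ t r, G (t, -r) = G (t, r)}
  zero_mem' := ⟨contDiff_const, fun _ _ => rfl⟩
  add_mem' := by
    rintro G H ⟨hG, hG'⟩ ⟨hH, hH'⟩
    exact ⟨hG.add hH, fun t r => by simp [hG' t r, hH' t r]⟩
  smul_mem' := by
    rintro c G ⟨hG, hG'⟩
    exact ⟨contDiff_const.smul hG, fun t r => by simp [hG' t r]⟩

theorem pd₁_even {G : ℝ × ℝ → ℝ} (hG : ContDiff ℝ (⊤ : ℕ∞) G) (he : ∀ t r, G (t, -r) = G (t, r))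
    (t r : ℝ) : pd₁ G (t, -r) = pd₁ G (t, r) := by
  have h := hasDerivAt_pd₁ hG t (-r)
  simp only [he] at h
  exact h.unique (hasDerivAt_pd₁ hG t r)

theorem pd₂_neg {G : ℝ × ℝ → ℝ} (hG : ContDiff ℝ (⊤ : ℕ∞) G) {c : ℝ}
    (he : ∀ t r, G (t, -r) = c * G (t, r)) (t r : ℝ) : pd₂ G (t, -r) = -c * pd₂ G (t, r) := by
  have h := (hasDerivAt_pd₂ hG t (-r)).comp r (hasDerivAt_neg r)
  have e : (fun s => G (t, s)) ∘ Neg.neg = fun s => c * G (t, s) := by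
    funext s; simp [he]
  rw [e] at h
  have := h.unique ((hasDerivAt_pd₂ hG t r).const_mul c)
  linarith

theorem pd₁_add {G H : ℝ × ℝ → ℝ} (hG : ContDiff ℝ (⊤ : ℕ∞) G) (hH : ContDiff ℝ (⊤ : ℕ∞) H) :
    pd₁ (G + H) = pd₁ G + pd₁ H := by
  funext p
  simp only [pd₁, Pi.add_apply]
  rw [fderiv_add (hG.differentiable (by simp) p) (hH.differentiable (by simp) p)]
  rfl

theorem pd₂_add {G H : ℝ × ℝ → ℝ} (hG : ContDiff ℝ (⊤ : ℕ∞) G) (hH : ContDiff ℝ (⊤ : ℕ∞) H) :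
    pd₂ (G + H) = pd₂ G + pd₂ H := by
  funext p
  simp only [pd₂, Pi.add_apply]
  rw [fderiv_add (hG.differentiable (by simp) p) (hH.differentiable (by simp) p)]
  rfl

theorem pd₁_smul (c : ℝ) {G : ℝ × ℝ → ℝ} (hG : ContDiff ℝ (⊤ : ℕ∞) G) : pd₁ (c • G) = c • pd₁ G := by
  funext p
  simp only [pd₁, Pi.smul_apply]
  rw [fderiv_const_smul (hG.differentiable (by simp) p)]
  rfl

theorem pd₂_smul (c : ℝ) {G : ℝ × ℝ → ℝ} (hG : ContDiff ℝ (⊤ : ℕ∞) G) : pd₂ (c • G) = c • pd₂ G := by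
  funext p
  simp only [pd₂, Pi.smul_apply]
  rw [fderiv_const_smul (hG.differentiable (by simp) p)]
  rfl

/-- The derivative in `t` on `EvenSmooth`. -/
def evenDt : Module.End ℝ EvenSmooth where
  toFun G := ⟨pd₁ G, contDiff_pd₁ G.2.1, pd₁_even G.2.1 G.2.2⟩
  map_add' G H := Subtype.ext (pd₁_add G.2.1 H.2.1)
  map_smul' c G := Subtype.ext (pd₁_smul c G.2.1)

/-- The second derivative in `r` on `EvenSmooth`. -/
def evenDrr : Module.End ℝ EvenSmooth where
  toFun G := ⟨pd₂ (pd₂ G), contDiff_pd₂ (contDiff_pd₂ G.2.1), fun t r => by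
    have h1 : ∀ t r, pd₂ G (t, -r) = -1 * pd₂ G (t, r) := fun t r =>
      pd₂_neg G.2.1 (fun t r => by rw [G.2.2, one_mul]) t r
    rw [pd₂_neg (contDiff_pd₂ G.2.1) h1 t r, neg_neg, one_mul]⟩
  map_add' G H := Subtype.ext (by
    change pd₂ (pd₂ ((G : ℝ × ℝ → ℝ) + H)) = pd₂ (pd₂ G) + pd₂ (pd₂ H)
    rw [pd₂_add G.2.1 H.2.1, pd₂_add (contDiff_pd₂ G.2.1) (contDiff_pd₂ H.2.1)])
  map_smul' c G := Subtype.ext (by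
    change pd₂ (pd₂ (c • (G : ℝ × ℝ → ℝ))) = c • pd₂ (pd₂ G)
    rw [pd₂_smul c G.2.1, pd₂_smul c (contDiff_pd₂ G.2.1)])

/-- The quotient `∂_r G / (2 r)`, that is `½ ∫₀¹ ∂_r² G(t, s r) ds`. -/
def evenQuot (G : EvenSmooth) : EvenSmooth :=
  ⟨(1 / 2 : ℝ) • radialAvg 0 (pd₂ (pd₂ G)),
    contDiff_const.smul (contDiff_radialAvg 0 (contDiff_pd₂ (contDiff_pd₂ G.2.1))), fun t r => by
      simp only [Pi.smul_apply, radialAvg, mul_neg]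
      congr 1
      refine intervalIntegral.integral_congr fun s _ => ?_
      exact congrArg (s ^ 0 * ·) ((evenDrr G).2.2 t (s * r))⟩

theorem two_mul_evenQuot (G : EvenSmooth) (t r : ℝ) :
    2 * r * (evenQuot G : ℝ × ℝ → ℝ) (t, r) = pd₂ G (t, r) := by
  have h0 : pd₂ G (t, 0) = 0 := by
    have := pd₂_neg G.2.1 (c := 1) (fun t r => by rw [G.2.2, one_mul]) t 0
    rw [neg_zero] at this
    linarith
  have hint : ∫ s in (0 : ℝ)..1, pd₂ (pd₂ G) (t, s * r) * r = pd₂ G (t, 1 * r) - pd₂ G (t, 0 * r) := by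
    have hc := (contDiff_pd₂ (contDiff_pd₂ G.2.1)).continuous
    refine intervalIntegral.integral_eq_sub_of_hasDerivAt (f := fun s => pd₂ G (t, s * r))
      (fun s _ => ?_) (Continuous.intervalIntegrable (by fun_prop) _ _)
    have h1 : HasDerivAt (fun s => s * r) r s := by simpa using (hasDerivAt_id s).mul_const r
    exact (hasDerivAt_pd₂ (contDiff_pd₂ G.2.1) t (s * r)).comp s h1
  rw [one_mul, zero_mul, h0, sub_zero, intervalIntegral.integral_mul_const] at hint
  rw [← hint]
  simp [evenQuot, radialAvg]
  ring

theorem hasDerivWithinAt_comp_sqrt (G : EvenSmooth) {t x : ℝ} (hx : 0 ≤ x) :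
    HasDerivWithinAt (fun y => (G : ℝ × ℝ → ℝ) (t, √y)) ((evenQuot G : ℝ × ℝ → ℝ) (t, √x)) (Ici 0) x := by
  have hpos : ∀ y > 0, HasDerivAt (fun y => (G : ℝ × ℝ → ℝ) (t, √y))
      ((evenQuot G : ℝ × ℝ → ℝ) (t, √y)) y := by
    intro y hy
    have h1 := (hasDerivAt_pd₂ G.2.1 t (√y)).comp y (Real.hasDerivAt_sqrt (ne_of_gt hy))
    refine h1.congr_deriv ?_
    rw [← two_mul_evenQuot]
    have := (Real.sqrt_pos.2 hy).ne'
    field_simp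
  have hGc := G.2.1.continuous
  have hQc := (evenQuot G).2.1.continuous
  rcases eq_or_lt_of_le hx with rfl | hx
  · refine hasDerivWithinAt_Ici_of_tendsto_deriv (s := Ioi 0)
      (fun y hy => (hpos y hy).differentiableAt.differentiableWithinAt)
      (Continuous.continuousWithinAt (by fun_prop)) self_mem_nhdsWithin ?_
    have hc : Continuous fun y => (evenQuot G : ℝ × ℝ → ℝ) (t, √y) := by fun_prop
    refine ((hc.tendsto 0).mono_left nhdsWithin_le_nhds).congr' ?_
    filter_upwards [self_mem_nhdsWithin] with y hy
    exact (hpos y hy).deriv.symm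
  · exact (hpos x hx).hasDerivWithinAt

theorem contDiffOn_comp_sqrt (G : EvenSmooth) :
    ContDiffOn ℝ (⊤ : ℕ∞) (fun p : ℝ × ℝ => (G : ℝ × ℝ → ℝ) (p.1, √p.2)) (univ ×ˢ Ici 0) := by
  refine contDiffOn_of_partials convex_univ
    (fun h => ∃ G : EvenSmooth, h = fun p => (G : ℝ × ℝ → ℝ) (p.1, √p.2)) ?_ ?_ ⟨G, rfl⟩
  · rintro _ ⟨G, rfl⟩
    have hGc := G.2.1.continuous
    exact Continuous.continuousOn (by fun_prop)
  · rintro _ ⟨G, rfl⟩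
    exact ⟨_, _, ⟨evenDt G, rfl⟩, ⟨evenQuot G, rfl⟩,
      fun q _ => (hasDerivAt_pd₁ G.2.1 q.1 (√q.2)).hasDerivWithinAt,
      fun q hq => hasDerivWithinAt_comp_sqrt G hq.2⟩

variable {T : ℝ}

theorem contDiffOn_fold (G : EvenSmooth) :
    ContDiffOn ℝ (⊤ : ℕ∞) (fun p : ℝ × ℝ => (G : ℝ × ℝ → ℝ) (p.1, √p.2)) (rect T) :=
  (contDiffOn_comp_sqrt G).mono fun _ hp => ⟨trivial, hp.2.1⟩

/-- The smooth function `(t, x) ↦ G(t, √x)` on the rectangle, for `G` even in the second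
variable. -/
def fold : EvenSmooth →ₗ[ℝ] Smooth T where
  toFun G := Smooth.mk (contDiffOn_fold G)
  map_add' G H := Smooth.ext fun _ hp => (Smooth.mk_apply _ hp).trans
    (congrArg₂ (· + ·) (Smooth.mk_apply (contDiffOn_fold G) hp).symm
      (Smooth.mk_apply (contDiffOn_fold H) hp).symm)
  map_smul' c G := Smooth.ext fun _ hp => (Smooth.mk_apply _ hp).trans
    (congrArg (c * ·) (Smooth.mk_apply (contDiffOn_fold G) hp).symm)

theorem fold_apply (G : EvenSmooth) {p : ℝ × ℝ} (hp : p ∈ rect T) :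
    (fold G : Smooth T).1 p = (G : ℝ × ℝ → ℝ) (p.1, √p.2) := Smooth.mk_apply (contDiffOn_fold G) hp

variable [hT : Fact (0 < T)]

theorem Dt_fold (G : EvenSmooth) : Dt (fold G : Smooth T) = fold (evenDt G) := by
  refine Smooth.ext fun p hp => ?_
  rw [fold_apply _ hp]
  refine Dt_eq_of_hasDerivWithinAt hp
    (((hasDerivAt_pd₁ G.2.1 p.1 (√p.2)).hasDerivWithinAt).congr (fun s hs => ?_) (fold_apply G hp))
  exact fold_apply G (p := (s, p.2)) ⟨hs, hp.2⟩

theorem Dx_fold (G : EvenSmooth) : Dx (fold G : Smooth T) = fold (evenQuot G) := by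
  refine Smooth.ext fun p hp => ?_
  rw [fold_apply _ hp]
  refine Dx_eq_of_hasDerivWithinAt hp
    (((hasDerivWithinAt_comp_sqrt G hp.2.1).mono Icc_subset_Ici_self).congr (fun s hs => ?_)
      (fold_apply G hp))
  exact fold_apply G (p := (p.1, s)) ⟨hp.1, hs⟩

/-- In the variable `r = √x` the operator `Λ_{1/2}` is `¼ ∂_r²`. -/
theorem Lap_fold (G : EvenSmooth) :
    Lap (1 / 2) (fold G : Smooth T) = fold ((1 / 4 : ℝ) • evenDrr G) := by
  refine Smooth.ext fun p hp => ?_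
  rw [Lap_apply, Dx_fold, Dx_fold, fold_apply _ hp, fold_apply _ hp, fold_apply _ hp]
  set r := √p.2 with hr
  have hr2 : p.2 = r ^ 2 := (Real.sq_sqrt hp.2.1).symm
  have h1 := two_mul_evenQuot (evenQuot G) p.1 r
  -- Differentiate `2 r Q = ∂_r G`.
  have h2 : 2 * (evenQuot G : ℝ × ℝ → ℝ) (p.1, r) + 2 * r * pd₂ (evenQuot G) (p.1, r)
      = pd₂ (pd₂ G) (p.1, r) := by
    have d1 : HasDerivAt (fun s => 2 * s * (evenQuot G : ℝ × ℝ → ℝ) (p.1, s))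
        (2 * (evenQuot G : ℝ × ℝ → ℝ) (p.1, r) + 2 * r * pd₂ (evenQuot G) (p.1, r)) r := by
      have := ((hasDerivAt_id r).const_mul 2).mul (hasDerivAt_pd₂ (evenQuot G).2.1 p.1 r)
      exact this.congr_deriv (by simp)
    simp only [two_mul_evenQuot] at d1
    exact d1.unique (hasDerivAt_pd₂ (contDiff_pd₂ G.2.1) p.1 r)
  have h3 : (((1 / 4 : ℝ) • evenDrr G : EvenSmooth) : ℝ × ℝ → ℝ) (p.1, r)
      = 1 / 4 * pd₂ (pd₂ G) (p.1, r) := rfl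
  rw [h3, ← h2, hr2, ← h1]
  ring

theorem Op_fold (j k : ℕ) (G : EvenSmooth) : Op (1 / 2) j k (fold G : Smooth T) =
    (1 / 4 : ℝ) ^ k • fold ((evenDrr ^ k) ((evenDt ^ (2 * j)) G)) := by
  have h1 : ∀ (k : ℕ) (G : EvenSmooth), (Lap (1 / 2) ^ k) (fold G : Smooth T) =
      (1 / 4 : ℝ) ^ k • fold ((evenDrr ^ k) G) := by
    intro k
    induction k with
    | zero => intro G; simp
    | succ k ih =>
      intro G
      rw [pow_succ, Module.End.mul_apply, Lap_fold, map_smul, map_smul, ih, smul_smul, pow_succ' (1 / 4 : ℝ),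
        pow_succ evenDrr, Module.End.mul_apply]
  have h2 : ∀ (i : ℕ) (G : EvenSmooth), (Dt ^ i) (fold G : Smooth T) = fold ((evenDt ^ i) G) := by
    intro i
    induction i with
    | zero => intro G; simp
    | succ i ih => intro G; rw [pow_succ, Module.End.mul_apply, Dt_fold, ih, pow_succ, Module.End.mul_apply]
  rw [Op, ((commute_Dt_Lap (1 / 2)).pow_pow _ _).eq, Module.End.mul_apply, h2, h1]

end

/-! ### Tame direct summands of `Σ(B)` from smoothing operators -/

/-- Operators `b k` which decrease rapidly with `k` and operators `a k` which grow at a controlled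
rate present `V` as a tame direct summand of `Σ(B)`, if `∑ a k ∘ b k` is the identity. -/
theorem isTameDirectSummand_of_operators {V B : Type*} [AddCommGroup V] [Module ℝ V]
    [NormedAddCommGroup B] [NormedSpace ℝ B] (p : ℕ → Seminorm ℝ V)
    (hdef : ∀ v, p 0 v = 0 → v = 0)
    (hcomplete : ∀ f : ℕ → V,
      (∀ n : ℕ, ∀ ε > 0, ∃ K : ℕ, ∀ i ≥ K, ∀ j ≥ K, p n (f i - f j) < ε) →
      ∃ v : V, ∀ n : ℕ, Tendsto (fun i => p n (f i - v)) atTop (𝓝 0))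
    (r : ℕ) (b : ℕ → V →ₗ[ℝ] B) (a : ℕ → B →ₗ[ℝ] V)
    (hb : ∀ n : ℕ, ∃ C : ℝ, 0 ≤ C ∧ ∀ (k : ℕ) (v : V), ‖b k v‖ ≤ C * Real.exp (-(n * k)) * p (n + r) v)
    (ha : ∀ n : ℕ, ∃ C : ℝ, 0 ≤ C ∧ ∀ (k : ℕ) (f : B), p n (a k f) ≤ C * Real.exp (n * k) * ‖f‖)
    (hsum : ∀ v, Tendsto (fun K => p 0 (∑ k ∈ Finset.range K, a k (b k v) - v)) atTop (𝓝 0)) :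
    IsTameDirectSummand (fun n v => p n v) (expSeqNorm B) := by
  have hgeom : Summable fun k : ℕ => Real.exp (-(k : ℝ)) := Real.summable_exp_neg_nat
  -- The decay of `b k v`, with one degree more than needed for summability.
  have hb' : ∀ n : ℕ, ∃ C : ℝ, 0 ≤ C ∧ ∀ (k : ℕ) (v : V),
      Real.exp (n * k) * ‖b k v‖ ≤ Real.exp (-(k : ℝ)) * (C * p (n + (r + 1)) v) := by
    intro n
    obtain ⟨C, hC, h⟩ := hb (n + 1)
    refine ⟨C, hC, fun k v => ?_⟩
    refine (mul_le_mul_of_nonneg_left (h k v) (Real.exp_pos _).le).trans (le_of_eq ?_)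
    have e : Real.exp (-(k : ℝ)) = Real.exp (n * k) * Real.exp (-((n + 1 : ℕ) * k)) := by
      rw [← Real.exp_add]; congr 1; push_cast; ring
    rw [e, show n + 1 + r = n + (r + 1) by ring]
    ring
  have hmem : ∀ v, (fun k => b k v) ∈ ExpSeq B := fun v n => by
    obtain ⟨C, -, h⟩ := hb' n
    exact Summable.of_nonneg_of_le (fun k => by positivity) (fun k => h k v) (hgeom.mul_right _)
  let L : V →ₗ[ℝ] ExpSeq B :=
    { toFun := fun v => ⟨fun k => b k v, hmem v⟩
      map_add' := fun v w => Subtype.ext (funext fun k => map_add (b k) v w)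
      map_smul' := fun c v => Subtype.ext (funext fun k => map_smul (b k) c v) }
  set S : ExpSeq B → ℕ → V := fun f K => ∑ k ∈ Finset.range K, a k ((f : ℕ → B) k) with hS
  have hlim : ∀ f : ExpSeq B, ∃ v : V, ∀ n : ℕ, Tendsto (fun K => p n (S f K - v)) atTop (𝓝 0) := by
    intro f
    refine hcomplete _ fun n ε hε => ?_
    obtain ⟨C, hC, h⟩ := ha n
    -- The tails of the sums are dominated by those of a convergent series.
    have hs := (f.2 n).mul_left C
    have hc := hs.hasSum.tendsto_sum_nat.cauchySeq
    obtain ⟨K, hK⟩ := Metric.cauchySeq_iff.1 hc ε hε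
    have key : ∀ i j : ℕ, i ≤ j → p n (S f i - S f j) ≤
        dist (∑ k ∈ Finset.range i, C * (Real.exp (n * k) * ‖(f : ℕ → B) k‖))
          (∑ k ∈ Finset.range j, C * (Real.exp (n * k) * ‖(f : ℕ → B) k‖)) := by
      intro i j hij
      rw [map_sub_rev, hS, dist_comm, Real.dist_eq]
      simp only []
      rw [← Finset.sum_Ico_eq_sub _ hij, ← Finset.sum_Ico_eq_sub _ hij]
      refine le_trans ?_ (le_abs_self _)
      refine (Finset.le_sum_of_subadditive (p n) (map_zero (p n)).le (map_add_le_add (p n)) _ _).trans (Finset.sum_le_sum fun k _ => ?_)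
      exact (h k _).trans (le_of_eq (by ring))
    refine ⟨K, fun i hi j hj => ?_⟩
    rcases le_total i j with hij | hij
    · exact (key i j hij).trans_lt (hK i hi j hj)
    · rw [map_sub_rev]
      exact (key j i hij).trans_lt (hK j hj i hi)
  choose M hM using hlim
  have huniq : ∀ (s : ℕ → V) (v w : V), Tendsto (fun K => p 0 (s K - v)) atTop (𝓝 0) →
      Tendsto (fun K => p 0 (s K - w)) atTop (𝓝 0) → v = w := by
    intro s v w hv hw
    refine sub_eq_zero.1 (hdef _ (le_antisymm ?_ (apply_nonneg _ _)))
    have h := hv.add hw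
    rw [add_zero] at h
    refine ge_of_tendsto' h fun K => ?_
    rw [map_sub_rev (p 0) (s K) v]
    simpa using map_add_le_add (p 0) (v - s K) (s K - w)
  let M' : ExpSeq B →ₗ[ℝ] V :=
    { toFun := M
      map_add' := fun f g => huniq _ _ _ (hM (f + g) 0) (by
        have h := (hM f 0).add (hM g 0)
        rw [add_zero] at h
        refine squeeze_zero (fun K => apply_nonneg _ _) (fun K => ?_) h
        have e : S (f + g) K - (M f + M g) = (S f K - M f) + (S g K - M g) := by
          have : S (f + g) K = S f K + S g K := by
            simp [hS, Finset.sum_add_distrib]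
          rw [this]; abel
        rw [e]
        exact map_add_le_add _ _ _)
      map_smul' := fun c f => huniq _ _ _ (hM (c • f) 0) (by
        have h := (hM f 0).const_mul ‖c‖
        rw [mul_zero] at h
        refine h.congr fun K => ?_
        have e : S (c • f) K - c • M f = c • (S f K - M f) := by
          have : S (c • f) K = c • S f K := by
            simp [hS, Finset.smul_sum]
          rw [this, smul_sub]
        change _ = p 0 (S (c • f) K - c • M f)
        rw [e, map_smul_eq_mul]) }
  refine ⟨L, M', ⟨r + 1, 0, fun n _ => ?_⟩, ⟨0, 0, fun n _ => ?_⟩, ?_⟩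
  · obtain ⟨C, hC, h⟩ := hb' n
    refine ⟨(∑' k : ℕ, Real.exp (-(k : ℝ))) * C, fun v => ?_⟩
    rw [mul_assoc, ← tsum_mul_right]
    exact (hmem v n).tsum_le_tsum (fun k => h k v) (hgeom.mul_right _)
  · obtain ⟨C, hC, h⟩ := ha n
    refine ⟨C, fun f => ?_⟩
    have h1 := (hM f n).add_const (C * expSeqNorm B (n + 0) f)
    rw [zero_add] at h1
    refine ge_of_tendsto' h1 fun K => ?_
    have e : p n (M f) ≤ p n (S f K - M f) + p n (S f K) := by
      rw [map_sub_rev]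
      simpa using map_add_le_add (p n) (M f - S f K) (S f K)
    refine e.trans (add_le_add le_rfl ((Finset.le_sum_of_subadditive (p n) (map_zero (p n)).le (map_add_le_add (p n)) _ _).trans ?_))
    rw [expSeqNorm, add_zero, ← tsum_mul_left]
    refine le_trans (Finset.sum_le_sum fun k _ => ?_)
      (((f.2 n).mul_left C).sum_le_tsum (Finset.range K) (fun k _ => by positivity))
    exact (h k _).trans (le_of_eq (by ring))
  · refine LinearMap.ext fun v => ?_
    exact huniq _ _ _ (hM (L v) 0) (hsum v)

/-! ### Functions vanishing near a side of the rectangle -/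

section Cutoff

variable {T : ℝ}

/-- The smooth functions on the rectangle vanishing for `5/6 ≤ x ≤ 1`. -/
def vanishX (T : ℝ) : Submodule ℝ (Smooth T) where
  carrier := {u | ∀ p ∈ rect T, 5 / 6 ≤ p.2 → (u : ℝ × ℝ → ℝ) p = 0}
  zero_mem' := fun _ _ _ => rfl
  add_mem' := fun {u v} hu hv p hp h => by simp [hu p hp h, hv p hp h]
  smul_mem' := fun c u hu p hp h => by simp [hu p hp h]

/-- The smooth functions on the rectangle vanishing for `2 T / 3 ≤ t ≤ T`. -/
def vanishT (T : ℝ) : Submodule ℝ (Smooth T) where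
  carrier := {u | ∀ p ∈ rect T, 2 * T / 3 ≤ p.1 → (u : ℝ × ℝ → ℝ) p = 0}
  zero_mem' := fun _ _ _ => rfl
  add_mem' := fun {u v} hu hv p hp h => by simp [hu p hp h, hv p hp h]
  smul_mem' := fun c u hu p hp h => by simp [hu p hp h]

theorem eq_zero_of_mem_vanishX {u : Smooth T} (hu : u ∈ vanishX T) {p : ℝ × ℝ} (hp : 5 / 6 ≤ p.2) :
    (u : ℝ × ℝ → ℝ) p = 0 := by
  by_cases h : p ∈ rect T
  · exact hu p h hp
  · exact u.2.2 p h

theorem eq_zero_of_mem_vanishT {u : Smooth T} (hu : u ∈ vanishT T) {p : ℝ × ℝ}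
    (hp : 2 * T / 3 ≤ p.1) : (u : ℝ × ℝ → ℝ) p = 0 := by
  by_cases h : p ∈ rect T
  · exact hu p h hp
  · exact u.2.2 p h

/-- Multiplication by a smooth function of `t`. -/
def mulT (φ : ℝ → ℝ) (hφ : ContDiff ℝ (⊤ : ℕ∞) φ) : Module.End ℝ (Smooth T) where
  toFun u := ⟨fun p => φ p.1 * (u : ℝ × ℝ → ℝ) p,
    (hφ.comp contDiff_fst).contDiffOn.mul u.2.1, fun p hp => by simp [u.2.2 p hp]⟩
  map_add' u v := by ext p; simp [mul_add]
  map_smul' c u := by ext p; simp; ring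

theorem mulT_apply {φ : ℝ → ℝ} (hφ : ContDiff ℝ (⊤ : ℕ∞) φ) (u : Smooth T) (p : ℝ × ℝ) :
    (mulT φ hφ u : ℝ × ℝ → ℝ) p = φ p.1 * (u : ℝ × ℝ → ℝ) p := rfl

theorem mulT_mem_vanishX {φ : ℝ → ℝ} (hφ : ContDiff ℝ (⊤ : ℕ∞) φ) {u : Smooth T}
    (hu : u ∈ vanishX T) : mulT φ hφ u ∈ vanishX T := fun p hp h => by
  rw [mulT_apply, hu p hp h, mul_zero]

variable [hT : Fact (0 < T)]

theorem Dt_mem_vanishX {u : Smooth T} (hu : u ∈ vanishX T) : Dt u ∈ vanishX T := fun p hp h =>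
  Dt_eq_of_hasDerivWithinAt hp ((hasDerivWithinAt_const p.1 (Icc 0 T) (0 : ℝ)).congr
    (fun _ _ => eq_zero_of_mem_vanishX hu h) (eq_zero_of_mem_vanishX hu h))

theorem Dx_mem_vanishX {u : Smooth T} (hu : u ∈ vanishX T) : Dx u ∈ vanishX T := fun p hp h => by
  have hm : p.2 ∈ Icc (5 / 6 : ℝ) 1 := ⟨h, hp.2.2⟩
  have h1 := (hasDerivWithinAt_Dx u hp).mono (Icc_subset_Icc_left (by norm_num : (0 : ℝ) ≤ 5 / 6))
  have h2 := (hasDerivWithinAt_const p.2 (Icc (5 / 6) 1) (0 : ℝ)).congr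
    (fun y hy => eq_zero_of_mem_vanishX hu (p := (p.1, y)) hy.1) (eq_zero_of_mem_vanishX hu h)
  exact (uniqueDiffOn_Icc (by norm_num) p.2 hm).eq_deriv _ h1 h2

theorem Lap_mem_vanishX (a : ℝ) {u : Smooth T} (hu : u ∈ vanishX T) : Lap a u ∈ vanishX T :=
  fun p hp h => by
    rw [Lap_apply, Dx_mem_vanishX hu p hp h, Dx_mem_vanishX (Dx_mem_vanishX hu) p hp h]
    ring

theorem Lap_pow_mem_vanishX (a : ℝ) (k : ℕ) {u : Smooth T} (hu : u ∈ vanishX T) :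
    (Lap a ^ k) u ∈ vanishX T := by
  induction k with
  | zero => exact hu
  | succ k ih => rw [pow_succ', Module.End.mul_apply]; exact Lap_mem_vanishX a ih

theorem Dt_mem_vanishT {u : Smooth T} (hu : u ∈ vanishT T) : Dt u ∈ vanishT T := fun p hp h => by
  have hT' := hT.out
  have hm : p.1 ∈ Icc (2 * T / 3) T := ⟨h, hp.1.2⟩
  have h1 := (hasDerivWithinAt_Dt u hp).mono (Icc_subset_Icc_left (by linarith : 0 ≤ 2 * T / 3))
  have h2 := (hasDerivWithinAt_const p.1 (Icc (2 * T / 3) T) (0 : ℝ)).congr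
    (fun y hy => eq_zero_of_mem_vanishT hu (p := (y, p.2)) hy.1) (eq_zero_of_mem_vanishT hu h)
  exact (uniqueDiffOn_Icc (by linarith) p.1 hm).eq_deriv _ h1 h2

theorem Dt_pow_mem_vanishT (k : ℕ) {u : Smooth T} (hu : u ∈ vanishT T) : (Dt ^ k) u ∈ vanishT T := by
  induction k with
  | zero => exact hu
  | succ k ih => rw [pow_succ', Module.End.mul_apply]; exact Dt_mem_vanishT ih

theorem hasDerivWithinAt_Ici_Dt {u : Smooth T} (hu : u ∈ vanishT T) {s : ℝ} (hs : 0 ≤ s) (x : ℝ) :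
    HasDerivWithinAt (fun s => (u : ℝ × ℝ → ℝ) (s, x)) ((Dt u : ℝ × ℝ → ℝ) (s, x)) (Ici 0) s := by
  have hT' := hT.out
  rcases lt_or_ge s T with h | h
  · by_cases hx : x ∈ Icc (0 : ℝ) 1
    · have hp : (s, x) ∈ rect T := ⟨⟨hs, h.le⟩, hx⟩
      refine (hasDerivWithinAt_Dt u hp).mono_of_mem_nhdsWithin ?_
      filter_upwards [self_mem_nhdsWithin, mem_nhdsWithin_of_mem_nhds (Iio_mem_nhds h)] with y h1 h2
      exact ⟨h1, le_of_lt h2⟩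
    · have h0 : ∀ (v : Smooth T) (s : ℝ), (v : ℝ × ℝ → ℝ) (s, x) = 0 :=
        fun v s => v.2.2 _ fun hp => hx hp.2
      simp only [h0]
      exact hasDerivWithinAt_const _ _ _
  · have e : (Dt u : ℝ × ℝ → ℝ) (s, x) = 0 :=
      eq_zero_of_mem_vanishT (Dt_mem_vanishT hu) (p := (s, x)) (by simp only []; linarith)
    rw [e]
    refine ((hasDerivAt_const s (0 : ℝ)).congr_of_eventuallyEq ?_).hasDerivWithinAt
    filter_upwards [Ioi_mem_nhds (show 2 * T / 3 < s by linarith)] with y hy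
    exact eq_zero_of_mem_vanishT hu (p := (y, x)) (le_of_lt hy)

theorem hasDerivWithinAt_Ici_Dx {u : Smooth T} (hu : u ∈ vanishX T) (t : ℝ) {y : ℝ} (hy : 0 ≤ y) :
    HasDerivWithinAt (fun y => (u : ℝ × ℝ → ℝ) (t, y)) ((Dx u : ℝ × ℝ → ℝ) (t, y)) (Ici 0) y := by
  rcases lt_or_ge y 1 with h | h
  · by_cases ht : t ∈ Icc 0 T
    · have hp : (t, y) ∈ rect T := ⟨ht, ⟨hy, h.le⟩⟩
      refine (hasDerivWithinAt_Dx u hp).mono_of_mem_nhdsWithin ?_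
      filter_upwards [self_mem_nhdsWithin, mem_nhdsWithin_of_mem_nhds (Iio_mem_nhds h)] with y h1 h2
      exact ⟨h1, le_of_lt h2⟩
    · have h0 : ∀ (v : Smooth T) (y : ℝ), (v : ℝ × ℝ → ℝ) (t, y) = 0 :=
        fun v s => v.2.2 _ fun hp => ht hp.1
      simp only [h0]
      exact hasDerivWithinAt_const _ _ _
  · have e : (Dx u : ℝ × ℝ → ℝ) (t, y) = 0 :=
      eq_zero_of_mem_vanishX (Dx_mem_vanishX hu) (p := (t, y)) (by simp only []; linarith)
    rw [e]
    refine ((hasDerivAt_const y (0 : ℝ)).congr_of_eventuallyEq ?_).hasDerivWithinAt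
    filter_upwards [Ioi_mem_nhds (show 5 / 6 < y by linarith)] with z hz
    exact eq_zero_of_mem_vanishX hu (p := (t, z)) (le_of_lt hz)

theorem continuous_unfold {u : Smooth T} (hX : u ∈ vanishX T) (hu : u ∈ vanishT T) :
    Continuous fun p : ℝ × ℝ => (u : ℝ × ℝ → ℝ) (max p.1 0, p.2 ^ 2) := by
  have hT' := hT.out
  have e : (fun p : ℝ × ℝ => (u : ℝ × ℝ → ℝ) (max p.1 0, p.2 ^ 2)) =
      fun p => (u : ℝ × ℝ → ℝ) (min (max p.1 0) T, min (p.2 ^ 2) 1) := by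
    funext p
    rcases le_total (max p.1 0) T with h1 | h1
    · rw [min_eq_left h1]
      rcases le_total (p.2 ^ 2) 1 with h2 | h2
      · rw [min_eq_left h2]
      · rw [min_eq_right h2, eq_zero_of_mem_vanishX hX, eq_zero_of_mem_vanishX hX]
        · simp only []; norm_num
        · simp only []; linarith
    · rw [min_eq_right h1, eq_zero_of_mem_vanishT hu, eq_zero_of_mem_vanishT hu]
      · simp only []; linarith
      · simp only []; linarith
  rw [e]
  refine u.2.1.continuousOn.comp_continuous (by fun_prop) fun p => ?_
  exact ⟨⟨le_min (le_max_right _ _) hT'.le, min_le_right _ _⟩,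
    ⟨le_min (sq_nonneg _) zero_le_one, min_le_right _ _⟩⟩

theorem abs_le_supN (u : Smooth T) (p : ℝ × ℝ) : |(u : ℝ × ℝ → ℝ) p| ≤ supN u := by
  by_cases hp : p ∈ rect T
  · exact abs_apply_le u hp
  · rw [u.2.2 p hp, abs_zero]; exact apply_nonneg _ _

/-! ### Multiplication by functions of `t` -/

theorem contDiff_deriv {φ : ℝ → ℝ} (hφ : ContDiff ℝ (⊤ : ℕ∞) φ) : ContDiff ℝ (⊤ : ℕ∞) (deriv φ) :=
  (contDiff_infty_iff_deriv.1 hφ).2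

theorem Dt_mulT {φ : ℝ → ℝ} (hφ : ContDiff ℝ (⊤ : ℕ∞) φ) (u : Smooth T) :
    Dt (mulT φ hφ u) = mulT (deriv φ) (contDiff_deriv hφ) u + mulT φ hφ (Dt u) := by
  refine Smooth.ext fun p hp => ?_
  refine (Dt_eq_of_hasDerivWithinAt (u := mulT φ hφ u) hp
    (((hφ.differentiable (by simp) p.1).hasDerivAt.hasDerivWithinAt).mul
      (hasDerivWithinAt_Dt u hp))).trans ?_
  simp [mulT_apply]

theorem Dx_mulT {φ : ℝ → ℝ} (hφ : ContDiff ℝ (⊤ : ℕ∞) φ) (u : Smooth T) :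
    Dx (mulT φ hφ u) = mulT φ hφ (Dx u) := by
  refine Smooth.ext fun p hp => ?_
  exact Dx_eq_of_hasDerivWithinAt hp ((hasDerivWithinAt_Dx u hp).const_mul (φ p.1))

theorem Lap_pow_mulT (a : ℝ) (k : ℕ) {φ : ℝ → ℝ} (hφ : ContDiff ℝ (⊤ : ℕ∞) φ) (u : Smooth T) :
    (Lap a ^ k) (mulT φ hφ u) = mulT φ hφ ((Lap a ^ k) u) := by
  induction k generalizing u with
  | zero => rfl
  | succ k ih =>
    have h : Lap a (mulT φ hφ u) = mulT φ hφ (Lap a u) := by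
      refine Smooth.ext fun p hp => ?_
      rw [Lap_apply, mulT_apply, Lap_apply, Dx_mulT, Dx_mulT, mulT_apply, mulT_apply]
      ring
    rw [pow_succ, Module.End.mul_apply, Module.End.mul_apply, h, ih]

theorem exists_supN_mulT_le {φ : ℝ → ℝ} (hφ : ContDiff ℝ (⊤ : ℕ∞) φ) :
    ∃ C : ℝ, 0 ≤ C ∧ ∀ u : Smooth T, supN (mulT φ hφ u) ≤ C * supN u := by
  obtain ⟨C, hC⟩ := (isCompact_Icc (a := 0) (b := T)).exists_bound_of_continuousOn
    hφ.continuous.continuousOn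
  refine ⟨|C|, abs_nonneg _, fun u => supN_le fun p hp => ?_⟩
  rw [mulT_apply, abs_mul]
  exact mul_le_mul ((hC p.1 hp.1).trans (le_abs_self C)) (abs_apply_le u hp) (abs_nonneg _)
    (abs_nonneg _)

theorem exists_supN_Dt_pow_mulT_le (n : ℕ) {φ : ℝ → ℝ} (hφ : ContDiff ℝ (⊤ : ℕ∞) φ) :
    ∃ C : ℝ, 0 ≤ C ∧ ∀ u : Smooth T,
      supN ((Dt ^ n) (mulT φ hφ u)) ≤ C * ∑ i ∈ Finset.range (n + 1), supN ((Dt ^ i) u) := by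
  induction n generalizing φ with
  | zero =>
    obtain ⟨C, hC, h⟩ := exists_supN_mulT_le (T := T) hφ
    exact ⟨C, hC, fun u => by simpa using h u⟩
  | succ n ih =>
    obtain ⟨C, hC, h⟩ := ih hφ
    obtain ⟨C', hC', h'⟩ := ih (contDiff_deriv hφ)
    refine ⟨C' + C, by positivity, fun u => ?_⟩
    rw [pow_succ, Module.End.mul_apply, Dt_mulT, map_add, add_mul]
    refine (map_add_le_add supN _ _).trans (add_le_add ((h' u).trans ?_) ((h (Dt u)).trans ?_))
    · refine mul_le_mul_of_nonneg_left ?_ hC'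
      rw [Finset.sum_range_succ _ (n + 1)]
      exact le_add_of_nonneg_right (apply_nonneg _ _)
    · refine mul_le_mul_of_nonneg_left ?_ hC
      rw [Finset.sum_range_succ' _ (n + 1)]
      refine le_add_of_le_of_nonneg (le_of_eq (Finset.sum_congr rfl fun i _ => ?_)) (apply_nonneg _ _)
      rw [pow_succ, Module.End.mul_apply]

/-! ### Slices in the variable `r = √x` -/

theorem hasDerivAt_slice {u : Smooth T} (hu : u ∈ vanishX T) (t y : ℝ) :
    HasDerivAt (fun y => (u : ℝ × ℝ → ℝ) (t, y ^ 2)) (2 * y * (Dx u : ℝ × ℝ → ℝ) (t, y ^ 2)) y := by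
  have h1 : HasDerivWithinAt (fun y : ℝ => y ^ 2) (2 * y) univ y := by
    exact (hasDerivAt_pow 2 y).hasDerivWithinAt.congr_deriv (by norm_num)
  have h2 := HasDerivWithinAt.comp (h := fun y : ℝ => y ^ 2) y
    (hasDerivWithinAt_Ici_Dx hu t (sq_nonneg y)) h1 fun z _ => sq_nonneg z
  rw [hasDerivWithinAt_univ] at h2
  exact h2.congr_deriv (by ring)

theorem hasDerivAt_slice_deriv {u : Smooth T} (hu : u ∈ vanishX T) (t y : ℝ) :
    HasDerivAt (fun y => 2 * y * (Dx u : ℝ × ℝ → ℝ) (t, y ^ 2))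
      (4 * (Lap (1 / 2) u : ℝ × ℝ → ℝ) (t, y ^ 2)) y := by
  have h1 := ((hasDerivAt_id y).const_mul 2).mul (hasDerivAt_slice (Dx_mem_vanishX hu) t y)
  refine h1.congr_deriv ?_
  rw [Lap_apply]
  simp only [id]
  ring

theorem iteratedDeriv_slice_even {u : Smooth T} (hu : u ∈ vanishX T) (t : ℝ) (k : ℕ) :
    iteratedDeriv (2 * k) (fun y => (u : ℝ × ℝ → ℝ) (t, y ^ 2)) =
      fun y => 4 ^ k * ((Lap (1 / 2) ^ k) u : ℝ × ℝ → ℝ) (t, y ^ 2) := by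
  induction k with
  | zero => simp
  | succ k ih =>
    have hk := Lap_pow_mem_vanishX (1 / 2) k hu
    have d1 : deriv (fun y => 4 ^ k * ((Lap (1 / 2) ^ k) u : ℝ × ℝ → ℝ) (t, y ^ 2)) = fun y =>
        4 ^ k * (2 * y * (Dx ((Lap (1 / 2) ^ k) u) : ℝ × ℝ → ℝ) (t, y ^ 2)) :=
      funext fun y => ((hasDerivAt_slice hk t y).const_mul _).deriv
    rw [mul_add, mul_one, iteratedDeriv_succ, iteratedDeriv_succ, ih, d1]
    funext y
    rw [((hasDerivAt_slice_deriv hk t y).const_mul _).deriv, pow_succ' (Lap (1 / 2)), Module.End.mul_apply]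
    ring

theorem iteratedDeriv_slice_odd {u : Smooth T} (hu : u ∈ vanishX T) (t : ℝ) (k : ℕ) :
    iteratedDeriv (2 * k + 1) (fun y => (u : ℝ × ℝ → ℝ) (t, y ^ 2)) =
      fun y => 4 ^ k * (2 * y * (Dx ((Lap (1 / 2) ^ k) u) : ℝ × ℝ → ℝ) (t, y ^ 2)) := by
  rw [iteratedDeriv_succ, iteratedDeriv_slice_even hu]
  funext y
  exact ((hasDerivAt_slice (Lap_pow_mem_vanishX (1 / 2) k hu) t y).const_mul _).deriv

theorem contDiff_slice {u : Smooth T} (hu : u ∈ vanishX T) (t : ℝ) :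
    ContDiff ℝ (⊤ : ℕ∞) (fun y => (u : ℝ × ℝ → ℝ) (t, y ^ 2)) := by
  refine contDiff_of_differentiable_iteratedDeriv fun m _ => ?_
  obtain ⟨k, rfl | rfl⟩ := Nat.even_or_odd' m
  · rw [iteratedDeriv_slice_even hu]
    exact fun y => ((hasDerivAt_slice (Lap_pow_mem_vanishX _ k hu) t y).const_mul _).differentiableAt
  · rw [iteratedDeriv_slice_odd hu]
    exact fun y =>
      ((hasDerivAt_slice_deriv (Lap_pow_mem_vanishX _ k hu) t y).const_mul _).differentiableAt

theorem exists_iteratedDeriv_slice_le {j n : ℕ} (h : j ≤ 2 * n) : ∃ C : ℝ, 0 ≤ C ∧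
    ∀ u ∈ vanishX T, ∀ t y : ℝ, |iteratedDeriv j (fun y => (u : ℝ × ℝ → ℝ) (t, y ^ 2)) y| ≤
      C * ∑ k ∈ Finset.range (n + 1), supN ((Lap (1 / 2) ^ k) u) := by
  have hle : ∀ {k : ℕ} (u : Smooth T), k ≤ n →
      supN ((Lap (1 / 2) ^ k) u) ≤ ∑ k ∈ Finset.range (n + 1), supN ((Lap (1 / 2) ^ k) u) :=
    fun {k} u hk => Finset.single_le_sum (f := fun k => supN ((Lap (1 / 2) ^ k) u))
      (fun _ _ => apply_nonneg _ _) (Finset.mem_range.2 (by omega))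
  obtain ⟨k, rfl | rfl⟩ := Nat.even_or_odd' j
  · refine ⟨4 ^ k, by positivity, fun u hu t y => ?_⟩
    rw [iteratedDeriv_slice_even hu]
    simp only [abs_mul, abs_pow, abs_of_pos (zero_lt_four (α := ℝ))]
    exact mul_le_mul_of_nonneg_left ((abs_le_supN _ _).trans (hle u (by omega))) (by positivity)
  · refine ⟨4 ^ k * (2 * (1 / 2 : ℝ)⁻¹), by positivity, fun u hu t y => ?_⟩
    rw [iteratedDeriv_slice_odd hu]
    simp only [abs_mul, abs_pow, abs_of_pos (zero_lt_four (α := ℝ)), abs_two, mul_assoc]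
    refine mul_le_mul_of_nonneg_left (mul_le_mul_of_nonneg_left ?_ zero_le_two) (by positivity)
    have h1 : |y| * |(Dx ((Lap (1 / 2) ^ k) u) : ℝ × ℝ → ℝ) (t, y ^ 2)| ≤
        supN (Dx ((Lap (1 / 2) ^ k) u)) := by
      rcases le_or_gt |y| 1 with hy | hy
      · exact (mul_le_of_le_one_left (abs_nonneg _) hy).trans (abs_le_supN _ _)
      · have hy2 : 1 < y ^ 2 := by rw [← sq_abs]; nlinarith
        rw [eq_zero_of_mem_vanishX (Dx_mem_vanishX (Lap_pow_mem_vanishX _ k hu))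
          (p := (t, y ^ 2)) (by simp only []; linarith), abs_zero, mul_zero]
        exact apply_nonneg _ _
    refine h1.trans ((supN_Dx_le (by norm_num) _).trans (mul_le_mul_of_nonneg_left ?_ (by norm_num)))
    rw [← Module.End.mul_apply, ← pow_succ']
    exact hle u (by omega)

/-- The derivatives of even order of `y ↦ θ(y) u(t, y²)`, for a smooth function `θ`. -/
theorem exists_iteratedDeriv_mul_slice_le {θ : ℝ → ℝ} (hθ : ContDiff ℝ (⊤ : ℕ∞) θ) (n : ℕ) :
    ∃ C : ℝ, 0 ≤ C ∧ ∀ u ∈ vanishX T, ∀ t y : ℝ,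
      |iteratedDeriv (2 * n) (fun y => θ y * (u : ℝ × ℝ → ℝ) (t, y ^ 2)) y| ≤
        C * ∑ k ∈ Finset.range (n + 1), supN ((Lap (1 / 2) ^ k) u) := by
  choose! C hC h using fun j (hj : j ≤ 2 * n) => exists_iteratedDeriv_slice_le (T := T) hj
  have hθb : ∀ i : ℕ, ∃ D : ℝ, 0 ≤ D ∧ ∀ y ∈ Icc (-1 : ℝ) 1, |iteratedDeriv i θ y| ≤ D := by
    intro i
    obtain ⟨D, hD⟩ := (isCompact_Icc (a := (-1 : ℝ)) (b := 1)).exists_bound_of_continuousOn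
      (hθ.continuous_iteratedDeriv i (by exact_mod_cast le_top)).continuousOn
    exact ⟨|D|, abs_nonneg _, fun y hy => (hD y hy).trans (le_abs_self D)⟩
  choose D hD hDb using hθb
  have hC' : ∀ i, 0 ≤ C (2 * n - i) := fun i => hC _ (Nat.sub_le _ _)
  refine ⟨∑ i ∈ Finset.range (2 * n + 1), ((2 * n).choose i : ℝ) * D i * C (2 * n - i),
    Finset.sum_nonneg fun i _ => mul_nonneg (mul_nonneg (by positivity) (hD i)) (hC' i),
    fun u hu t y => ?_⟩
  have hS : 0 ≤ ∑ k ∈ Finset.range (n + 1), supN ((Lap (1 / 2) ^ k) u) :=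
    Finset.sum_nonneg fun _ _ => apply_nonneg _ _
  have hmul := norm_iteratedFDeriv_mul_le hθ (contDiff_slice hu t) y (n := 2 * n)
    (WithTop.coe_le_coe.2 (le_top : ((2 * n : ℕ) : ℕ∞) ≤ ⊤))
  simp only [norm_iteratedFDeriv_eq_norm_iteratedDeriv, Real.norm_eq_abs] at hmul
  refine hmul.trans ?_
  rw [Finset.sum_mul]
  refine Finset.sum_le_sum fun i _ => ?_
  rw [mul_assoc, mul_assoc, mul_assoc]
  refine mul_le_mul_of_nonneg_left ?_ (by positivity)
  rcases le_or_gt |y| 1 with hy | hy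
  · exact mul_le_mul (hDb i y (abs_le.1 hy)) (h _ (Nat.sub_le _ _) u hu t y) (abs_nonneg _) (hD i)
  · -- Near such a point `u(t, y²)` vanishes.
    have h0 : (fun y => (u : ℝ × ℝ → ℝ) (t, y ^ 2)) =ᶠ[𝓝 y] fun _ => 0 := by
      filter_upwards [(continuous_abs.tendsto y).eventually (Ioi_mem_nhds hy)] with z hz
      have hz2 : 1 < z ^ 2 := by rw [← sq_abs]; nlinarith [show 1 < |z| from hz]
      exact eq_zero_of_mem_vanishX hu (p := (t, z ^ 2)) (by simp only []; linarith)
    have e : iteratedDeriv (2 * n - i) (fun y => (u : ℝ × ℝ → ℝ) (t, y ^ 2)) y = 0 := by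
      rw [h0.iteratedDeriv_eq]
      simp
    rw [e, abs_zero, mul_zero]
    exact mul_nonneg (hD i) (mul_nonneg (hC' i) hS)

end Cutoff

/-! ### Approximation by mollification -/

/-- A Schwartz function supported in `[0, ∞)` with integral `1` and vanishing higher moments. -/
def kern : 𝓢(ℝ, ℝ) := exists_kernel.choose

theorem kern_of_nonpos : ∀ y ≤ 0, kern y = 0 := exists_kernel.choose_spec.1

theorem integral_kern : ∫ y, kern y = 1 := exists_kernel.choose_spec.2.1

theorem moment_kern : ∀ n : ℕ, ∫ y, y ^ (n + 1) * kern y = 0 := exists_kernel.choose_spec.2.2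

theorem pos_of_kern_ne_zero {v : ℝ × ℝ} (h : kern v.1 * kern v.2 ≠ 0) : 0 < v.1 ∧ 0 < v.2 := by
  constructor
  · by_contra hv
    exact h (by rw [kern_of_nonpos _ (not_lt.1 hv), zero_mul])
  · by_contra hv
    exact h (by rw [kern_of_nonpos _ (not_lt.1 hv), mul_zero])

theorem integrable_bcf_mul_schwartz (K : 𝓢(ℝ, ℝ)) (f : ℝ × ℝ →ᵇ ℝ) {a : ℝ → ℝ × ℝ}
    (ha : Continuous a) : Integrable fun y => f (a y) * K y := by
  refine ((K.integrable (μ := volume)).norm.const_mul ‖f‖).mono'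
    (((f.continuous.comp ha).mul K.continuous).aestronglyMeasurable)
    (Eventually.of_forall fun v => ?_)
  rw [norm_mul]
  exact mul_le_mul_of_nonneg_right (f.norm_coe_le_norm _) (norm_nonneg _)

theorem moll_eq_iterated (K : 𝓢(ℝ, ℝ)) (δ : ℝ) (f : ℝ × ℝ →ᵇ ℝ) (t r : ℝ) :
    moll K K δ f (t, r) = ∫ z, (∫ y, f (t + δ * y, r + δ * z) * K y) * K z := by
  rw [moll, Measure.volume_eq_prod, integral_prod_symm _ (integrable_moll K K δ f (t, r))]
  refine integral_congr_ae (Eventually.of_forall fun z => ?_)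
  simp only []
  rw [← integral_mul_const]
  refine integral_congr_ae (Eventually.of_forall fun y => ?_)
  simp only []
  ring

/-- The approximation error in the plane is controlled by the errors on the lines parallel to the
coordinate axes. -/
theorem abs_moll_sub_le {K : 𝓢(ℝ, ℝ)} {δ : ℝ} {f : ℝ × ℝ →ᵇ ℝ} {t r E₁ E₂ : ℝ}
    (h₁ : ∀ r, |(∫ y, f (t + δ * y, r) * K y) - f (t, r)| ≤ E₁)
    (h₂ : |(∫ z, f (t, r + δ * z) * K z) - f (t, r)| ≤ E₂) :
    |moll K K δ f (t, r) - f (t, r)| ≤ E₁ * (∫ z, |K z|) + E₂ := by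
  have hi₁ : Integrable fun z => (∫ y, f (t + δ * y, r + δ * z) * K y) * K z := by
    refine (integrable_moll K K δ f (t, r)).integral_prod_right.congr
      (Eventually.of_forall fun z => ?_)
    simp only []
    rw [← integral_mul_const]
    refine integral_congr_ae (Eventually.of_forall fun y => ?_)
    simp only []
    ring
  have hi₂ : Integrable fun z => f (t, r + δ * z) * K z :=
    integrable_bcf_mul_schwartz K f (by fun_prop)
  have e : moll K K δ f (t, r) - f (t, r) =
      (∫ z, ((∫ y, f (t + δ * y, r + δ * z) * K y) - f (t, r + δ * z)) * K z) +
        ((∫ z, f (t, r + δ * z) * K z) - f (t, r)) := by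
    simp only [sub_mul]
    rw [integral_sub hi₁ hi₂, moll_eq_iterated]
    ring
  rw [e]
  refine (abs_add_le _ _).trans (add_le_add ?_ h₂)
  rw [← integral_const_mul]
  refine abs_integral_le_integral_abs.trans (integral_mono ?_
    ((K.integrable (μ := volume)).abs.const_mul E₁) fun z => ?_)
  · simp only [sub_mul]
    exact (hi₁.sub hi₂).abs
  · simp only []
    rw [abs_mul]
    exact mul_le_mul_of_nonneg_right (h₁ _) (abs_nonneg _)

section Unfold

variable {T : ℝ}

/-- A smooth function of `t` which is `1` for `t ≤ T / 3` and `0` for `t ≥ 2 T / 3`. -/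
def cutT (T : ℝ) (t : ℝ) : ℝ := Real.smoothTransition (2 - 3 * t / T)

theorem contDiff_cutT (T : ℝ) : ContDiff ℝ (⊤ : ℕ∞) (cutT T) :=
  Real.smoothTransition.contDiff.comp (by fun_prop)

/-- A smooth function `θ` with `θ(r) + θ(-r) = 1` which vanishes for `r ≤ -1/2`. -/
def evenCut (r : ℝ) : ℝ := Real.smoothTransition (r + 1 / 2)

theorem contDiff_evenCut : ContDiff ℝ (⊤ : ℕ∞) evenCut :=
  Real.smoothTransition.contDiff.comp (by fun_prop)

theorem abs_evenCut_le (r : ℝ) : |evenCut r| ≤ 1 := by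
  rw [evenCut, abs_of_nonneg (Real.smoothTransition.nonneg _)]
  exact Real.smoothTransition.le_one _

theorem smoothTransition_add (x : ℝ) :
    Real.smoothTransition x + Real.smoothTransition (1 - x) = 1 := by
  have h := Real.smoothTransition.pos_denom x
  rw [Real.smoothTransition, Real.smoothTransition, sub_sub_cancel, add_comm (expNegInvGlue (1 - x)),
    ← add_div, div_self h.ne']

theorem evenCut_add (r : ℝ) : evenCut r + evenCut (-r) = 1 := by
  rw [evenCut, evenCut, show -r + 1 / 2 = 1 - (r + 1 / 2) by ring, smoothTransition_add]

/-- Multiplication by the cut-off function in `t`. -/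
def mulCut : Module.End ℝ (Smooth T) := mulT (cutT T) (contDiff_cutT T)

theorem mulCut_mem_vanishX {u : Smooth T} (hu : u ∈ vanishX T) : mulCut u ∈ vanishX T :=
  mulT_mem_vanishX _ hu

variable [hT : Fact (0 < T)]

theorem cutT_add (t : ℝ) : cutT T t + cutT T (T - t) = 1 := by
  have e : 2 - 3 * (T - t) / T = 1 - (2 - 3 * t / T) := by
    have := hT.out.ne'
    field_simp
    ring
  rw [cutT, cutT, e, smoothTransition_add]

theorem mulCut_mem_vanishT (u : Smooth T) : mulCut u ∈ vanishT T := fun p _ h => by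
  rw [mulCut, mulT_apply, cutT, Real.smoothTransition.zero_of_nonpos, zero_mul]
  have : 2 ≤ 3 * p.1 / T := by rw [le_div_iff₀ hT.out]; linarith
  linarith

/-- The function `(t, r) ↦ θ(r) (φ u)(max t 0, r²)` on the plane, where `φ` cuts off in `t`.
It is smooth for `t ≥ 0`. -/
def unfold : vanishX T →ₗ[ℝ] (ℝ × ℝ →ᵇ ℝ) where
  toFun u := BoundedContinuousFunction.ofNormedAddCommGroup
    (fun p => evenCut p.2 * (mulCut u.1 : ℝ × ℝ → ℝ) (max p.1 0, p.2 ^ 2))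
    ((contDiff_evenCut.continuous.comp continuous_snd).mul
      (continuous_unfold (mulCut_mem_vanishX u.2) (mulCut_mem_vanishT u.1)))
    (supN (mulCut u.1)) fun p => by
      rw [Real.norm_eq_abs, abs_mul]
      exact (mul_le_of_le_one_left (abs_nonneg _) (abs_evenCut_le _)).trans (abs_le_supN _ _)
  map_add' u v := by
    ext p
    change evenCut p.2 * (mulCut (u.1 + v.1) : ℝ × ℝ → ℝ) _ = evenCut p.2 * _ + evenCut p.2 * _
    rw [map_add, ← mul_add]
    rfl
  map_smul' c u := by
    ext p
    change evenCut p.2 * (mulCut (c • u.1) : ℝ × ℝ → ℝ) _ = c * (evenCut p.2 * _)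
    rw [map_smul, mul_left_comm]
    rfl

theorem unfold_apply (u : vanishX T) (p : ℝ × ℝ) :
    unfold u p = evenCut p.2 * (mulCut u.1 : ℝ × ℝ → ℝ) (max p.1 0, p.2 ^ 2) := rfl

theorem unfold_eq_zero (u : vanishX T) {p : ℝ × ℝ} (hp : √(5 / 6) ≤ p.2) : unfold u p = 0 := by
  have h : 5 / 6 ≤ p.2 ^ 2 := by
    rw [← Real.sq_sqrt (show (0 : ℝ) ≤ 5 / 6 by norm_num)]
    exact pow_le_pow_left₀ (Real.sqrt_nonneg _) hp 2
  rw [unfold_apply, eq_zero_of_mem_vanishX (mulCut_mem_vanishX u.2) (p := (max p.1 0, p.2 ^ 2)) h,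
    mul_zero]

theorem abs_unfold_le (u : vanishX T) (p : ℝ × ℝ) : |unfold u p| ≤ supN (mulCut u.1) := by
  rw [unfold_apply, abs_mul]
  exact (mul_le_of_le_one_left (abs_nonneg _) (abs_evenCut_le _)).trans (abs_le_supN _ _)

/-- Mollification approximates `unfold u` to every order in the scale `δ`. -/
theorem exists_abs_moll_unfold_sub_le (n : ℕ) : ∃ C : ℝ, 0 ≤ C ∧ ∀ (u : vanishX T) (δ : ℝ), 0 < δ →
    ∀ (t r : ℝ), 0 ≤ t → |mollOp kern δ (unfold u) (t, r) - unfold u (t, r)| ≤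
      C * δ ^ (2 * (n + 1)) * supG (1 / 2) (n + 2) u.1 := by
  obtain ⟨C₁, hC₁, h₁⟩ := exists_supN_Dt_pow_mulT_le (T := T) (2 * (n + 1)) (contDiff_cutT T)
  have hex : ∀ i : ℕ, ∃ C : ℝ, 0 ≤ C ∧ (i ≤ 2 * (n + 1) → ∀ u : Smooth T,
      supN ((Dt ^ i) u) ≤ C * supG (1 / 2) (n + 2) u) := by
    intro i
    by_cases hi : i ≤ 2 * (n + 1)
    · obtain ⟨C, hC, h⟩ := exists_supN_Dt_pow_Lap_le (T := T) (1 / 2) (m := i) (k := 0) (n := n + 2)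
        (by omega)
      exact ⟨C, hC, fun _ u => h u⟩
    · exact ⟨0, le_rfl, fun h => absurd h hi⟩
  choose D hD hDb using hex
  obtain ⟨C₂, hC₂, h₂⟩ := exists_iteratedDeriv_mul_slice_le (T := T) contDiff_evenCut (n + 1)
  obtain ⟨C₃, hC₃, h₃⟩ := exists_supN_mulT_le (T := T) (contDiff_cutT T)
  set N := 2 * (n + 1) with hN
  set A₁ := C₁ * ∑ i ∈ Finset.range (N + 1), D i with hA₁
  have hA₁0 : 0 ≤ A₁ := mul_nonneg hC₁ (Finset.sum_nonneg fun i _ => hD i)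
  set A₂ := C₂ * ((n + 2 : ℕ) * C₃) with hA₂
  have hA₂0 : 0 ≤ A₂ := by positivity
  set m₀ := ∫ z, |kern z| with hm₀
  set m := ∫ y, |y| ^ N * |kern y| with hm
  have hm₀0 : 0 ≤ m₀ := integral_nonneg fun _ => abs_nonneg _
  have hm0 : 0 ≤ m := integral_nonneg fun _ => by positivity
  refine ⟨A₁ * m * m₀ + A₂ * m, by positivity, fun u δ hδ t r ht => ?_⟩
  set P := supG (1 / 2) (n + 2) u.1 with hP
  have hP0 : 0 ≤ P := apply_nonneg _ _
  set v : Smooth T := mulCut u.1 with hv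
  have hvX : v ∈ vanishX T := mulCut_mem_vanishX u.2
  have hvT : v ∈ vanishT T := mulCut_mem_vanishT u.1
  have hM₁ : supN ((Dt ^ N) v) ≤ A₁ * P := by
    refine (h₁ u.1).trans ?_
    rw [hA₁, mul_assoc, Finset.sum_mul]
    refine mul_le_mul_of_nonneg_left (Finset.sum_le_sum fun i hi => ?_) hC₁
    exact hDb i (by rw [Finset.mem_range] at hi; omega) u.1
  have hM₂ : C₂ * ∑ k ∈ Finset.range (n + 1 + 1), supN ((Lap (1 / 2) ^ k) v) ≤ A₂ * P := by
    rw [hA₂, mul_assoc, mul_assoc]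
    refine mul_le_mul_of_nonneg_left ?_ hC₂
    have hterm : ∀ k ∈ Finset.range (n + 1 + 1), supN ((Lap (1 / 2) ^ k) v) ≤ C₃ * P := by
      intro k hk
      rw [hv, mulCut, Lap_pow_mulT]
      refine (h₃ _).trans (mul_le_mul_of_nonneg_left ?_ hC₃)
      have := supN_Op_le_supG (1 / 2) (n := n + 2) (j := 0) (k := k)
        (by rw [Finset.mem_range] at hk; omega) u.1
      rwa [Op, mul_zero, pow_zero, one_mul] at this
    refine (Finset.sum_le_card_nsmul _ _ _ hterm).trans (le_of_eq ?_)
    rw [Finset.card_range, nsmul_eq_mul]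
  have hJ : ∀ t r, 0 ≤ t → unfold u (t, r) = evenCut r * (v : ℝ × ℝ → ℝ) (t, r ^ 2) := by
    intro t r ht
    rw [unfold_apply, max_eq_left ht]
  -- The error in the variable `t`.
  have hE₁ : ∀ r, |(∫ y, unfold u (t + δ * y, r) * kern y) - unfold u (t, r)| ≤
      A₁ * P * δ ^ N * m := by
    intro r
    set h : ℕ → ℝ → ℝ := fun i s => evenCut r * ((Dt ^ i) v : ℝ × ℝ → ℝ) (s, r ^ 2) with hh
    -- The kernel only sees the points with `t + δ y ≥ 0`.
    have e : ∀ y, unfold u (t + δ * y, r) * kern y = h 0 (t + δ * y) * kern y := by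
      intro y
      rcases le_or_gt y 0 with hy | hy
      · rw [kern_of_nonpos y hy, mul_zero, mul_zero]
      · rw [hJ _ _ (by positivity)]
        rfl
    have hint : Integrable fun y => h 0 (t + δ * y) * kern y := by
      simp only [← e]
      exact integrable_bcf_mul_schwartz kern (unfold u) (by fun_prop)
    simp only [e]
    rw [hJ t r ht]
    refine abs_average_sub_le (h := h) kern_of_nonpos integral_kern moment_kern (by omega : 0 < N)
      (by positivity) (fun i _ s hs => ?_) (fun s _ => ?_) hδ hint
    · have := hasDerivWithinAt_Ici_Dt (Dt_pow_mem_vanishT i hvT) (ht.trans hs) (r ^ 2)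
      rw [← Module.End.mul_apply Dt (Dt ^ i), ← pow_succ'] at this
      exact (this.const_mul _).mono (Ici_subset_Ici.2 ht)
    · refine (abs_mul _ _).trans_le ?_
      exact ((mul_le_of_le_one_left (abs_nonneg _) (abs_evenCut_le _)).trans
        (abs_le_supN _ _)).trans hM₁
  -- The error in the variable `r`, where `r ↦ u(t, r²)` is smooth on the whole line.
  have hE₂ : |(∫ z, unfold u (t, r + δ * z) * kern z) - unfold u (t, r)| ≤ A₂ * P * δ ^ N * m := by
    set h : ℕ → ℝ → ℝ :=
      fun i => iteratedDeriv i fun y => evenCut y * (v : ℝ × ℝ → ℝ) (t, y ^ 2) with hh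
    have hcd : ContDiff ℝ (⊤ : ℕ∞) fun y => evenCut y * (v : ℝ × ℝ → ℝ) (t, y ^ 2) :=
      contDiff_evenCut.mul (contDiff_slice hvX t)
    have h0 : ∀ y, unfold u (t, y) = h 0 y := fun y => by
      rw [hJ t y ht, hh]; simp only [iteratedDeriv_zero]
    have hint : Integrable fun z => h 0 (r + δ * z) * kern z := by
      simp only [← h0]
      exact integrable_bcf_mul_schwartz kern (unfold u) (by fun_prop)
    simp only [h0]
    refine abs_average_sub_le (h := h) kern_of_nonpos integral_kern moment_kern (by omega : 0 < N)
      (by positivity) (fun i _ s _ => ?_) (fun s _ => (h₂ v hvX t s).trans hM₂) hδ hint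
    have hdiff := hcd.differentiable_iteratedDeriv i (WithTop.coe_lt_coe.2 (ENat.natCast_lt_top i))
    rw [hh]
    simp only [iteratedDeriv_succ]
    exact (hdiff s).hasDerivAt.hasDerivWithinAt
  refine (abs_moll_sub_le hE₁ hE₂).trans (le_of_eq ?_)
  ring

/-- The mollification at the scale `exp (-k / 2)` for the index `k + 1`, and zero for the index
`0`. -/
def smoothing : ℕ → (ℝ × ℝ →ᵇ ℝ) →ₗ[ℝ] (ℝ × ℝ →ᵇ ℝ)
  | 0 => 0
  | k + 1 => mollOp kern (Real.exp (-(k / 2)))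

theorem smoothing_comm (i j : ℕ) (f : ℝ × ℝ →ᵇ ℝ) :
    smoothing i (smoothing j f) = smoothing j (smoothing i f) := by
  cases i <;> cases j <;> simp [smoothing, mollOp_comm kern]

theorem exists_abs_smoothing_sub_le (n : ℕ) : ∃ C : ℝ, 0 ≤ C ∧ ∀ (k : ℕ) (u : vanishX T) (t r : ℝ),
    0 ≤ t → |smoothing k (unfold u) (t, r) - unfold u (t, r)| ≤
      C * Real.exp (-(n * k)) * supG (1 / 2) (n + 2) u.1 := by
  obtain ⟨C₁, hC₁, h₁⟩ := exists_supN_mulT_le (T := T) (contDiff_cutT T)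
  obtain ⟨C₂, hC₂, h₂⟩ := exists_abs_moll_unfold_sub_le (T := T) n
  refine ⟨C₁ + C₂ * Real.exp n, by positivity, fun k u t r ht => ?_⟩
  have hP0 : 0 ≤ supG (1 / 2) (n + 2) u.1 := apply_nonneg _ _
  rw [add_mul, add_mul]
  rcases k with _ | k
  · have e : |unfold u (t, r)| ≤ C₁ * supG (1 / 2) (n + 2) u.1 := by
      refine ((abs_unfold_le u _).trans (h₁ u.1)).trans (mul_le_mul_of_nonneg_left ?_ hC₁)
      rw [← supG_zero (1 / 2)]
      exact supG_mono _ (by omega) _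
    have e2 : smoothing 0 (unfold u) (t, r) = 0 := rfl
    rw [e2, zero_sub, abs_neg, Nat.cast_zero, mul_zero, neg_zero, Real.exp_zero, mul_one, mul_one]
    exact e.trans (le_add_of_nonneg_right (by positivity))
  · refine (h₂ u _ (Real.exp_pos _) t r ht).trans (le_trans ?_ (le_add_of_nonneg_left (by positivity)))
    refine mul_le_mul_of_nonneg_right ?_ hP0
    rw [mul_assoc]
    refine mul_le_mul_of_nonneg_left ?_ hC₂
    rw [← Real.exp_nat_mul, ← Real.exp_add, Real.exp_le_exp]
    push_cast
    nlinarith [(Nat.cast_nonneg k : (0 : ℝ) ≤ k)]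

end Unfold

/-! ### Locality of the smoothing operators -/

theorem smoothing_eq_zero {f : ℝ × ℝ →ᵇ ℝ} {c : ℝ} (hf : ∀ q : ℝ × ℝ, c ≤ q.2 → f q = 0) (k : ℕ)
    {p : ℝ × ℝ} (hp : c ≤ p.2) : smoothing k f p = 0 := by
  rcases k with _ | k
  · rfl
  · have h := abs_moll_le_of_bound kern kern (Real.exp (-(k / 2))) f p (C := 0) fun v hv => by
      have := (pos_of_kern_ne_zero hv).2
      rw [hf _ (by simp only []; nlinarith [Real.exp_pos (-(k / 2 : ℝ))]), abs_zero]
    rw [zero_mul] at h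
    exact abs_nonpos_iff.1 h

theorem abs_smoothing_le {f : ℝ × ℝ →ᵇ ℝ} {C : ℝ} (hC : 0 ≤ C)
    (hf : ∀ q : ℝ × ℝ, 0 ≤ q.1 → |f q| ≤ C) (k : ℕ) {p : ℝ × ℝ} (hp : 0 ≤ p.1) :
    |smoothing k f p| ≤ C * kernelMass kern kern := by
  rcases k with _ | k
  · change |(0 : ℝ)| ≤ _
    rw [abs_zero]
    exact mul_nonneg hC (kernelMass_nonneg _ _)
  · refine abs_moll_le_of_bound kern kern (Real.exp (-(k / 2))) f p fun v hv => hf _ ?_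
    have := (pos_of_kern_ne_zero hv).1
    simp only []
    positivity

theorem smoothing_congr {f g : ℝ × ℝ →ᵇ ℝ} (h : ∀ q : ℝ × ℝ, 0 ≤ q.1 → f q = g q) (k : ℕ)
    {p : ℝ × ℝ} (hp : 0 ≤ p.1) : smoothing k f p = smoothing k g p := by
  have h1 := abs_smoothing_le (f := f - g) le_rfl (fun q hq => by simp [h q hq]) k hp
  rw [zero_mul, map_sub] at h1
  exact sub_eq_zero.1 (abs_nonpos_iff.1 h1)

/-- The operator `f(t, r) ↦ f(max t 0, r) - f(max t 0, max r ρ)` with `ρ = √(5/6)`; its values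
vanish for `r ≥ ρ`. -/
def clip : (ℝ × ℝ →ᵇ ℝ) →ₗ[ℝ] (ℝ × ℝ →ᵇ ℝ) where
  toFun f := f.compContinuous ⟨fun p => (max p.1 0, p.2), by fun_prop⟩ -
    f.compContinuous ⟨fun p => (max p.1 0, max p.2 √(5 / 6)), by fun_prop⟩
  map_add' f g := by ext p; simp; ring
  map_smul' c f := by ext p; simp; ring

theorem clip_apply (f : ℝ × ℝ →ᵇ ℝ) (p : ℝ × ℝ) :
    clip f p = f (max p.1 0, p.2) - f (max p.1 0, max p.2 √(5 / 6)) := rfl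

theorem clip_eq_zero (f : ℝ × ℝ →ᵇ ℝ) (p : ℝ × ℝ) (hp : √(5 / 6) ≤ p.2) : clip f p = 0 := by
  rw [clip_apply, max_eq_left hp, sub_self]

theorem clip_eq_self {f : ℝ × ℝ →ᵇ ℝ} (hf : ∀ q : ℝ × ℝ, √(5 / 6) ≤ q.2 → f q = 0) {p : ℝ × ℝ}
    (hp : 0 ≤ p.1) : clip f p = f p := by
  rw [clip_apply, max_eq_left hp, hf (p.1, max p.2 √(5 / 6)) (le_max_right _ _), sub_zero]

theorem norm_clip_le {f : ℝ × ℝ →ᵇ ℝ} {C : ℝ} (hC : 0 ≤ C) (hf : ∀ q : ℝ × ℝ, 0 ≤ q.1 → |f q| ≤ C) :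
    ‖clip f‖ ≤ 2 * C := by
  refine (BoundedContinuousFunction.norm_le (by positivity)).2 fun p => ?_
  rw [clip_apply, Real.norm_eq_abs]
  refine (abs_sub _ _).trans ?_
  have h1 := hf (max p.1 0, p.2) (le_max_right _ _)
  have h2 := hf (max p.1 0, max p.2 √(5 / 6)) (le_max_right _ _)
  linarith

/-! ### From functions on the plane to smooth functions on the rectangle -/

/-- The even part, up to the factor `1/2`, of `η` times a mollification of `f`, that is
`g(t, r) + g(t, -r)` with `g(t, r) = η(r) (K ∗ f)(t, r)`. -/
def evenMoll {η : ℝ → ℝ} (hη : ContDiff ℝ (⊤ : ℕ∞) η) (K₁ K₂ : 𝓢(ℝ, ℝ)) {δ : ℝ} (hδ : 0 < δ)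
    (f : ℝ × ℝ →ᵇ ℝ) : EvenSmooth :=
  ⟨fun p => η p.2 * moll K₁ K₂ δ f p + η (-p.2) * moll K₁ K₂ δ f (p.1, -p.2), by
    have hm := contDiff_moll K₁ K₂ hδ f
    refine ContDiff.add ((hη.comp contDiff_snd).mul hm) ((hη.comp contDiff_snd.neg).mul (hm.comp ?_))
    exact contDiff_fst.prodMk contDiff_snd.neg, fun t r => by
    simp only [neg_neg]
    ring⟩

theorem evenMoll_apply {η : ℝ → ℝ} (hη : ContDiff ℝ (⊤ : ℕ∞) η) (K₁ K₂ : 𝓢(ℝ, ℝ)) {δ : ℝ}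
    (hδ : 0 < δ) (f : ℝ × ℝ →ᵇ ℝ) (p : ℝ × ℝ) : (evenMoll hη K₁ K₂ hδ f : ℝ × ℝ → ℝ) p =
      η p.2 * moll K₁ K₂ δ f p + η (-p.2) * moll K₁ K₂ δ f (p.1, -p.2) := rfl

theorem evenDt_evenMoll {η : ℝ → ℝ} (hη : ContDiff ℝ (⊤ : ℕ∞) η) (K₁ K₂ : 𝓢(ℝ, ℝ)) {δ : ℝ}
    (hδ : 0 < δ) (f : ℝ × ℝ →ᵇ ℝ) :
    evenDt (evenMoll hη K₁ K₂ hδ f) = (-δ⁻¹) • evenMoll hη (schwartzDeriv K₁) K₂ hδ f := by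
  refine Subtype.ext (funext fun p => ?_)
  refine (hasDerivAt_pd₁ (evenMoll hη K₁ K₂ hδ f).2.1 p.1 p.2).unique ?_
  refine (((hasDerivAt_moll_fst K₁ K₂ hδ f p.1 p.2).const_mul (η p.2)).add
    ((hasDerivAt_moll_fst K₁ K₂ hδ f p.1 (-p.2)).const_mul (η (-p.2)))).congr_deriv ?_
  simp only [Submodule.coe_smul, Pi.smul_apply, evenMoll_apply, smul_eq_mul]
  ring

theorem evenDt_pow_evenMoll {η : ℝ → ℝ} (hη : ContDiff ℝ (⊤ : ℕ∞) η) (K₁ K₂ : 𝓢(ℝ, ℝ)) {δ : ℝ}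
    (hδ : 0 < δ) (f : ℝ × ℝ →ᵇ ℝ) (n : ℕ) : (evenDt ^ n) (evenMoll hη K₁ K₂ hδ f) =
      (-δ⁻¹) ^ n • evenMoll hη (schwartzDeriv^[n] K₁) K₂ hδ f := by
  induction n generalizing K₁ with
  | zero => simp
  | succ n ih =>
    rw [pow_succ, Module.End.mul_apply, evenDt_evenMoll, map_smul, ih, smul_smul, pow_succ' (-δ⁻¹),
      Function.iterate_succ_apply]

theorem evenDrr_evenMoll {η : ℝ → ℝ} (hη : ContDiff ℝ (⊤ : ℕ∞) η) (K₁ K₂ : 𝓢(ℝ, ℝ)) {δ : ℝ}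
    (hδ : 0 < δ) (f : ℝ × ℝ →ᵇ ℝ) : evenDrr (evenMoll hη K₁ K₂ hδ f) =
      evenMoll (contDiff_deriv (contDiff_deriv hη)) K₁ K₂ hδ f +
        (-2 * δ⁻¹) • evenMoll (contDiff_deriv hη) K₁ (schwartzDeriv K₂) hδ f +
        (δ⁻¹ ^ 2) • evenMoll hη K₁ (schwartzDeriv (schwartzDeriv K₂)) hδ f := by
  refine Subtype.ext (funext fun p => ?_)
  have hη' := fun r => (hη.differentiable (by simp) r).hasDerivAt
  have hη'' := fun r => ((contDiff_deriv hη).differentiable (by simp) r).hasDerivAt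
  have hneg : ∀ {h : ℝ → ℝ} {h' r : ℝ}, HasDerivAt h h' (-r) → HasDerivAt (fun s => h (-s)) (-h') r :=
    fun {h h' r} hh => (HasDerivAt.comp r hh (hasDerivAt_neg r)).congr_deriv (by ring)
  have d1 : ∀ r, pd₂ (evenMoll hη K₁ K₂ hδ f) (p.1, r) =
      (deriv η r * moll K₁ K₂ δ f (p.1, r) + η r * (-δ⁻¹ * moll K₁ (schwartzDeriv K₂) δ f (p.1, r))) -
      (deriv η (-r) * moll K₁ K₂ δ f (p.1, -r) +
        η (-r) * (-δ⁻¹ * moll K₁ (schwartzDeriv K₂) δ f (p.1, -r))) := by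
    intro r
    refine (hasDerivAt_pd₂ (evenMoll hη K₁ K₂ hδ f).2.1 p.1 r).unique ?_
    refine (((hη' r).mul (hasDerivAt_moll_snd K₁ K₂ hδ f p.1 r)).add
      (hneg ((hη' (-r)).mul (hasDerivAt_moll_snd K₁ K₂ hδ f p.1 (-r))))).congr_deriv ?_
    ring
  refine (hasDerivAt_pd₂ (contDiff_pd₂ (evenMoll hη K₁ K₂ hδ f).2.1) p.1 p.2).unique ?_
  simp only [d1]
  have e : ∀ r, HasDerivAt (fun r => deriv η r * moll K₁ K₂ δ f (p.1, r) +
      η r * (-δ⁻¹ * moll K₁ (schwartzDeriv K₂) δ f (p.1, r)))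
      (deriv (deriv η) r * moll K₁ K₂ δ f (p.1, r) +
        -2 * δ⁻¹ * (deriv η r * moll K₁ (schwartzDeriv K₂) δ f (p.1, r)) +
        δ⁻¹ ^ 2 * (η r * moll K₁ (schwartzDeriv (schwartzDeriv K₂)) δ f (p.1, r))) r := by
    intro r
    refine (((hη'' r).mul (hasDerivAt_moll_snd K₁ K₂ hδ f p.1 r)).add
      ((hη' r).mul ((hasDerivAt_moll_snd K₁ (schwartzDeriv K₂) hδ f p.1 r).const_mul (-δ⁻¹)))).congr_deriv ?_
    ring
  refine ((e p.2).sub (hneg (e (-p.2)))).congr_deriv ?_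
  simp only [Submodule.coe_add, Submodule.coe_smul, Pi.add_apply, Pi.smul_apply, evenMoll_apply, smul_eq_mul]
  ring

/-- Every derivative of a mollification costs a factor `δ⁻¹`. -/
theorem exists_abs_evenDrr_pow_evenMoll_le (k : ℕ) {η : ℝ → ℝ} (hη : ContDiff ℝ (⊤ : ℕ∞) η)
    (K₁ K₂ : 𝓢(ℝ, ℝ)) : ∃ C : ℝ, 0 ≤ C ∧ ∀ (δ : ℝ) (hδ : 0 < δ), δ ≤ 1 → ∀ (f : ℝ × ℝ →ᵇ ℝ) (p : ℝ × ℝ),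
      |p.2| ≤ 1 → |((evenDrr ^ k) (evenMoll hη K₁ K₂ hδ f) : ℝ × ℝ → ℝ) p| ≤
        C * δ⁻¹ ^ (2 * k) * ‖f‖ := by
  induction k generalizing η K₁ K₂ with
  | zero =>
    obtain ⟨D, hD⟩ := (isCompact_Icc (a := (-1 : ℝ)) (b := 1)).exists_bound_of_continuousOn
      hη.continuous.continuousOn
    refine ⟨2 * |D| * kernelMass K₁ K₂, mul_nonneg (by positivity) (kernelMass_nonneg _ _),
      fun δ hδ _ f p hp => ?_⟩
    have key : ∀ q : ℝ × ℝ, |q.2| ≤ 1 → |η q.2 * moll K₁ K₂ δ f q| ≤ |D| * (‖f‖ * kernelMass K₁ K₂) := by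
      intro q hq
      rw [abs_mul]
      exact mul_le_mul ((hD _ (abs_le.1 hq)).trans (le_abs_self D)) (abs_moll_le _ _ _ _ _)
        (abs_nonneg _) (abs_nonneg _)
    rw [pow_zero, Module.End.one_apply, evenMoll_apply]
    refine (abs_add_le _ _).trans ((add_le_add (key p hp)
      (key (p.1, -p.2) (by simpa using hp))).trans (le_of_eq ?_))
    ring
  | succ k ih =>
    obtain ⟨C₁, hC₁, h₁⟩ := ih (contDiff_deriv (contDiff_deriv hη)) K₁ K₂
    obtain ⟨C₂, hC₂, h₂⟩ := ih (contDiff_deriv hη) K₁ (schwartzDeriv K₂)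
    obtain ⟨C₃, hC₃, h₃⟩ := ih hη K₁ (schwartzDeriv (schwartzDeriv K₂))
    refine ⟨C₁ + 2 * C₂ + C₃, by positivity, fun δ hδ hδ1 f p hp => ?_⟩
    have hd : 1 ≤ δ⁻¹ := (one_le_inv₀ hδ).2 hδ1
    rw [pow_succ, Module.End.mul_apply, evenDrr_evenMoll, map_add, map_add, map_smul, map_smul]
    simp only [Submodule.coe_add, Submodule.coe_smul, Pi.add_apply, Pi.smul_apply, smul_eq_mul]
    refine (abs_add_three _ _ _).trans ?_
    rw [abs_mul, abs_mul, abs_mul, abs_neg, abs_two, abs_of_pos (inv_pos.2 hδ),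
      abs_of_pos (pow_pos (inv_pos.2 hδ) 2)]
    have hP : 0 ≤ δ⁻¹ ^ (2 * k) * ‖f‖ := by positivity
    have e1 := h₁ δ hδ hδ1 f p hp
    have e2 := mul_le_mul_of_nonneg_left (h₂ δ hδ hδ1 f p hp) (show 0 ≤ 2 * δ⁻¹ by positivity)
    have e3 := mul_le_mul_of_nonneg_left (h₃ δ hδ hδ1 f p hp) (show 0 ≤ δ⁻¹ ^ 2 by positivity)
    have hd2 : 1 ≤ δ⁻¹ ^ 2 := one_le_pow₀ hd
    have hd1 : δ⁻¹ ≤ δ⁻¹ ^ 2 := by nlinarith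
    refine (add_le_add_three e1 e2 e3).trans ?_
    have f1 : C₁ * δ⁻¹ ^ (2 * k) * ‖f‖ ≤ δ⁻¹ ^ 2 * (C₁ * (δ⁻¹ ^ (2 * k) * ‖f‖)) := by
      rw [mul_assoc]
      exact le_mul_of_one_le_left (by positivity) hd2
    have f2 : 2 * δ⁻¹ * (C₂ * δ⁻¹ ^ (2 * k) * ‖f‖) ≤ δ⁻¹ ^ 2 * (2 * C₂ * (δ⁻¹ ^ (2 * k) * ‖f‖)) := by
      have : 2 * δ⁻¹ * (C₂ * δ⁻¹ ^ (2 * k) * ‖f‖) = δ⁻¹ * (2 * C₂ * (δ⁻¹ ^ (2 * k) * ‖f‖)) := by ring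
      rw [this]
      exact mul_le_mul_of_nonneg_right hd1 (by positivity)
    refine (add_le_add_three f1 f2 le_rfl).trans (le_of_eq ?_)
    ring

section Fold

variable {T : ℝ}

/-- A smooth function which is `1` for `r ≥ -1/2` and `0` for `r ≤ -3/4`. -/
def foldCut (r : ℝ) : ℝ := Real.smoothTransition (4 * r + 3)

theorem contDiff_foldCut : ContDiff ℝ (⊤ : ℕ∞) foldCut :=
  Real.smoothTransition.contDiff.comp (by fun_prop)

theorem foldCut_mul_evenCut (r : ℝ) : foldCut r * evenCut r = evenCut r := by
  rcases le_total r (-1 / 2) with h | h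
  · rw [evenCut, Real.smoothTransition.zero_of_nonpos (by linarith), mul_zero]
  · rw [foldCut, Real.smoothTransition.one_of_one_le (by linarith), one_mul]

/-- The value `(κ g)(t, √x) + (κ g)(t, -√x)` at `(t, x)`, where `κ` is `foldCut`. As
`κ θ = θ` and `θ(r) + θ(-r) = 1` for `θ = evenCut`, this is a left inverse of multiplication by
`θ(r)` after the substitution `x = r²`. -/
def foldVal (g : ℝ × ℝ → ℝ) (p : ℝ × ℝ) : ℝ :=
  foldCut (√p.2) * g (p.1, √p.2) + foldCut (-√p.2) * g (p.1, -√p.2)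

theorem fold_evenMoll_mem {f : ℝ × ℝ →ᵇ ℝ} (hf : ∀ q : ℝ × ℝ, √(5 / 6) ≤ q.2 → f q = 0) {δ : ℝ}
    (hδ : 0 < δ) : fold (evenMoll contDiff_foldCut kern kern hδ f) ∈ vanishX T := by
  intro p hp h
  have h1 : √(5 / 6) ≤ √p.2 := Real.sqrt_le_sqrt h
  have h2 : (3 / 4 : ℝ) ≤ √(5 / 6) := Real.le_sqrt_of_sq_le (by norm_num)
  have h3 : moll kern kern δ f (p.1, √p.2) = 0 := by
    have h := abs_moll_le_of_bound kern kern δ f (p.1, √p.2) (C := 0) fun v hv => by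
      have := (pos_of_kern_ne_zero hv).2
      rw [hf _ (by simp only []; nlinarith), abs_zero]
    rw [zero_mul] at h
    exact abs_nonpos_iff.1 h
  rw [fold_apply _ hp, evenMoll_apply]
  simp only []
  rw [h3, mul_zero, zero_add, foldCut, Real.smoothTransition.zero_of_nonpos (by linarith), zero_mul]

/-- The smooth function obtained by clipping, mollifying and folding. -/
def foldMoll {δ : ℝ} (hδ : 0 < δ) : (ℝ × ℝ →ᵇ ℝ) →ₗ[ℝ] vanishX T where
  toFun f := ⟨fold (evenMoll contDiff_foldCut kern kern hδ (clip f)), fold_evenMoll_mem (clip_eq_zero f) hδ⟩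
  map_add' f g := by
    refine Subtype.ext (Smooth.ext fun p hp => ?_)
    simp only [Submodule.coe_add, Pi.add_apply]
    rw [fold_apply _ hp, fold_apply _ hp, fold_apply _ hp]
    simp only [evenMoll_apply, ← mollOp_apply, map_add, _root_.BoundedContinuousFunction.add_apply]
    ring
  map_smul' c f := by
    refine Subtype.ext (Smooth.ext fun p hp => ?_)
    simp only [Submodule.coe_smul, Pi.smul_apply, RingHom.id_apply]
    rw [fold_apply _ hp, fold_apply _ hp]
    simp only [evenMoll_apply, ← mollOp_apply, map_smul, BoundedContinuousFunction.smul_apply, smul_eq_mul]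
    ring

theorem foldMoll_apply {δ : ℝ} (hδ : 0 < δ) (f : ℝ × ℝ →ᵇ ℝ) {p : ℝ × ℝ} (hp : p ∈ rect T) :
    ((foldMoll hδ f : vanishX T).1 : ℝ × ℝ → ℝ) p = foldVal (mollOp kern δ (clip f)) p :=
  fold_apply _ hp

variable [hT : Fact (0 < T)]

theorem exists_supG_foldMoll_le (n : ℕ) : ∃ C : ℝ, 0 ≤ C ∧ ∀ (δ : ℝ) (hδ : 0 < δ), δ ≤ 1 →
    ∀ f : ℝ × ℝ →ᵇ ℝ, supG (1 / 2) n (foldMoll hδ f : vanishX T).1 ≤ C * δ⁻¹ ^ (2 * n) * ‖f‖ := by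
  choose C hC h using fun j k : ℕ =>
    exists_abs_evenDrr_pow_evenMoll_le k contDiff_foldCut (schwartzDeriv^[2 * j] kern) kern
  have hS : 0 ≤ ∑ i ∈ indices n, C i.1 i.2 := Finset.sum_nonneg fun i _ => hC i.1 i.2
  refine ⟨(∑ i ∈ indices n, C i.1 i.2) * 2, by positivity, fun δ hδ hδ1 f => ?_⟩
  have hd : 1 ≤ δ⁻¹ := (one_le_inv₀ hδ).2 hδ1
  have hcl : ‖clip f‖ ≤ 2 * ‖f‖ := norm_clip_le (norm_nonneg _) fun q _ => f.norm_coe_le_norm q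
  refine supG_le (by positivity) fun j k hjk => supN_le fun p hp => ?_
  have hp1 : |√p.2| ≤ 1 := by
    rw [abs_of_nonneg (Real.sqrt_nonneg _)]
    exact Real.sqrt_le_one.2 hp.2.2
  change |(Op (1 / 2) j k (fold (evenMoll contDiff_foldCut kern kern hδ (clip f)) : Smooth T) : ℝ × ℝ → ℝ) p| ≤ _
  rw [Op_fold, evenDt_pow_evenMoll, map_smul, map_smul, smul_smul]
  simp only [Submodule.coe_smul, Pi.smul_apply, smul_eq_mul]
  rw [fold_apply _ hp, abs_mul, abs_mul, abs_pow, abs_pow, abs_neg, abs_of_pos (inv_pos.2 hδ)]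
  have h1 : |(1 / 4 : ℝ)| ^ k ≤ 1 := pow_le_one₀ (abs_nonneg _) (by rw [abs_of_pos] <;> norm_num)
  have h2 := h j k δ hδ hδ1 (clip f) (p.1, √p.2) hp1
  have h3 : C j k ≤ ∑ i ∈ indices n, C i.1 i.2 :=
    Finset.single_le_sum (f := fun i : ℕ × ℕ => C i.1 i.2) (fun i _ => hC i.1 i.2)
      (mem_indices.2 hjk : (j, k) ∈ indices n)
  calc _ ≤ 1 * δ⁻¹ ^ (2 * j) * (C j k * δ⁻¹ ^ (2 * k) * ‖clip f‖) := by
        refine mul_le_mul (mul_le_mul_of_nonneg_right h1 (by positivity)) h2 (abs_nonneg _) (by positivity)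
    _ = C j k * (δ⁻¹ ^ (2 * j + 2 * k) * ‖clip f‖) := by rw [pow_add]; ring
    _ ≤ (∑ i ∈ indices n, C i.1 i.2) * (δ⁻¹ ^ (2 * n) * (2 * ‖f‖)) := by
        refine mul_le_mul h3 (mul_le_mul (pow_le_pow_right₀ hd (by omega)) hcl (norm_nonneg _)
          (by positivity)) (by positivity) hS
    _ = _ := by ring

end Fold

section Summand

variable {T : ℝ}

/-! ### Reflection in `t` -/

/-- The reflection `t ↦ T - t`. -/
def reflT : Module.End ℝ (Smooth T) where
  toFun u := ⟨fun p => (u : ℝ × ℝ → ℝ) (T - p.1, p.2),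
    u.2.1.comp (by fun_prop : ContDiff ℝ (⊤ : ℕ∞) fun p : ℝ × ℝ => (T - p.1, p.2)).contDiffOn
      fun p hp => ⟨⟨by linarith [hp.1.2], by linarith [hp.1.1]⟩, hp.2⟩,
    fun p hp => u.2.2 _ fun h => hp ⟨⟨by linarith [h.1.2], by linarith [h.1.1]⟩, h.2⟩⟩
  map_add' u v := rfl
  map_smul' c u := rfl

theorem reflT_apply (u : Smooth T) (p : ℝ × ℝ) :
    (reflT u : ℝ × ℝ → ℝ) p = (u : ℝ × ℝ → ℝ) (T - p.1, p.2) := rfl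

theorem reflT_mem_rect {p : ℝ × ℝ} (hp : p ∈ rect T) : (T - p.1, p.2) ∈ rect T :=
  ⟨⟨by linarith [hp.1.2], by linarith [hp.1.1]⟩, hp.2⟩

theorem reflT_mem_vanishX {u : Smooth T} (hu : u ∈ vanishX T) : reflT u ∈ vanishX T := fun _ hp h =>
  hu _ (reflT_mem_rect hp) h

/-! ### The tame structure for `a = 1/2` -/

/-- Folding after clipping and smoothing with the index `k`; zero for the index `0`, like
`smoothing`. -/
def foldSmoothing : ℕ → (ℝ × ℝ →ᵇ ℝ) →ₗ[ℝ] vanishX T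
  | 0 => 0
  | k + 1 => foldMoll (Real.exp_pos (-(k / 2)))

theorem foldSmoothing_apply (k : ℕ) (f : ℝ × ℝ →ᵇ ℝ) {p : ℝ × ℝ} (hp : p ∈ rect T) :
    ((foldSmoothing k f : vanishX T).1 : ℝ × ℝ → ℝ) p = foldVal (smoothing k (clip f)) p := by
  rcases k with _ | k
  · simp [foldSmoothing, smoothing, foldVal]
  · exact foldMoll_apply _ f hp

theorem foldVal_congr {g h : ℝ × ℝ → ℝ} (e : ∀ q : ℝ × ℝ, 0 ≤ q.1 → g q = h q) {p : ℝ × ℝ}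
    (hp : p ∈ rect T) : foldVal g p = foldVal h p := by
  rw [foldVal, foldVal, e (p.1, √p.2) hp.1.1, e (p.1, -√p.2) hp.1.1]

theorem abs_foldVal_le {g : ℝ × ℝ → ℝ} {C : ℝ} (h : ∀ q : ℝ × ℝ, 0 ≤ q.1 → |g q| ≤ C)
    {p : ℝ × ℝ} (hp : p ∈ rect T) : |foldVal g p| ≤ 2 * C := by
  have hκ : ∀ r, |foldCut r| ≤ 1 := fun r => by
    rw [foldCut, abs_of_nonneg (Real.smoothTransition.nonneg _)]
    exact Real.smoothTransition.le_one _
  have h1 := (mul_le_of_le_one_left (abs_nonneg _) (hκ (√p.2))).trans (h (p.1, √p.2) hp.1.1)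
  have h2 := (mul_le_of_le_one_left (abs_nonneg _) (hκ (-√p.2))).trans (h (p.1, -√p.2) hp.1.1)
  rw [foldVal]
  refine (abs_add_le _ _).trans ?_
  rw [abs_mul, abs_mul]
  linarith

variable [hT : Fact (0 < T)]

theorem foldVal_unfold (u : vanishX T) {p : ℝ × ℝ} (hp : p ∈ rect T) :
    foldVal (unfold u) p = (mulCut u.1 : ℝ × ℝ → ℝ) p := by
  rw [foldVal, unfold_apply, unfold_apply]
  simp only [max_eq_left hp.1.1, neg_sq, Real.sq_sqrt hp.2.1]
  rw [← mul_assoc, ← mul_assoc, foldCut_mul_evenCut, foldCut_mul_evenCut, ← add_mul, evenCut_add, one_mul]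

/-- The analysis operators, which decompose a function into pieces of decreasing scale: the differences of
consecutive mollifications of `unfold u`. They are clipped to be controlled on the whole plane by
the values for `t ≥ 0`. -/
def analysisOp (k : ℕ) : vanishX T →ₗ[ℝ] (ℝ × ℝ →ᵇ ℝ) :=
  clip ∘ₗ (smoothing (k + 1) - smoothing k) ∘ₗ unfold

/-- The synthesis operators. The sum of two consecutive smoothings makes the products with the
analysis operators telescope. -/
def synthesisOp (k : ℕ) : (ℝ × ℝ →ᵇ ℝ) →ₗ[ℝ] vanishX T := foldSmoothing (k + 1) + foldSmoothing k

theorem exists_norm_analysisOp_le (n : ℕ) : ∃ C : ℝ, 0 ≤ C ∧ ∀ (k : ℕ) (u : vanishX T),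
    ‖analysisOp k u‖ ≤ C * Real.exp (-(n * k)) * supG (1 / 2) (n + 2) u.1 := by
  obtain ⟨C, hC, h⟩ := exists_abs_smoothing_sub_le (T := T) n
  refine ⟨4 * C, by positivity, fun k u => ?_⟩
  have hP : 0 ≤ supG (1 / 2) (n + 2) u.1 := apply_nonneg _ _
  refine (norm_clip_le (C := 2 * (C * Real.exp (-(n * k)) * supG (1 / 2) (n + 2) u.1)) (by positivity)
    fun q hq => ?_).trans (le_of_eq (by ring))
  have h1 := h k u q.1 q.2 hq
  have h2 := h (k + 1) u q.1 q.2 hq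
  have h3 : C * Real.exp (-(n * (k + 1 : ℕ))) * supG (1 / 2) (n + 2) u.1 ≤
      C * Real.exp (-(n * k)) * supG (1 / 2) (n + 2) u.1 := by
    refine mul_le_mul_of_nonneg_right (mul_le_mul_of_nonneg_left ?_ hC) hP
    rw [Real.exp_le_exp]
    push_cast
    nlinarith [(Nat.cast_nonneg n : (0 : ℝ) ≤ n)]
  have e : ((smoothing (k + 1) - smoothing k) ∘ₗ unfold) u q =
      (smoothing (k + 1) (unfold u) (q.1, q.2) - unfold u (q.1, q.2)) -
        (smoothing k (unfold u) (q.1, q.2) - unfold u (q.1, q.2)) := by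
    simp
  rw [e]
  refine (abs_sub _ _).trans ?_
  linarith

theorem exists_supG_synthesisOp_le (n : ℕ) : ∃ C : ℝ, 0 ≤ C ∧ ∀ (k : ℕ) (f : ℝ × ℝ →ᵇ ℝ),
    supG (1 / 2) n (synthesisOp k f : vanishX T).1 ≤ C * Real.exp (n * k) * ‖f‖ := by
  obtain ⟨C, hC, h⟩ := exists_supG_foldMoll_le (T := T) n
  have key : ∀ (k : ℕ) (f : ℝ × ℝ →ᵇ ℝ),
      supG (1 / 2) n (foldSmoothing k f : vanishX T).1 ≤ C * Real.exp (n * k) * ‖f‖ := by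
    intro k f
    rcases k with _ | k
    · have : supG (1 / 2) n (foldSmoothing 0 f : vanishX T).1 = 0 := map_zero _
      rw [this]
      positivity
    · refine (h _ (Real.exp_pos _) (Real.exp_le_one_iff.2 (by simp; positivity)) f).trans ?_
      refine mul_le_mul_of_nonneg_right (mul_le_mul_of_nonneg_left ?_ hC) (norm_nonneg _)
      rw [← Real.exp_neg, ← Real.exp_nat_mul, Real.exp_le_exp]
      push_cast
      nlinarith [(Nat.cast_nonneg n : (0 : ℝ) ≤ n)]
  refine ⟨C * Real.exp n + C, by positivity, fun k f => ?_⟩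
  have h1 : supG (1 / 2) n (synthesisOp k f : vanishX T).1 ≤
      supG (1 / 2) n (foldSmoothing (k + 1) f : vanishX T).1 +
        supG (1 / 2) n (foldSmoothing k f : vanishX T).1 := map_add_le_add (supG (1 / 2) n) _ _
  refine h1.trans ((add_le_add (key (k + 1) f) (key k f)).trans (le_of_eq ?_))
  have e : Real.exp (n * (k + 1 : ℕ)) = Real.exp n * Real.exp (n * k) := by
    rw [← Real.exp_add]; congr 1; push_cast; ring
  rw [e]
  ring

/-- The sums telescope, because `(S' + S)(S' - S) = S'² - S²` for commuting operators. The clipping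
in between has no effect, because the functions concerned vanish for `r ≥ √(5/6)` and only their
values for `t ≥ 0` matter. -/
theorem sum_synthesisOp_analysisOp (K : ℕ) (u : vanishX T) {p : ℝ × ℝ} (hp : p ∈ rect T) :
    ((∑ k ∈ Finset.range K, synthesisOp k (analysisOp k u) : vanishX T).1 : ℝ × ℝ → ℝ) p =
      foldVal (smoothing K (smoothing K (unfold u))) p := by
  induction K with
  | zero => simp [smoothing, foldVal]
  | succ k ih =>
    rw [Finset.sum_range_succ]
    simp only [Submodule.coe_add, Pi.add_apply]
    rw [ih]
    set w := unfold u with hw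
    set g := smoothing (k + 1) w - smoothing k w with hg
    have hg0 : ∀ q : ℝ × ℝ, √(5 / 6) ≤ q.2 → g q = 0 := fun q hq => by
      rw [hg, BoundedContinuousFunction.sub_apply,
        smoothing_eq_zero (fun q hq => unfold_eq_zero u hq) _ hq,
        smoothing_eq_zero (fun q hq => unfold_eq_zero u hq) _ hq, sub_zero]
    have hcc : ∀ q : ℝ × ℝ, 0 ≤ q.1 → clip (clip g) q = g q := fun q hq => by
      rw [clip_eq_self (clip_eq_zero g) hq, clip_eq_self hg0 hq]
    have e : ∀ j, ((foldSmoothing j (clip g) : vanishX T).1 : ℝ × ℝ → ℝ) p = foldVal (smoothing j g) p :=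
      fun j => by
        rw [foldSmoothing_apply _ _ hp]
        exact foldVal_congr (fun q hq => smoothing_congr hcc j hq) hp
    have e2 : ((synthesisOp k (analysisOp k u) : vanishX T).1 : ℝ × ℝ → ℝ) p =
        foldVal (smoothing (k + 1) g) p + foldVal (smoothing k g) p := by
      rw [← e, ← e]; rfl
    rw [e2, hg, map_sub, map_sub, smoothing_comm k (k + 1)]
    simp only [foldVal, BoundedContinuousFunction.sub_apply]
    ring

/-- The products of synthesis and analysis operators sum up to the cut-off in `t`, not to the
identity. -/
theorem tendsto_sum_synthesisOp (u : vanishX T) : Tendsto (fun K => supN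
    ((∑ k ∈ Finset.range K, synthesisOp k (analysisOp k u) : vanishX T).1 - mulCut u.1)) atTop (𝓝 0) := by
  obtain ⟨C, hC, h⟩ := exists_abs_smoothing_sub_le (T := T) 1
  set P := supG (1 / 2) (1 + 2) u.1 with hP
  have hP0 : 0 ≤ P := apply_nonneg _ _
  have hm : 0 ≤ kernelMass kern kern := kernelMass_nonneg _ _
  have hlim : Tendsto (fun K : ℕ => 2 * (C * P * (kernelMass kern kern + 1)) * Real.exp (-(K : ℝ)))
      atTop (𝓝 0) := by
    have h1 : Tendsto (fun K : ℕ => Real.exp (-(K : ℝ))) atTop (𝓝 0) :=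
      Real.tendsto_exp_neg_atTop_nhds_zero.comp tendsto_natCast_atTop_atTop
    simpa using h1.const_mul (2 * (C * P * (kernelMass kern kern + 1)))
  refine squeeze_zero (fun K => apply_nonneg _ _) (fun K => supN_le fun p hp => ?_) hlim
  set w := unfold u with hw
  have hδ : ∀ q : ℝ × ℝ, 0 ≤ q.1 → |smoothing K w q - w q| ≤ C * P * Real.exp (-(K : ℝ)) := by
    intro q hq
    refine (h K u q.1 q.2 hq).trans (le_of_eq ?_)
    rw [Nat.cast_one, one_mul]
    ring
  have hδ2 : ∀ q : ℝ × ℝ, 0 ≤ q.1 → |smoothing K (smoothing K w) q - w q| ≤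
      C * P * (kernelMass kern kern + 1) * Real.exp (-(K : ℝ)) := by
    intro q hq
    have h1 := abs_smoothing_le (f := smoothing K w - w) (C := C * P * Real.exp (-(K : ℝ)))
      (by positivity) hδ K hq
    rw [map_sub, BoundedContinuousFunction.sub_apply] at h1
    have h2 := (abs_sub_le _ (smoothing K w q) _).trans (add_le_add h1 (hδ q hq))
    exact h2.trans (le_of_eq (by ring))
  have e : (((∑ k ∈ Finset.range K, synthesisOp k (analysisOp k u) : vanishX T).1 - mulCut u.1 : Smooth T) :
      ℝ × ℝ → ℝ) p = foldVal (fun q => smoothing K (smoothing K w) q - w q) p := by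
    have h1 : (((∑ k ∈ Finset.range K, synthesisOp k (analysisOp k u) : vanishX T).1 - mulCut u.1 : Smooth T) :
      ℝ × ℝ → ℝ) p = ((∑ k ∈ Finset.range K, synthesisOp k (analysisOp k u) : vanishX T).1 : ℝ × ℝ → ℝ) p -
        (mulCut u.1 : ℝ × ℝ → ℝ) p := rfl
    rw [h1, sum_synthesisOp_analysisOp K u hp, ← foldVal_unfold u hp]
    simp only [foldVal]
    ring
  rw [e]
  exact (abs_foldVal_le hδ2 hp).trans (le_of_eq (by ring))

theorem Dt_reflT (u : Smooth T) : Dt (reflT u) = -reflT (Dt u) := by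
  refine Smooth.ext fun p hp => ?_
  have h1 : HasDerivWithinAt (fun s => T - s) (-1) (Icc 0 T) p.1 := by
    simpa using (hasDerivWithinAt_id p.1 (Icc 0 T)).const_sub T
  have h2 := HasDerivWithinAt.comp (h := fun s => T - s) p.1
    (hasDerivWithinAt_Dt u (reflT_mem_rect hp)) h1
    fun s hs => ⟨by linarith [hs.2], by linarith [hs.1]⟩
  refine (Dt_eq_of_hasDerivWithinAt (u := reflT u) hp h2).trans ?_
  simp [reflT_apply]

theorem Dx_reflT (u : Smooth T) : Dx (reflT u) = reflT (Dx u) :=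
  Smooth.ext fun _ hp => Dx_eq_of_hasDerivWithinAt hp (hasDerivWithinAt_Dx u (reflT_mem_rect hp))

theorem Op_reflT (a : ℝ) (j k : ℕ) (u : Smooth T) : Op a j k (reflT u) = reflT (Op a j k u) := by
  have h1 : ∀ (k : ℕ) (u : Smooth T), (Lap a ^ k) (reflT u) = reflT ((Lap a ^ k) u) := by
    intro k
    induction k with
    | zero => intro u; rfl
    | succ k ih =>
      intro u
      have e : Lap a (reflT u) = reflT (Lap a u) := by
        ext p
        rw [Lap_apply, reflT_apply, Lap_apply, Dx_reflT, Dx_reflT, reflT_apply, reflT_apply]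
      rw [pow_succ, Module.End.mul_apply, Module.End.mul_apply, e, ih]
  have h2 : ∀ (j : ℕ) (u : Smooth T), (Dt ^ (2 * j)) (reflT u) = reflT ((Dt ^ (2 * j)) u) := by
    intro j
    induction j with
    | zero => intro u; rfl
    | succ j ih =>
      intro u
      rw [mul_add, mul_one, pow_add, Module.End.mul_apply, Module.End.mul_apply, pow_two,
        Module.End.mul_apply, Module.End.mul_apply, Dt_reflT, map_neg, Dt_reflT, neg_neg, ih]
  rw [Op, Module.End.mul_apply, Module.End.mul_apply, h1, h2]

theorem supN_reflT_le (u : Smooth T) : supN (reflT u) ≤ supN u :=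
  supN_le fun p hp => by
    rw [reflT_apply]
    exact abs_apply_le u (reflT_mem_rect hp)

theorem supG_reflT_le (a : ℝ) (n : ℕ) (u : Smooth T) : supG a n (reflT u) ≤ supG a n u :=
  supG_le (apply_nonneg _ _) fun j k h => by
    rw [Op_reflT]
    exact (supN_reflT_le _).trans (supN_Op_le_supG a h u)

/-- The reflection `t ↦ T - t` on `vanishX T`. -/
def reflX : vanishX T →ₗ[ℝ] vanishX T := reflT.restrict fun _ h => reflT_mem_vanishX h

/-- The cut-off function and its reflection form a partition of unity. -/
theorem mulCut_add_reflT (u : Smooth T) : mulCut u + reflT (mulCut (reflT u)) = u := by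
  ext p
  change cutT T p.1 * (u : ℝ × ℝ → ℝ) p + cutT T (T - p.1) * (u : ℝ × ℝ → ℝ) (T - (T - p.1), p.2) = _
  rw [sub_sub_cancel, ← add_mul, cutT_add, one_mul]

/-! ### Completeness, and the tame direct summand -/

theorem exists_limit_vanishX {a : ℝ} (ha : 0 < a) (f : ℕ → vanishX T)
    (hf : ∀ n : ℕ, ∀ ε > 0, ∃ K : ℕ, ∀ i ≥ K, ∀ j ≥ K, supG a n ((f i).1 - (f j).1) < ε) :
    ∃ v : vanishX T, ∀ n : ℕ, Tendsto (fun i => supG a n ((f i).1 - v.1)) atTop (𝓝 0) := by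
  obtain ⟨v, hv⟩ := exists_smooth_limit (fun i => (f i).1) fun i ε hε => by
    obtain ⟨C, hC, h⟩ := exists_derivN_le (T := T) ha i
    obtain ⟨K, hK⟩ := hf (i.1 / 2 + i.2 + 1) (ε / (C + 1)) (by positivity)
    refine ⟨K, fun m hm n hn => (h _).trans_lt ?_⟩
    have h1 := hK m hm n hn
    rw [lt_div_iff₀ (by positivity)] at h1
    have h2 : 0 ≤ supG a (i.1 / 2 + i.2 + 1) ((f m).1 - (f n).1) := apply_nonneg _ _
    linarith
  refine ⟨⟨v, fun p hp h => ?_⟩, fun n => ?_⟩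
  · have h0 := hv (0, 0)
    have e : ∀ w : Smooth T, derivN (0, 0) w = supN w := fun w => by simp [derivN, derivOp]
    simp only [e] at h0
    refine abs_nonpos_iff.1 (ge_of_tendsto' h0 fun i => ?_)
    have h1 := abs_apply_le ((f i).1 - v) hp
    have h2 : (((f i).1 - v : Smooth T) : ℝ × ℝ → ℝ) p = -(v : ℝ × ℝ → ℝ) p := by
      change ((f i).1 : ℝ × ℝ → ℝ) p - _ = _
      rw [(f i).2 p hp h, zero_sub]
    rwa [h2, abs_neg] at h1
  · obtain ⟨s, C, hC, h⟩ := exists_supG_le_derivN (T := T) a n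
    have h1 : Tendsto (fun i => C * ∑ j ∈ s, derivN j ((f i).1 - v)) atTop (𝓝 0) := by
      have := (tendsto_finsetSum s fun j _ => hv j).const_mul C
      simpa using this
    exact squeeze_zero (fun i => apply_nonneg _ _) (fun i => h _) h1

theorem eq_zero_of_supN_eq_zero {u : Smooth T} (h : supN u = 0) : u = 0 :=
  Smooth.ext fun _ hp => abs_nonpos_iff.1 ((abs_apply_le u hp).trans_eq h)

/-- The second copy of the bounded continuous functions treats the reflection `t ↦ T - t` of the
function, since the operators only reproduce the part of it cut off near `t = T`. -/
theorem isTameDirectSummand_supG_half : IsTameDirectSummand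
    (fun n (u : vanishX T) => supG (1 / 2) n u.1) (expSeqNorm ((ℝ × ℝ →ᵇ ℝ) × (ℝ × ℝ →ᵇ ℝ))) := by
  refine isTameDirectSummand_of_operators (V := vanishX T) (B := (ℝ × ℝ →ᵇ ℝ) × (ℝ × ℝ →ᵇ ℝ))
    (fun n => (supG (1 / 2) n).comp (vanishX T).subtype) ?_
    (exists_limit_vanishX (T := T) (a := 1 / 2) (by norm_num)) 2
    (fun k => (analysisOp (T := T) k).prod (analysisOp k ∘ₗ reflX))
    (fun k => (synthesisOp (T := T) k).coprod (reflX ∘ₗ synthesisOp k)) ?_ ?_ ?_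
  · intro v hv
    refine Subtype.ext (eq_zero_of_supN_eq_zero ?_)
    rw [← supG_zero (1 / 2)]
    exact hv
  · intro n
    obtain ⟨C, hC, h⟩ := exists_norm_analysisOp_le (T := T) n
    refine ⟨C, hC, fun k v => max_le (h k v) ((h k (reflX v)).trans ?_)⟩
    exact mul_le_mul_of_nonneg_left (supG_reflT_le _ _ _) (by positivity)
  · intro n
    obtain ⟨C, hC, h⟩ := exists_supG_synthesisOp_le (T := T) n
    refine ⟨C + C, by positivity, fun k f => ?_⟩
    have h1 : ∀ g : ℝ × ℝ →ᵇ ℝ, ‖g‖ ≤ ‖f‖ → supG (1 / 2) n (synthesisOp k g : vanishX T).1 ≤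
        C * Real.exp (n * k) * ‖f‖ := fun g hg =>
      (h k g).trans (mul_le_mul_of_nonneg_left hg (by positivity))
    have h2 := (supG_reflT_le (1 / 2) n (synthesisOp k f.2 : vanishX T).1).trans
      (h1 f.2 (norm_snd_le f))
    have h3 : supG (1 / 2) n ((synthesisOp k f.1 : vanishX T).1 + reflT (synthesisOp k f.2 : vanishX T).1) ≤
        _ := map_add_le_add (supG (1 / 2) n) _ _
    refine (h3.trans (add_le_add (h1 f.1 (norm_fst_le f)) h2)).trans (le_of_eq ?_)
    ring
  · intro v
    have h1 := (tendsto_sum_synthesisOp v).add (tendsto_sum_synthesisOp (reflX v))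
    rw [add_zero] at h1
    refine squeeze_zero (fun K => apply_nonneg _ _) (fun K => ?_) h1
    set x := (∑ k ∈ Finset.range K, synthesisOp k (analysisOp k v) : vanishX T) with hx
    set y := (∑ k ∈ Finset.range K, synthesisOp k (analysisOp k (reflX v)) : vanishX T) with hy
    have e : (∑ k ∈ Finset.range K, (synthesisOp k).coprod (reflX ∘ₗ synthesisOp k)
        ((analysisOp k).prod (analysisOp k ∘ₗ reflX) v) : vanishX T) = x + reflX y := by
      simp [hx, hy, Finset.sum_add_distrib, map_sum]
    rw [e]
    change supG (1 / 2) 0 (x.1 + reflT y.1 - v.1) ≤ _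
    have e2 : x.1 + reflT y.1 - v.1 = (x.1 - mulCut v.1) + reflT (y.1 - mulCut (reflT v.1)) := by
      conv_lhs => rw [← mulCut_add_reflT v.1]
      rw [map_sub]
      abel
    rw [supG_zero, e2]
    exact (map_add_le_add supN _ _).trans (add_le_add le_rfl (supN_reflT_le _))

end Summand

/-! ### One-dimensional inequalities -/

/-- The Cauchy–Schwarz inequality with respect to a weight. -/
theorem sq_integral_mul_le {a b : ℝ} (hab : a ≤ b) {w f : ℝ → ℝ} (hw : ContinuousOn w (Icc a b))
    (hf : ContinuousOn f (Icc a b)) (hw0 : ∀ x ∈ Icc a b, 0 ≤ w x) :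
    (∫ x in a..b, w x * f x) ^ 2 ≤ (∫ x in a..b, w x) * ∫ x in a..b, w x * f x ^ 2 := by
  have i0 := hw.intervalIntegrable_of_Icc (μ := volume) hab
  have i1 : IntervalIntegrable (fun x => w x * f x) volume a b :=
    (hw.mul hf).intervalIntegrable_of_Icc (μ := volume) hab
  have i2 : IntervalIntegrable (fun x => w x * f x ^ 2) volume a b :=
    (hw.mul (hf.pow 2)).intervalIntegrable_of_Icc (μ := volume) hab
  have h : ∀ c : ℝ, 0 ≤ (∫ x in a..b, w x) * (c * c) + (-2 * ∫ x in a..b, w x * f x) * c +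
      ∫ x in a..b, w x * f x ^ 2 := by
    intro c
    have e : (∫ x in a..b, w x) * (c * c) + (-2 * ∫ x in a..b, w x * f x) * c +
        ∫ x in a..b, w x * f x ^ 2 = ∫ x in a..b, w x * (f x - c) ^ 2 := by
      have e1 : ∀ x, w x * (f x - c) ^ 2 = (c * c) * w x + (-2 * c) * (w x * f x) + w x * f x ^ 2 :=
        fun x => by ring
      simp only [e1]
      rw [intervalIntegral.integral_add ((i0.const_mul _).add (i1.const_mul _)) i2,
        intervalIntegral.integral_add (i0.const_mul _) (i1.const_mul _),
        intervalIntegral.integral_const_mul, intervalIntegral.integral_const_mul]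
      ring
    rw [e]
    exact intervalIntegral.integral_nonneg hab fun x hx => mul_nonneg (hw0 x hx) (sq_nonneg _)
  have := discrim_le_zero h
  rw [discrim] at this
  linarith

theorem abs_sub_le_of_abs_deriv_le {a b : ℝ} (hab : a ≤ b) {f f' F F' : ℝ → ℝ}
    (hf : ContinuousOn f (Icc a b)) (hF : ContinuousOn F (Icc a b))
    (df : ∀ x ∈ Ioo a b, HasDerivAt f (f' x) x) (dF : ∀ x ∈ Ioo a b, HasDerivAt F (F' x) x)
    (h : ∀ x ∈ Ioo a b, |f' x| ≤ F' x) : |f b - f a| ≤ F b - F a := by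
  have h1 : MonotoneOn (F - f) (Icc a b) := by
    refine monotoneOn_of_hasDerivWithinAt_nonneg (convex_Icc a b) (hF.sub hf) (f' := F' - f') ?_ ?_
    · rw [interior_Icc]
      exact fun x hx => ((dF x hx).sub (df x hx)).hasDerivWithinAt
    · rw [interior_Icc]
      exact fun x hx => sub_nonneg.2 ((le_abs_self _).trans (h x hx))
  have h2 : MonotoneOn (F + f) (Icc a b) := by
    refine monotoneOn_of_hasDerivWithinAt_nonneg (convex_Icc a b) (hF.add hf) (f' := F' + f') ?_ ?_
    · rw [interior_Icc]
      exact fun x hx => ((dF x hx).add (df x hx)).hasDerivWithinAt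
    · rw [interior_Icc]
      exact fun x hx => by
        have := (neg_le_abs _).trans (h x hx)
        simp only [Pi.add_apply]
        linarith
  have e1 := h1 (left_mem_Icc.2 hab) (right_mem_Icc.2 hab) hab
  have e2 := h2 (left_mem_Icc.2 hab) (right_mem_Icc.2 hab) hab
  simp only [Pi.sub_apply, Pi.add_apply] at e1 e2
  rw [abs_le]
  constructor <;> linarith

/-- A Sobolev inequality on `[0, T]`. -/
theorem exists_sq_le_integral {T : ℝ} (hT : 0 < T) : ∃ C : ℝ, 0 ≤ C ∧ ∀ h h' h'' : ℝ → ℝ,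
    (∀ t ∈ Icc 0 T, HasDerivWithinAt h (h' t) (Icc 0 T) t) →
    (∀ t ∈ Icc 0 T, HasDerivWithinAt h' (h'' t) (Icc 0 T) t) → ContinuousOn h'' (Icc 0 T) →
    ∀ t ∈ Icc 0 T, h t ^ 2 ≤ C * ((∫ s in (0 : ℝ)..T, h s ^ 2) + ∫ s in (0 : ℝ)..T, h'' s ^ 2) := by
  refine ⟨294 / T + 2 * T ^ 3, by positivity, fun h h' h'' d1 d2 hc t ht => ?_⟩
  have c0 : ContinuousOn h (Icc 0 T) := fun s hs => (d1 s hs).continuousWithinAt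
  have c1 : ContinuousOn h' (Icc 0 T) := fun s hs => (d2 s hs).continuousWithinAt
  set I := ∫ s in (0 : ℝ)..T, h s ^ 2 with hI
  set J := ∫ s in (0 : ℝ)..T, h'' s ^ 2 with hJ
  have hI0 : 0 ≤ I := intervalIntegral.integral_nonneg hT.le fun _ _ => sq_nonneg _
  have hJ0 : 0 ≤ J := intervalIntegral.integral_nonneg hT.le fun _ _ => sq_nonneg _
  have hmono : ∀ {f : ℝ → ℝ} {c d : ℝ}, ContinuousOn f (Icc 0 T) → 0 ≤ c → c ≤ d → d ≤ T →
      ∫ s in c..d, f s ^ 2 ≤ ∫ s in (0 : ℝ)..T, f s ^ 2 := fun hf hc hcd hd =>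
    intervalIntegral.integral_mono_interval hc hcd hd (Eventually.of_forall fun _ => sq_nonneg _)
      ((hf.pow 2).intervalIntegrable_of_Icc hT.le)
  -- On every third of the interval there is a point where `h` is at most its quadratic mean.
  have hpt : ∀ c : ℝ, 0 ≤ c → c + T / 3 ≤ T → ∃ s ∈ Icc c (c + T / 3), |h s| ≤ √(3 * I / T) := by
    intro c hc0 hcT
    have hsub : Icc c (c + T / 3) ⊆ Icc 0 T := Icc_subset_Icc hc0 hcT
    have hcc : c ≤ c + T / 3 := by linarith
    obtain ⟨s, hs, hmin⟩ := isCompact_Icc.exists_isMinOn (nonempty_Icc.2 hcc) ((c0.mono hsub).pow 2)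
    refine ⟨s, hs, Real.abs_le_sqrt ?_⟩
    have h1 : ∫ _ in c..(c + T / 3), h s ^ 2 ≤ ∫ y in c..(c + T / 3), h y ^ 2 :=
      intervalIntegral.integral_mono_on hcc intervalIntegrable_const
        (((c0.mono hsub).pow 2).intervalIntegrable_of_Icc hcc) fun y hy => hmin hy
    rw [intervalIntegral.integral_const, add_sub_cancel_left, smul_eq_mul] at h1
    have h2 := h1.trans (hmono c0 hc0 hcc hcT)
    rw [le_div_iff₀ hT]
    linarith
  -- The oscillation of `h'`, by the Cauchy–Schwarz inequality.
  have hdiff : ∀ c ∈ Icc 0 T, ∀ d ∈ Icc 0 T, |h' d - h' c| ≤ √(T * J) := by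
    have key : ∀ c ∈ Icc 0 T, ∀ d ∈ Icc 0 T, c ≤ d → |h' d - h' c| ≤ √(T * J) := by
      intro c hcm d hdm hcd
      have hsub : Icc c d ⊆ Icc 0 T := Icc_subset_Icc hcm.1 hdm.2
      have h1 : ∫ y in c..d, h'' y = h' d - h' c :=
        intervalIntegral.integral_eq_sub_of_hasDerivAt_of_le hcd (c1.mono hsub)
          (fun y hy => (d2 y (hsub (Ioo_subset_Icc_self hy))).hasDerivAt
            (Icc_mem_nhds (hcm.1.trans_lt hy.1) (hy.2.trans_le hdm.2)))
          ((hc.mono hsub).intervalIntegrable_of_Icc hcd)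
      have h2 := sq_integral_mul_le hcd (w := fun _ => 1) continuousOn_const (hc.mono hsub)
        fun _ _ => zero_le_one
      simp only [one_mul, intervalIntegral.integral_const, smul_eq_mul, mul_one, h1] at h2
      refine Real.abs_le_sqrt (h2.trans ?_)
      refine mul_le_mul (by linarith [hcm.1, hdm.2]) (hmono hc hcm.1 hcd hdm.2) ?_ hT.le
      exact intervalIntegral.integral_nonneg hcd fun _ _ => sq_nonneg _
    intro c hcm d hdm
    rcases le_total c d with hcd | hcd
    · exact key c hcm d hdm hcd
    · rw [abs_sub_comm]; exact key d hdm c hcm hcd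
  set M := √(3 * I / T) with hM
  set E := √(T * J) with hE
  have hM0 : 0 ≤ M := Real.sqrt_nonneg _
  have hE0 : 0 ≤ E := Real.sqrt_nonneg _
  obtain ⟨s₁, hs₁, hb₁⟩ := hpt 0 le_rfl (by linarith)
  obtain ⟨s₂, hs₂, hb₂⟩ := hpt (2 * T / 3) (by positivity) (by linarith)
  have hm₁ : s₁ ∈ Icc 0 T := ⟨hs₁.1, by linarith [hs₁.2]⟩
  have hm₂ : s₂ ∈ Icc 0 T := ⟨by linarith [hs₂.1], by linarith [hs₂.2]⟩
  have hlt : s₁ < s₂ := by linarith [hs₁.2, hs₂.1]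
  have hsub : Icc s₁ s₂ ⊆ Icc 0 T := Icc_subset_Icc hm₁.1 hm₂.2
  -- A point where `h'` is the slope of a chord of length at least `T / 3`.
  obtain ⟨ξ, hξ, hξ'⟩ := exists_hasDerivAt_eq_slope h h' hlt (c0.mono hsub) fun y hy =>
    (d1 y (hsub (Ioo_subset_Icc_self hy))).hasDerivAt
      (Icc_mem_nhds (hm₁.1.trans_lt hy.1) (hy.2.trans_le hm₂.2))
  have hξb : |h' ξ| ≤ 6 * M / T := by
    rw [hξ', abs_div, abs_of_pos (sub_pos.2 hlt), div_le_div_iff₀ (sub_pos.2 hlt) hT]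
    have h1 : |h s₂ - h s₁| ≤ 2 * M := (abs_sub _ _).trans (by linarith)
    have h2 : T / 3 ≤ s₂ - s₁ := by linarith [hs₁.2, hs₂.1]
    nlinarith
  have hd' : ∀ s ∈ Icc 0 T, |h' s| ≤ 6 * M / T + E := by
    intro s hs
    have h1 := hdiff ξ (hsub (Ioo_subset_Icc_self hξ)) s hs
    have h2 := abs_sub_abs_le_abs_sub (h' s) (h' ξ)
    linarith
  have h1 : |h t| ≤ 7 * M + T * E := by
    have h2 := (convex_Icc 0 T).norm_image_sub_le_of_norm_hasDerivWithin_le d1 hd' hm₁ ht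
    rw [Real.norm_eq_abs, Real.norm_eq_abs] at h2
    have h3 : |t - s₁| ≤ T := by
      rw [abs_le]; constructor <;> linarith [ht.1, ht.2, hm₁.1, hm₁.2]
    have h4 : (6 * M / T + E) * |t - s₁| ≤ 6 * M + T * E := by
      refine (mul_le_mul_of_nonneg_left h3 (by positivity)).trans (le_of_eq ?_)
      field_simp
    have h5 := abs_sub_abs_le_abs_sub (h t) (h s₁)
    linarith
  have hM2 : M ^ 2 = 3 * I / T := Real.sq_sqrt (by positivity)
  have hE2 : E ^ 2 = T * J := Real.sq_sqrt (by positivity)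
  calc h t ^ 2 = |h t| ^ 2 := (sq_abs _).symm
    _ ≤ (7 * M + T * E) ^ 2 := pow_le_pow_left₀ (abs_nonneg _) h1 2
    _ ≤ 98 * M ^ 2 + 2 * T ^ 2 * E ^ 2 := by nlinarith [sq_nonneg (7 * M - T * E)]
    _ = 294 / T * I + 2 * T ^ 3 * J := by rw [hM2, hE2]; ring
    _ ≤ (294 / T + 2 * T ^ 3) * (I + J) := by
      have : 0 ≤ 294 / T * J + 2 * T ^ 3 * I := by positivity
      nlinarith

/-! ### Weighted estimates for the singular operator -/

section Weighted

variable {T : ℝ} [hT : Fact (0 < T)]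

theorem hasDerivAt_Dx (u : Smooth T) {t x : ℝ} (ht : t ∈ Icc 0 T) (hx : x ∈ Ioo (0 : ℝ) 1) :
    HasDerivAt (fun y => (u : ℝ × ℝ → ℝ) (t, y)) ((Dx u : ℝ × ℝ → ℝ) (t, x)) x :=
  (hasDerivWithinAt_Dx u (p := (t, x)) ⟨ht, Ioo_subset_Icc_self hx⟩).hasDerivAt
    (Icc_mem_nhds hx.1 hx.2)

theorem continuousOn_slice (u : Smooth T) {t : ℝ} (ht : t ∈ Icc 0 T) :
    ContinuousOn (fun y => (u : ℝ × ℝ → ℝ) (t, y)) (Icc 0 1) := fun y hy =>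
  (hasDerivWithinAt_Dx u (p := (t, y)) ⟨ht, hy⟩).continuousWithinAt

/-- The operator `Λ_a` is `x ^ (1 - a) ∂ₓ (x ^ a ∂ₓ)`. -/
theorem hasDerivAt_rpow_mul_Dx (a : ℝ) (u : Smooth T) {t x : ℝ} (ht : t ∈ Icc 0 T)
    (hx : x ∈ Ioo (0 : ℝ) 1) : HasDerivAt (fun y => y ^ a * (Dx u : ℝ × ℝ → ℝ) (t, y))
      (x ^ (a - 1) * (Lap a u : ℝ × ℝ → ℝ) (t, x)) x := by
  refine ((Real.hasDerivAt_rpow_const (Or.inl hx.1.ne')).mul (hasDerivAt_Dx (Dx u) ht hx)).congr_deriv ?_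
  have e : x ^ a = x ^ (a - 1) * x := by
    rw [← Real.rpow_add_one hx.1.ne', sub_add_cancel]
  rw [Lap_apply, e]
  ring

theorem continuousOn_rpow_mul_Dx {a : ℝ} (ha : 0 ≤ a) (u : Smooth T) {t : ℝ} (ht : t ∈ Icc 0 T) :
    ContinuousOn (fun y => y ^ a * (Dx u : ℝ × ℝ → ℝ) (t, y)) (Icc 0 1) :=
  (Real.continuous_rpow_const ha).continuousOn.mul (continuousOn_slice (Dx u) ht)

/-- The weighted form of `sup |∂ₓ u| ≤ a⁻¹ sup |Λ_a u|`, with the weight `x ^ β`, `β < a`. -/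
theorem rpow_mul_abs_Dx_le {a β : ℝ} (ha : 0 < a) (hβ : β < a) (u : Smooth T) {t A : ℝ}
    (ht : t ∈ Icc 0 T)
    (h : ∀ x ∈ Icc (0 : ℝ) 1, x ^ β * |(Lap a u : ℝ × ℝ → ℝ) (t, x)| ≤ A) {x : ℝ}
    (hx : x ∈ Ioc (0 : ℝ) 1) : x ^ β * |(Dx u : ℝ × ℝ → ℝ) (t, x)| ≤ A / (a - β) := by
  have hab : 0 < a - β := sub_pos.2 hβ
  have hsub : Icc 0 x ⊆ Icc (0 : ℝ) 1 := Icc_subset_Icc_right hx.2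
  have key := abs_sub_le_of_abs_deriv_le hx.1.le
    ((continuousOn_rpow_mul_Dx ha.le u ht).mono hsub)
    (F := fun y => A / (a - β) * y ^ (a - β)) (F' := fun y => A * y ^ (a - β - 1))
    ((Real.continuous_rpow_const hab.le).continuousOn.const_smul (A / (a - β)))
    (fun y hy => hasDerivAt_rpow_mul_Dx a u ht ⟨hy.1, hy.2.trans_le hx.2⟩)
    (fun y hy => ((Real.hasDerivAt_rpow_const (Or.inl hy.1.ne')).const_mul _).congr_deriv
      (by field_simp)) fun y hy => by
        rw [abs_mul, abs_of_nonneg (Real.rpow_nonneg hy.1.le _)]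
        have h1 := h y ⟨hy.1.le, hy.2.le.trans hx.2⟩
        have e : y ^ (a - 1) = y ^ (a - β - 1) * y ^ β := by
          rw [← Real.rpow_add hy.1]; congr 1; ring
        rw [e, mul_assoc, mul_comm A]
        exact mul_le_mul_of_nonneg_left h1 (Real.rpow_nonneg hy.1.le _)
  simp only [Real.zero_rpow ha.ne', Real.zero_rpow hab.ne', zero_mul, mul_zero, sub_zero] at key
  rw [abs_mul, abs_of_pos (Real.rpow_pos_of_pos hx.1 _)] at key
  have e : x ^ a = x ^ (a - β) * x ^ β := by rw [← Real.rpow_add hx.1]; congr 1; ring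
  rw [e, mul_assoc, mul_comm (A / (a - β))] at key
  exact le_of_mul_le_mul_left key (Real.rpow_pos_of_pos hx.1 _)

theorem exists_rpow_mul_abs_Dx_pow_le (k : ℕ) {a β : ℝ} (ha : 0 < a) (hβ0 : 0 < β) (hβ : β < a) :
    ∃ C : ℝ, 0 ≤ C ∧ ∀ (u : Smooth T) (t A : ℝ), t ∈ Icc 0 T →
      (∀ x ∈ Icc (0 : ℝ) 1, x ^ β * |((Lap a ^ k) u : ℝ × ℝ → ℝ) (t, x)| ≤ A) →
      ∀ x ∈ Icc (0 : ℝ) 1, x ^ β * |((Dx ^ k) u : ℝ × ℝ → ℝ) (t, x)| ≤ C * A := by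
  induction k generalizing a with
  | zero => exact ⟨1, zero_le_one, fun u t A _ h x hx => by rw [one_mul]; exact h x hx⟩
  | succ k ih =>
    obtain ⟨C, hC, h⟩ := ih (a := a + 1) (by linarith) (by linarith)
    have hab : 0 < a - β := sub_pos.2 hβ
    refine ⟨C * (a - β)⁻¹, by positivity, fun u t A ht hu x hx => ?_⟩
    rw [pow_succ, Module.End.mul_apply, mul_assoc]
    refine h (Dx u) t _ ht (fun y hy => ?_) x hx
    rw [← Module.End.mul_apply, ← Dx_mul_Lap_pow, Module.End.mul_apply, inv_mul_eq_div]
    have hA : 0 ≤ A := (mul_nonneg (Real.rpow_nonneg zero_le_one _) (abs_nonneg _)).trans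
      (hu 1 (right_mem_Icc.2 zero_le_one))
    rcases eq_or_lt_of_le hy.1 with rfl | hy0
    · rw [Real.zero_rpow hβ0.ne', zero_mul]
      positivity
    · refine rpow_mul_abs_Dx_le ha hβ _ ht (fun z hz => ?_) ⟨hy0, hy.2⟩
      rw [← Module.End.mul_apply, ← pow_succ']
      exact hu z hz

/-- The Cauchy–Schwarz inequality for `x ^ a ∂ₓ u = ∫₀ˣ y ^ (a - 1) Λ_a u dy`. -/
theorem rpow_mul_abs_Dx_le_sqrt_integral {a : ℝ} (ha : 1 ≤ a) (u : Smooth T) {t : ℝ}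
    (ht : t ∈ Icc 0 T) {x : ℝ} (hx : x ∈ Ioc (0 : ℝ) 1) :
    x ^ (a / 2) * |(Dx u : ℝ × ℝ → ℝ) (t, x)| ≤
      √(∫ y in (0 : ℝ)..1, y ^ (a - 1) * (Lap a u : ℝ × ℝ → ℝ) (t, y) ^ 2) := by
  have ha0 : 0 < a := by linarith
  have hsub : Icc 0 x ⊆ Icc (0 : ℝ) 1 := Icc_subset_Icc_right hx.2
  have hw : Continuous fun y : ℝ => y ^ (a - 1) := Real.continuous_rpow_const (by linarith)
  have hL := continuousOn_slice (Lap a u) ht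
  have h1 : ∫ y in (0 : ℝ)..x, y ^ (a - 1) * (Lap a u : ℝ × ℝ → ℝ) (t, y) =
      x ^ a * (Dx u : ℝ × ℝ → ℝ) (t, x) := by
    rw [intervalIntegral.integral_eq_sub_of_hasDerivAt_of_le hx.1.le
      ((continuousOn_rpow_mul_Dx ha0.le u ht).mono hsub)
      (fun y hy => hasDerivAt_rpow_mul_Dx a u ht ⟨hy.1, hy.2.trans_le hx.2⟩)
      ((hw.continuousOn.mul (hL.mono hsub)).intervalIntegrable_of_Icc hx.1.le),
      Real.zero_rpow ha0.ne', zero_mul, sub_zero]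
  have h2 := sq_integral_mul_le hx.1.le hw.continuousOn (hL.mono hsub)
    fun y hy => Real.rpow_nonneg hy.1 _
  rw [h1, integral_rpow (Or.inl (by linarith)), sub_add_cancel, Real.zero_rpow ha0.ne', sub_zero] at h2
  have h3 : ∫ y in (0 : ℝ)..x, y ^ (a - 1) * (Lap a u : ℝ × ℝ → ℝ) (t, y) ^ 2 ≤
      ∫ y in (0 : ℝ)..1, y ^ (a - 1) * (Lap a u : ℝ × ℝ → ℝ) (t, y) ^ 2 := by
    refine intervalIntegral.integral_mono_interval le_rfl hx.1.le hx.2 ?_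
      ((hw.continuousOn.mul (hL.pow 2)).intervalIntegrable_of_Icc zero_le_one)
    refine (ae_restrict_iff' measurableSet_Ioc).2 (Eventually.of_forall fun y hy => ?_)
    exact mul_nonneg (Real.rpow_nonneg hy.1.le _) (sq_nonneg _)
  have hxa : 0 < x ^ a := Real.rpow_pos_of_pos hx.1 _
  have hxa2 : (x ^ (a / 2)) ^ 2 = x ^ a := by
    rw [← Real.rpow_natCast, ← Real.rpow_mul hx.1.le]; congr 1; push_cast; ring
  set Q := ∫ y in (0 : ℝ)..1, y ^ (a - 1) * (Lap a u : ℝ × ℝ → ℝ) (t, y) ^ 2 with hQ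
  refine Real.le_sqrt_of_sq_le ?_
  rw [mul_pow, sq_abs, hxa2]
  have h4 : (x ^ a * (Dx u : ℝ × ℝ → ℝ) (t, x)) ^ 2 ≤ x ^ a * Q := by
    refine h2.trans (mul_le_mul (div_le_self hxa.le ha) h3 ?_ hxa.le)
    exact intervalIntegral.integral_nonneg hx.1.le fun y hy =>
      mul_nonneg (Real.rpow_nonneg hy.1 _) (sq_nonneg _)
  rw [mul_pow, pow_two (x ^ a), mul_assoc] at h4
  exact le_of_mul_le_mul_left h4 hxa

/-- Integration from `x = 1`, where the functions vanish, lowers the exponent of the weight. -/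
theorem abs_le_of_Dx_pow_bound {m : ℕ} {u : Smooth T} (hu : u ∈ vanishX T) {t A : ℝ}
    (ht : t ∈ Icc 0 T) (hA : 0 ≤ A)
    (h : ∀ x ∈ Ioc (0 : ℝ) 1, |((Dx ^ (m + 1)) u : ℝ × ℝ → ℝ) (t, x)| ≤ A * x ^ (-(m : ℝ) - 1 / 2))
    {x : ℝ} (hx : x ∈ Icc (0 : ℝ) 1) : |(u : ℝ × ℝ → ℝ) (t, x)| ≤ 2 ^ (m + 1) * A := by
  induction m generalizing A with
  | zero =>
    have h1 : (u : ℝ × ℝ → ℝ) (t, 1) = 0 :=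
      eq_zero_of_mem_vanishX hu (p := (t, 1)) (by norm_num)
    have key := abs_sub_le_of_abs_deriv_le hx.2
      ((continuousOn_slice u ht).mono (Icc_subset_Icc_left hx.1))
      (F := fun y => 2 * A * √y) (F' := fun y => A * y ^ (-(1 / 2 : ℝ)))
      (Real.continuous_sqrt.continuousOn.const_smul (2 * A))
      (fun y hy => hasDerivAt_Dx u ht ⟨hx.1.trans_lt hy.1, hy.2⟩)
      (fun y hy => by
        have hy0 : 0 < y := hx.1.trans_lt hy.1
        refine ((Real.hasDerivAt_sqrt hy0.ne').const_mul (2 * A)).congr_deriv ?_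
        rw [Real.rpow_neg hy0.le, ← Real.sqrt_eq_rpow]
        ring) fun y hy => by
        have := h y ⟨hx.1.trans_lt hy.1, hy.2.le⟩
        simpa using this
    rw [h1, zero_sub, abs_neg, Real.sqrt_one] at key
    have := Real.sqrt_nonneg x
    have h2 : 0 ≤ 2 * A * √x := by positivity
    rw [zero_add, pow_one]
    linarith
  | succ m ih =>
    have hpow : ∀ k : ℕ, (Dx ^ k) u ∈ vanishX T := by
      intro k
      induction k with
      | zero => exact hu
      | succ k ih => rw [pow_succ', Module.End.mul_apply]; exact Dx_mem_vanishX ih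
    rw [pow_succ, mul_assoc]
    refine ih (A := 2 * A) (by positivity) fun y hy => ?_
    set v := (Dx ^ (m + 1)) u with hv
    have h1 : (v : ℝ × ℝ → ℝ) (t, 1) = 0 :=
      eq_zero_of_mem_vanishX (hpow (m + 1)) (p := (t, 1)) (by norm_num)
    have hγ : (1 : ℝ) / 2 ≤ m + 1 / 2 := by linarith [(Nat.cast_nonneg m : (0 : ℝ) ≤ m)]
    have hγ0 : (0 : ℝ) < m + 1 / 2 := by linarith
    have hpos : ∀ z ∈ Icc y 1, z ≠ 0 := fun z hz => (hy.1.trans_le hz.1).ne'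
    have key := abs_sub_le_of_abs_deriv_le hy.2
      ((continuousOn_slice v ht).mono (Icc_subset_Icc_left hy.1.le))
      (F := fun z => -(A / (m + 1 / 2)) * z ^ (-(m : ℝ) - 1 / 2))
      (F' := fun z => A * z ^ (-((m + 1 : ℕ) : ℝ) - 1 / 2))
      (ContinuousOn.mul continuousOn_const fun z hz =>
        (Real.continuousAt_rpow_const z _ (Or.inl (hpos z hz))).continuousWithinAt)
      (fun z hz => hasDerivAt_Dx v ht ⟨hy.1.trans hz.1, hz.2⟩)
      (fun z hz => by
        refine ((Real.hasDerivAt_rpow_const (Or.inl (hpos z (Ioo_subset_Icc_self hz)))).const_mul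
          _).congr_deriv ?_
        rw [show -((m + 1 : ℕ) : ℝ) - 1 / 2 = -(m : ℝ) - 1 / 2 - 1 by push_cast; ring]
        field_simp
        ring) fun z hz => by
        have := h z ⟨hy.1.trans hz.1, hz.2.le⟩
        rwa [pow_succ', Module.End.mul_apply, ← hv] at this
    rw [h1, zero_sub, abs_neg, Real.one_rpow] at key
    have h2 : A / (m + 1 / 2) ≤ 2 * A := by
      rw [div_le_iff₀ hγ0]
      nlinarith
    have h3 : 0 ≤ y ^ (-(m : ℝ) - 1 / 2) := Real.rpow_nonneg hy.1.le _
    have h4 : 0 ≤ A / (m + 1 / 2) := by positivity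
    have h5 := mul_le_mul_of_nonneg_right h2 h3
    linarith

/-- The values of a function in `vanishX T` are controlled by a weighted `L²` norm. -/
theorem exists_sq_le_integral_Lap_pow {a : ℝ} (ha : 1 ≤ a) {m : ℕ} (hm : a / 2 ≤ m + 1 / 2)
    (hm' : (m : ℝ) + 1 / 2 < a + 1) : ∃ C : ℝ, 0 ≤ C ∧ ∀ u ∈ vanishX T, ∀ t ∈ Icc 0 T,
      ∀ x ∈ Icc (0 : ℝ) 1, (u : ℝ × ℝ → ℝ) (t, x) ^ 2 ≤
        C * ∫ y in (0 : ℝ)..1, y ^ (a - 1) * ((Lap a ^ (m + 1)) u : ℝ × ℝ → ℝ) (t, y) ^ 2 := by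
  have hβ0 : (0 : ℝ) < m + 1 / 2 := by positivity
  obtain ⟨C, hC, h⟩ := exists_rpow_mul_abs_Dx_pow_le (T := T) m (a := a + 1) (by linarith) hβ0 hm'
  refine ⟨(2 ^ (m + 1) * C) ^ 2, by positivity, fun u hu t ht x hx => ?_⟩
  set Q := ∫ y in (0 : ℝ)..1, y ^ (a - 1) * ((Lap a ^ (m + 1)) u : ℝ × ℝ → ℝ) (t, y) ^ 2 with hQ
  have hQ0 : 0 ≤ Q := intervalIntegral.integral_nonneg zero_le_one fun y hy =>
    mul_nonneg (Real.rpow_nonneg hy.1 _) (sq_nonneg _)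
  -- The weighted `L²` norm bounds `Λ_{a+1} ^ m ∂ₓ u = ∂ₓ Λ_a ^ m u`, with the weight `y ^ (m + 1/2)`.
  have h1 : ∀ y ∈ Icc (0 : ℝ) 1,
      y ^ ((m : ℝ) + 1 / 2) * |((Lap (a + 1) ^ m) (Dx u) : ℝ × ℝ → ℝ) (t, y)| ≤ √Q := by
    intro y hy
    rw [← Module.End.mul_apply, ← Dx_mul_Lap_pow, Module.End.mul_apply]
    rcases eq_or_lt_of_le hy.1 with rfl | hy0
    · rw [Real.zero_rpow hβ0.ne', zero_mul]
      exact Real.sqrt_nonneg _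
    · have e := rpow_mul_abs_Dx_le_sqrt_integral ha ((Lap a ^ m) u) ht ⟨hy0, hy.2⟩
      rw [← Module.End.mul_apply (Lap a) (Lap a ^ m), ← pow_succ', ← hQ] at e
      refine le_trans (mul_le_mul_of_nonneg_right ?_ (abs_nonneg _)) e
      exact Real.rpow_le_rpow_of_exponent_ge hy0 hy.2 hm
  have h2 := h (Dx u) t _ ht h1
  have h3 := abs_le_of_Dx_pow_bound hu ht (A := C * √Q) (by positivity) (m := m) (fun y hy => by
    have e := h2 y ⟨hy.1.le, hy.2⟩
    rw [← Module.End.mul_apply, ← pow_succ] at e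
    have hp : 0 < y ^ ((m : ℝ) + 1 / 2) := Real.rpow_pos_of_pos hy.1 _
    rw [show -(m : ℝ) - 1 / 2 = -((m : ℝ) + 1 / 2) by ring, Real.rpow_neg hy.1.le, ← div_eq_mul_inv,
      le_div_iff₀ hp, mul_comm]
    exact e) hx
  calc (u : ℝ × ℝ → ℝ) (t, x) ^ 2 = |(u : ℝ × ℝ → ℝ) (t, x)| ^ 2 := (sq_abs _).symm
    _ ≤ (2 ^ (m + 1) * (C * √Q)) ^ 2 := pow_le_pow_left₀ (abs_nonneg _) h3 2
    _ = (2 ^ (m + 1) * C) ^ 2 * Q := by rw [← mul_assoc, mul_pow, Real.sq_sqrt hQ0]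

end Weighted

/-! ### The grading by weighted `L²` norms -/

/-- The seminorm `u ↦ √(B u u)` of a positive semidefinite symmetric bilinear form. -/
def formSeminorm {V : Type*} [AddCommGroup V] [Module ℝ V] (B : LinearMap.BilinForm ℝ V)
    (hs : ∀ u v, B u v = B v u) (hp : ∀ u, 0 ≤ B u u) : Seminorm ℝ V :=
  Seminorm.of (fun u => √(B u u))
    (fun u v => by
      refine Real.sqrt_le_iff.2 ⟨by positivity, ?_⟩
      have h1 : B u v ≤ √(B u u) * √(B v v) := by
        rw [← Real.sqrt_mul (hp u)]
        exact Real.le_sqrt_of_sq_le (B.apply_sq_le_of_symm hp ⟨hs⟩ u v)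
      have h2 : B v u = B u v := hs v u
      have h3 := Real.sq_sqrt (hp u)
      have h4 := Real.sq_sqrt (hp v)
      simp only [map_add, LinearMap.add_apply]
      nlinarith)
    (fun c u => by
      simp only [map_smul, LinearMap.smul_apply, smul_eq_mul]
      rw [← mul_assoc, Real.sqrt_mul (mul_self_nonneg c), Real.sqrt_mul_self_eq_abs, Real.norm_eq_abs])

section L2

variable {T : ℝ}

theorem integrableOn_weight {a : ℝ} (ha : 1 ≤ a) (u v : Smooth T) : IntegrableOn
    (fun p : ℝ × ℝ => p.2 ^ (a - 1) * ((u : ℝ × ℝ → ℝ) p * (v : ℝ × ℝ → ℝ) p)) (rect T) :=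
  ContinuousOn.integrableOn_compact isCompact_rect
    (((Real.continuous_rpow_const (by linarith)).comp continuous_snd).continuousOn.mul
      (u.2.1.continuousOn.mul v.2.1.continuousOn))

/-- The inner product of `L²(rect T, x ^ (a - 1) dt dx)` on smooth functions. -/
def l2Form {a : ℝ} (ha : 1 ≤ a) : LinearMap.BilinForm ℝ (Smooth T) :=
  LinearMap.mk₂ ℝ (fun u v => ∫ p in rect T, p.2 ^ (a - 1) * ((u : ℝ × ℝ → ℝ) p * (v : ℝ × ℝ → ℝ) p))
    (fun u u' v => by
      rw [← integral_add (integrableOn_weight ha u v) (integrableOn_weight ha u' v)]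
      refine integral_congr_ae (Eventually.of_forall fun p => ?_)
      simp only [Submodule.coe_add, Pi.add_apply]
      ring)
    (fun c u v => by
      rw [smul_eq_mul, ← integral_const_mul]
      refine integral_congr_ae (Eventually.of_forall fun p => ?_)
      simp only [Submodule.coe_smul, Pi.smul_apply, smul_eq_mul]
      ring)
    (fun u v v' => by
      rw [← integral_add (integrableOn_weight ha u v) (integrableOn_weight ha u v')]
      refine integral_congr_ae (Eventually.of_forall fun p => ?_)
      simp only [Submodule.coe_add, Pi.add_apply]
      ring)
    (fun c u v => by
      rw [smul_eq_mul, ← integral_const_mul]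
      refine integral_congr_ae (Eventually.of_forall fun p => ?_)
      simp only [Submodule.coe_smul, Pi.smul_apply, smul_eq_mul]
      ring)

theorem l2Form_apply {a : ℝ} (ha : 1 ≤ a) (u v : Smooth T) : l2Form ha u v =
    ∫ p in rect T, p.2 ^ (a - 1) * ((u : ℝ × ℝ → ℝ) p * (v : ℝ × ℝ → ℝ) p) := rfl

theorem l2Form_symm {a : ℝ} (ha : 1 ≤ a) (u v : Smooth T) : l2Form ha u v = l2Form ha v u := by
  simp only [l2Form_apply, mul_comm ((u : ℝ × ℝ → ℝ) _)]

theorem l2Form_nonneg {a : ℝ} (ha : 1 ≤ a) (u : Smooth T) : 0 ≤ l2Form ha u u :=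
  setIntegral_nonneg isCompact_rect.measurableSet fun _ hp =>
    mul_nonneg (Real.rpow_nonneg hp.2.1 _) (mul_self_nonneg _)

variable [hT : Fact (0 < T)]

theorem l2Form_self {a : ℝ} (ha : 1 ≤ a) (u : Smooth T) : l2Form ha u u =
    ∫ t in (0 : ℝ)..T, ∫ x in (0 : ℝ)..1, x ^ (a - 1) * (u : ℝ × ℝ → ℝ) (t, x) ^ 2 := by
  rw [l2Form_apply, rect, Measure.volume_eq_prod,
    setIntegral_prod _ (by rw [← Measure.volume_eq_prod]; exact integrableOn_weight ha u u),
    intervalIntegral.integral_of_le hT.out.le, integral_Icc_eq_integral_Ioc]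
  refine integral_congr_ae (Eventually.of_forall fun t => ?_)
  simp only [intervalIntegral.integral_of_le zero_le_one, integral_Icc_eq_integral_Ioc, pow_two]

theorem intervalIntegrable_l2 {a : ℝ} (ha : 1 ≤ a) (u : Smooth T) : IntervalIntegrable
    (fun t => ∫ x in (0 : ℝ)..1, x ^ (a - 1) * (u : ℝ × ℝ → ℝ) (t, x) ^ 2) volume 0 T := by
  have h := integrableOn_weight ha u u
  rw [rect, IntegrableOn, Measure.volume_eq_prod, ← Measure.prod_restrict] at h
  rw [intervalIntegrable_iff_integrableOn_Icc_of_le hT.out.le]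
  refine h.integral_prod_left.congr (Eventually.of_forall fun t => ?_)
  simp only [intervalIntegral.integral_of_le zero_le_one, integral_Icc_eq_integral_Ioc, pow_two]

/-- The sum over `j + k ≤ n` of the forms of `Op a j k u`. -/
def l2Sum {a : ℝ} (ha : 1 ≤ a) (n : ℕ) : LinearMap.BilinForm ℝ (Smooth T) :=
  ∑ i ∈ indices n, (l2Form ha).compl₁₂ (Op a i.1 i.2) (Op a i.1 i.2)

theorem l2Sum_apply {a : ℝ} (ha : 1 ≤ a) (n : ℕ) (u v : Smooth T) : l2Sum ha n u v =
    ∑ i ∈ indices n, l2Form ha (Op a i.1 i.2 u) (Op a i.1 i.2 v) := by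
  simp [l2Sum, LinearMap.sum_apply]

/-- The grading by the `L²` norms with weight `x ^ (a - 1)` of `Op a j k u`, `j + k ≤ n`. -/
def l2G {a : ℝ} (ha : 1 ≤ a) (n : ℕ) : Seminorm ℝ (Smooth T) :=
  formSeminorm (l2Sum ha n)
    (fun u v => by simp only [l2Sum_apply, l2Form_symm ha (Op a _ _ u)])
    fun u => by
      rw [l2Sum_apply]
      exact Finset.sum_nonneg fun i _ => l2Form_nonneg ha _

theorem l2G_apply {a : ℝ} (ha : 1 ≤ a) (n : ℕ) (u : Smooth T) :
    l2G ha n u = √(∑ i ∈ indices n, l2Form ha (Op a i.1 i.2 u) (Op a i.1 i.2 u)) :=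
  congrArg Real.sqrt (l2Sum_apply ha n u u)

theorem l2G_mono {a : ℝ} (ha : 1 ≤ a) {m n : ℕ} (h : m ≤ n) (u : Smooth T) :
    l2G ha m u ≤ l2G ha n u := by
  rw [l2G_apply, l2G_apply]
  exact Real.sqrt_le_sqrt (Finset.sum_le_sum_of_subset_of_nonneg (indices_mono h)
    fun i _ _ => l2Form_nonneg ha _)

theorem l2Form_Op_le {a : ℝ} (ha : 1 ≤ a) {n j k : ℕ} (h : j + k ≤ n) (u : Smooth T) :
    l2Form ha (Op a j k u) (Op a j k u) ≤ l2G ha n u ^ 2 := by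
  rw [l2G_apply, Real.sq_sqrt (Finset.sum_nonneg fun i _ => l2Form_nonneg ha _)]
  exact Finset.single_le_sum (f := fun i : ℕ × ℕ => l2Form ha (Op a i.1 i.2 u) (Op a i.1 i.2 u))
    (fun i _ => l2Form_nonneg ha _) (mem_indices.2 h : (j, k) ∈ indices n)

theorem exists_l2G_le_supG {a : ℝ} (ha : 1 ≤ a) (n : ℕ) :
    ∃ C : ℝ, 0 ≤ C ∧ ∀ u : Smooth T, l2G ha n u ≤ C * supG a n u := by
  refine ⟨√((indices n).card * volume.real (rect T)), Real.sqrt_nonneg _, fun u => ?_⟩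
  have hP : 0 ≤ supG a n u := apply_nonneg _ _
  rw [l2G_apply]
  conv_rhs => rw [← Real.sqrt_sq hP, ← Real.sqrt_mul (by positivity)]
  refine Real.sqrt_le_sqrt ?_
  have hterm : ∀ i ∈ indices n, l2Form ha (Op a i.1 i.2 u) (Op a i.1 i.2 u) ≤
      supG a n u ^ 2 * volume.real (rect T) := by
    intro i hi
    rw [l2Form_apply]
    refine (Real.le_norm_self _).trans (norm_setIntegral_le_of_norm_le_const
      isCompact_rect.measure_lt_top fun p hp => ?_)
    rw [Real.norm_eq_abs, abs_mul, abs_mul_self, abs_of_nonneg (Real.rpow_nonneg hp.2.1 _), ← pow_two]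
    have h1 : p.2 ^ (a - 1) ≤ 1 := Real.rpow_le_one hp.2.1 hp.2.2 (by linarith)
    refine (mul_le_of_le_one_left (sq_nonneg _) h1).trans ?_
    rw [← sq_abs]
    exact pow_le_pow_left₀ (abs_nonneg _)
      ((abs_apply_le _ hp).trans (supN_Op_le_supG a (mem_indices.1 hi) u)) 2
  refine (Finset.sum_le_card_nsmul _ _ _ hterm).trans (le_of_eq ?_)
  rw [nsmul_eq_mul]
  ring

theorem Dt_pow_mem_vanishX (k : ℕ) {u : Smooth T} (hu : u ∈ vanishX T) : (Dt ^ k) u ∈ vanishX T := by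
  induction k with
  | zero => exact hu
  | succ k ih => rw [pow_succ', Module.End.mul_apply]; exact Dt_mem_vanishX ih

/-- The Sobolev inequality: on `vanishX T` the supremum norms are controlled by weighted `L²`
norms, with a loss of finitely many degrees. -/
theorem exists_supG_le_l2G {a : ℝ} (ha : 1 ≤ a) : ∃ r : ℕ, ∀ n : ℕ, ∃ C : ℝ, 0 ≤ C ∧
    ∀ u ∈ vanishX T, supG a n u ≤ C * l2G ha (n + r) u := by
  -- The exponent `m + 1/2` of the weight has to lie in `[a/2, a + 1)`.
  set m := ⌈a / 2 - 1 / 2⌉₊ with hm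
  have hm1 : a / 2 ≤ m + 1 / 2 := by linarith [Nat.le_ceil (a / 2 - 1 / 2)]
  have hm2 : (m : ℝ) + 1 / 2 < a + 1 := by
    linarith [Nat.ceil_lt_add_one (show 0 ≤ a / 2 - 1 / 2 by linarith)]
  obtain ⟨C₁, hC₁, h₁⟩ := exists_sq_le_integral hT.out
  obtain ⟨C₂, hC₂, h₂⟩ := exists_sq_le_integral_Lap_pow (T := T) ha hm1 hm2
  refine ⟨m + 2, fun n => ⟨√(C₁ * (2 * C₂)), Real.sqrt_nonneg _, fun u hu => ?_⟩⟩
  set Q := l2G ha (n + (m + 2)) u with hQ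
  have hQ0 : 0 ≤ Q := apply_nonneg _ _
  refine supG_le (by positivity) fun j k hjk => supN_le fun p hp => ?_
  have hint : ∀ v ∈ vanishX T, l2Form ha ((Lap a ^ (m + 1)) v) ((Lap a ^ (m + 1)) v) ≤ Q ^ 2 →
      ∫ s in (0 : ℝ)..T, (v : ℝ × ℝ → ℝ) (s, p.2) ^ 2 ≤ C₂ * Q ^ 2 := by
    intro v hv hle
    refine le_trans ?_ (mul_le_mul_of_nonneg_left hle hC₂)
    rw [l2Form_self, ← intervalIntegral.integral_const_mul]
    have hc : ContinuousOn (fun s => (v : ℝ × ℝ → ℝ) (s, p.2)) (Icc 0 T) := fun s hs =>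
      (hasDerivWithinAt_Dt v (p := (s, p.2)) ⟨hs, hp.2⟩).continuousWithinAt
    exact intervalIntegral.integral_mono_on hT.out.le
      ((hc.pow 2).intervalIntegrable_of_Icc hT.out.le) ((intervalIntegrable_l2 ha _).const_mul _)
      fun s hs => h₂ v hv s hs p.2 hp.2
  have hv : Op a j k u ∈ vanishX T := Dt_pow_mem_vanishX _ (Lap_pow_mem_vanishX a k hu)
  have hLap : ∀ j, (Lap a ^ (m + 1)) (Op a j k u) = Op a j (m + 1 + k) u := fun j => by
    rw [Op, Op, ← Module.End.mul_apply, ← mul_assoc, ← ((commute_Dt_Lap a).pow_pow _ _).eq, mul_assoc,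
      ← pow_add]
  have hDt : Dt (Dt (Op a j k u)) = Op a (j + 1) k u := by
    change (Dt * Dt * (Dt ^ (2 * j) * Lap a ^ k) : Module.End ℝ (Smooth T)) u =
      (Dt ^ (2 * (j + 1)) * Lap a ^ k : Module.End ℝ (Smooth T)) u
    rw [← pow_two, ← mul_assoc, ← pow_add, show 2 + 2 * j = 2 * (j + 1) by ring]
  have e1 := hint _ hv (by rw [hLap]; exact l2Form_Op_le ha (by omega) u)
  have e2 := hint _ (Dt_mem_vanishX (Dt_mem_vanishX hv))
    (by rw [hDt, hLap]; exact l2Form_Op_le ha (by omega) u)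
  have hp' : ∀ s ∈ Icc 0 T, (s, p.2) ∈ rect T := fun s hs => ⟨hs, hp.2⟩
  have e3 := h₁ (fun s => (Op a j k u : ℝ × ℝ → ℝ) (s, p.2)) _ _
    (fun s hs => hasDerivWithinAt_Dt _ (hp' s hs))
    (fun s hs => hasDerivWithinAt_Dt (Dt (Op a j k u)) (hp' s hs))
    (fun s hs => (hasDerivWithinAt_Dt (Dt (Dt (Op a j k u))) (hp' s hs)).continuousWithinAt) p.1 hp.1
  refine (Real.abs_le_sqrt (e3.trans (mul_le_mul_of_nonneg_left (add_le_add e1 e2) hC₁))).trans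
    (le_of_eq ?_)
  rw [show C₁ * (C₂ * Q ^ 2 + C₂ * Q ^ 2) = C₁ * (2 * C₂) * Q ^ 2 by ring, Real.sqrt_mul (by positivity),
    Real.sqrt_sq hQ0]

end L2

section Transfer

variable {T : ℝ}

/-! ### Reflection in `x` -/

theorem flip_mem_rect {p : ℝ × ℝ} (hp : p ∈ rect T) : (p.1, 1 - p.2) ∈ rect T :=
  ⟨hp.1, ⟨by linarith [hp.2.2], by linarith [hp.2.1]⟩⟩

/-- The reflection `x ↦ 1 - x`. -/
def flipX : Module.End ℝ (Smooth T) where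
  toFun u := ⟨fun p => (u : ℝ × ℝ → ℝ) (p.1, 1 - p.2),
    u.2.1.comp (by fun_prop : ContDiff ℝ (⊤ : ℕ∞) fun p : ℝ × ℝ => (p.1, 1 - p.2)).contDiffOn
      fun _ hp => flip_mem_rect hp,
    fun p hp => u.2.2 _ fun h => hp (by simpa using flip_mem_rect h)⟩
  map_add' u v := rfl
  map_smul' c u := rfl

theorem flipX_apply (u : Smooth T) (p : ℝ × ℝ) :
    (flipX u : ℝ × ℝ → ℝ) p = (u : ℝ × ℝ → ℝ) (p.1, 1 - p.2) := rfl

/-- The identity for `μ = 0`, and the reflection `x ↦ 1 - x` for `μ = 1`. -/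
def side : Fin 2 → Module.End ℝ (Smooth T)
  | 0 => 1
  | 1 => flipX

theorem neg_smul_smooth (c : ℝ) (u : Smooth T) : -(c • u) = (-1 * c) • u :=
  Smooth.ext fun p _ => by
    change -(c * (u : ℝ × ℝ → ℝ) p) = -1 * c * (u : ℝ × ℝ → ℝ) p
    ring

theorem side_side (μ : Fin 2) (u : Smooth T) : side μ (side μ u) = u := by
  match μ with
  | 0 => rfl
  | 1 => ext p; simp [side, flipX_apply]

/-- An element of `𝔈_[μ]` as a smooth function on the rectangle. -/
def incl (μ : Fin 2) : E T μ →ₗ[ℝ] Smooth T where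
  toFun u := ⟨u.toFun, u.2.1, u.2.2.1⟩
  map_add' _ _ := rfl
  map_smul' _ _ := rfl

theorem E.ext {μ : Fin 2} {u v : E T μ} (h : u.toFun = v.toFun) : u = v := Subtype.ext h

theorem side_incl_mem (μ : Fin 2) (u : E T μ) : side μ (incl μ u) ∈ vanishX T := by
  intro p hp h
  match μ with
  | 0 => exact u.2.2.2 p hp ⟨h, hp.2.2⟩
  | 1 => exact u.2.2.2 _ (flip_mem_rect hp) ⟨(flip_mem_rect hp).2.1, by simp only []; linarith⟩

theorem side_mem_smoothSubmodule (μ : Fin 2) (v : vanishX T) :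
    (side μ v.1 : ℝ × ℝ → ℝ) ∈ smoothSubmodule T μ := by
  refine ⟨(side μ v.1).2.1, (side μ v.1).2.2, fun p hp h => ?_⟩
  match μ with
  | 0 => exact v.2 p hp h.1
  | 1 => exact v.2 _ (flip_mem_rect hp) (by simp only []; linarith [h.2])

/-- The space `𝔈_[μ]` is identified with `vanishX T`, for `μ = 1` by the reflection `x ↦ 1 - x`. -/
def toVanish (μ : Fin 2) : E T μ ≃ₗ[ℝ] vanishX T where
  toFun u := ⟨side μ (incl μ u), side_incl_mem μ u⟩
  map_add' u v := Subtype.ext (by simp)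
  map_smul' c u := Subtype.ext (by simp)
  invFun v := (⟨side μ v.1, side_mem_smoothSubmodule μ v⟩ : smoothSubmodule T μ)
  left_inv u := E.ext (congrArg (fun w : Smooth T => (w : ℝ × ℝ → ℝ)) (side_side μ (incl μ u)))
  right_inv v := Subtype.ext (side_side μ v.1)

theorem toVanish_val (μ : Fin 2) (u : E T μ) : (toVanish μ u).1 = side μ (incl μ u) := rfl

variable [hT : Fact (0 < T)]

theorem Dt_flipX (u : Smooth T) : Dt (flipX u) = flipX (Dt u) :=
  Smooth.ext fun _ hp => Dt_eq_of_hasDerivWithinAt hp (hasDerivWithinAt_Dt u (flip_mem_rect hp))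

theorem Dx_flipX (u : Smooth T) : Dx (flipX u) = -flipX (Dx u) := by
  refine Smooth.ext fun p hp => ?_
  have h1 : HasDerivWithinAt (fun s : ℝ => 1 - s) (-1) (Icc 0 1) p.2 := by
    simpa using (hasDerivWithinAt_id p.2 (Icc 0 1)).const_sub 1
  have h2 := HasDerivWithinAt.comp (h := fun s : ℝ => 1 - s) p.2
    (hasDerivWithinAt_Dx u (flip_mem_rect hp)) h1
    fun s hs => ⟨by linarith [hs.2], by linarith [hs.1]⟩
  refine (Dx_eq_of_hasDerivWithinAt (u := flipX u) hp h2).trans ?_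
  simp [flipX_apply]

theorem Dt_pow_side (μ : Fin 2) (j : ℕ) (u : Smooth T) : (Dt ^ j) (side μ u) = side μ ((Dt ^ j) u) := by
  match μ with
  | 0 => rfl
  | 1 =>
    induction j generalizing u with
    | zero => rfl
    | succ j ih =>
      rw [pow_succ, Module.End.mul_apply, Module.End.mul_apply, ← ih]
      exact congrArg _ (Dt_flipX u)

theorem supN_side (μ : Fin 2) (u : Smooth T) : supN (side μ u) = supN u := by
  have h : ∀ u : Smooth T, supN (side μ u) ≤ supN u := fun u => supN_le fun p hp => by
    match μ with
    | 0 => exact abs_apply_le u hp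
    | 1 => exact abs_apply_le u (flip_mem_rect hp)
  exact le_antisymm (h u) (by simpa only [side_side] using h (side μ u))

theorem derivN_side (μ : Fin 2) (i : ℕ × ℕ) (u : Smooth T) : derivN i (side μ u) = derivN i u := by
  have h : ∀ (k : ℕ) (u : Smooth T), ∃ c : ℝ, |c| = 1 ∧ (Dx ^ k) (side μ u) = c • side μ ((Dx ^ k) u) := by
    match μ with
    | 0 => exact fun k u => ⟨1, abs_one, (one_smul _ _).symm⟩
    | 1 =>
      intro k
      induction k with
      | zero => exact fun u => ⟨1, abs_one, (one_smul _ _).symm⟩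
      | succ k ih =>
        intro u
        obtain ⟨c, hc, e⟩ := ih (Dx u)
        refine ⟨-1 * c, by rw [abs_mul, hc]; simp, ?_⟩
        have e1 : Dx (side 1 u) = -side 1 (Dx u) := Dx_flipX u
        rw [pow_succ, Module.End.mul_apply, Module.End.mul_apply, e1, map_neg, e, neg_smul_smooth]
  obtain ⟨c, hc, e⟩ := h i.2 u
  change supN ((Dt ^ i.1) ((Dx ^ i.2) (side μ u))) = supN ((Dt ^ i.1) ((Dx ^ i.2) u))
  rw [e, map_smul, Dt_pow_side, map_smul_eq_mul, Real.norm_eq_abs, hc, one_mul, supN_side]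

/-! ### The two gradings on `𝔈_[μ]` -/

/-- The exponent `a` for which `Λ_a` is the operator of index `μ`. -/
def expo (N : ℝ) : Fin 2 → ℝ
  | 0 => 5 / 2
  | 1 => N / 2

theorem dx_eqOn {f : ℝ × ℝ → ℝ} {w : Smooth T} (h : EqOn f w (rect T)) : EqOn (dx f) (Dx w) (rect T) :=
  fun _ hp => (dx_congr h hp).trans (Dx_apply w hp).symm

theorem dt_eqOn {f : ℝ × ℝ → ℝ} {w : Smooth T} (h : EqOn f w (rect T)) : EqOn (dt T f) (Dt w) (rect T) :=
  fun _ hp => (dt_congr h hp).trans (Dt_apply w hp).symm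

theorem negLap_eqOn (N : ℝ) (μ : Fin 2) {f : ℝ × ℝ → ℝ} {w : Smooth T} (h : EqOn f w (rect T)) :
    EqOn (negLap N μ f) (-side μ (Lap (expo N μ) (side μ w)) : Smooth T) (rect T) := by
  intro p hp
  match μ with
  | 0 =>
    change -(p.2 * dx (dx f) p + 5 / 2 * dx f p) = -((Lap (5 / 2) w : ℝ × ℝ → ℝ) p)
    rw [Lap_apply, dx_eqOn h hp, dx_eqOn (dx_eqOn h) hp]
  | 1 =>
    have h1 : EqOn (dX f) (-Dx w : Smooth T) (rect T) := fun q hq => congrArg Neg.neg (dx_eqOn h hq)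
    have h2 : EqOn (dX (dX f)) (Dx (Dx w)) (rect T) := fun q hq => by
      have e := dx_eqOn h1 hq
      change -(dx (dX f) q) = _
      rw [e, map_neg]
      simp
    change -((1 - p.2) * dX (dX f) p + N / 2 * dX f p) =
      -((Lap (N / 2) (flipX w) : ℝ × ℝ → ℝ) (p.1, 1 - p.2))
    rw [Lap_apply, Dx_flipX, map_neg, Dx_flipX, neg_neg, h1 hp, h2 hp]
    simp [flipX_apply]

theorem negDtt_eqOn {f : ℝ × ℝ → ℝ} {w : Smooth T} (h : EqOn f w (rect T)) :
    EqOn (negDtt T f) (-Dt (Dt w) : Smooth T) (rect T) := fun _ hp =>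
  congrArg Neg.neg (dt_eqOn (dt_eqOn h) hp)

theorem powOp_eqOn (N : ℝ) (μ : Fin 2) (j k : ℕ) (u : E T μ) : EqOn (powOp T N μ j k u.toFun)
    ((-1 : ℝ) ^ (j + k) • side μ (Op (expo N μ) j k (toVanish μ u).1) : Smooth T) (rect T) := by
  have h1 : ∀ k : ℕ, EqOn ((negLap N μ)^[k] u.toFun)
      ((-1 : ℝ) ^ k • side μ ((Lap (expo N μ) ^ k) (toVanish μ u).1) : Smooth T) (rect T) := by
    intro k
    induction k with
    | zero =>
      intro p _
      rw [pow_zero, pow_zero, one_smul, Module.End.one_apply, toVanish_val, side_side]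
      rfl
    | succ k ih =>
      rw [Function.iterate_succ_apply']
      have h := negLap_eqOn N μ ih
      rwa [map_smul, map_smul, map_smul, side_side, ← Module.End.mul_apply (Lap _) (Lap _ ^ k), ← pow_succ',
        neg_smul_smooth, ← pow_succ'] at h
  have h2 : ∀ j : ℕ, EqOn ((negDtt T)^[j] ((negLap N μ)^[k] u.toFun))
      ((-1 : ℝ) ^ (j + k) • (Dt ^ (2 * j)) (side μ ((Lap (expo N μ) ^ k) (toVanish μ u).1)) : Smooth T)
      (rect T) := by
    intro j
    induction j with
    | zero => simpa using h1 k
    | succ j ih =>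
      rw [Function.iterate_succ_apply']
      have h := negDtt_eqOn ih
      rwa [map_smul, map_smul, ← Module.End.mul_apply Dt (Dt ^ (2 * j)), ← pow_succ',
        ← Module.End.mul_apply Dt (Dt ^ (2 * j + 1)), ← pow_succ',
        neg_smul_smooth, ← pow_succ', show j + k + 1 = j + 1 + k by ring,
        show 2 * j + 1 + 1 = 2 * (j + 1) by ring] at h
  have h := h2 j
  rwa [Dt_pow_side] at h

theorem sq_powOp (N : ℝ) (μ : Fin 2) (j k : ℕ) (u : E T μ) {p : ℝ × ℝ} (hp : p ∈ rect T) :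
    |powOp T N μ j k u.toFun p| = |(side μ (Op (expo N μ) j k (toVanish μ u).1) : ℝ × ℝ → ℝ) p| := by
  rw [powOp_eqOn N μ j k u hp]
  simp [abs_mul]

/-- The supremum grading of index `μ` is the one of `Λ_a` on `vanishX T`, with `a = expo N μ`. -/
theorem supGrading_eq (N : ℝ) (μ : Fin 2) (n : ℕ) (u : E T μ) :
    supGrading T N μ n u = supG (expo N μ) n (toVanish μ u).1 := by
  have e : ∀ j k, linfNorm T (powOp T N μ j k u.toFun) = supN (Op (expo N μ) j k (toVanish μ u).1) := by
    intro j k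
    rw [← supN_side μ, supN_eq, linfNorm, linfNorm]
    exact congrArg _ (funext fun p => sq_powOp N μ j k u p.2)
  have hne : Nonempty (indices n) := ⟨⟨(0, 0), mem_indices.2 (Nat.zero_le n)⟩⟩
  simp only [supGrading, e]
  refine le_antisymm (ciSup_le fun i => supN_Op_le_supG _ (mem_indices.1 i.2) _) (supG_le ?_ ?_)
  · exact Real.iSup_nonneg fun i => apply_nonneg _ _
  · intro j k h
    exact le_ciSup (f := fun i : indices n => supN (Op (expo N μ) i.1.1 i.1.2 (toVanish μ u).1))
      (finite_range _).bddAbove ⟨(j, k), mem_indices.2 h⟩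

theorem one_le_expo {N : ℝ} (hN : 4 < N) (μ : Fin 2) : 1 ≤ expo N μ := by
  match μ with
  | 0 => norm_num [expo]
  | 1 => simp only [expo]; linarith

theorem sq_weightedNorm_powOp (N : ℝ) (μ : Fin 2) (j k : ℕ) (u : E T μ) {t : ℝ} (ht : t ∈ Icc 0 T) :
    weightedNorm N μ (fun x => powOp T N μ j k u.toFun (t, x)) ^ 2 = ∫ x in (0 : ℝ)..1,
      x ^ (expo N μ - 1) * (Op (expo N μ) j k (toVanish μ u).1 : ℝ × ℝ → ℝ) (t, x) ^ 2 := by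
  set w := Op (expo N μ) j k (toVanish μ u).1 with hw
  have h0 : ∀ x ∈ Icc (0 : ℝ) 1, 0 ≤ weight N μ x := fun x hx => by
    match μ with
    | 0 => exact Real.rpow_nonneg hx.1 _
    | 1 => exact Real.rpow_nonneg (by linarith [hx.2]) _
  rw [weightedNorm, Real.sq_sqrt (intervalIntegral.integral_nonneg zero_le_one fun x hx =>
    mul_nonneg (sq_nonneg _) (h0 x hx))]
  have e1 : ∫ x in (0 : ℝ)..1, |powOp T N μ j k u.toFun (t, x)| ^ 2 * weight N μ x =
      ∫ x in (0 : ℝ)..1, weight N μ x * (side μ w : ℝ × ℝ → ℝ) (t, x) ^ 2 := by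
    refine intervalIntegral.integral_congr fun x hx => ?_
    rw [uIcc_of_le zero_le_one] at hx
    rw [sq_powOp N μ j k u (p := (t, x)) ⟨ht, hx⟩, sq_abs, mul_comm]
  rw [e1]
  match μ with
  | 0 =>
    refine intervalIntegral.integral_congr fun x _ => ?_
    change x ^ (3 / 2 : ℝ) * (w : ℝ × ℝ → ℝ) (t, x) ^ 2 = x ^ (5 / 2 - 1 : ℝ) * (w : ℝ × ℝ → ℝ) (t, x) ^ 2
    norm_num
  | 1 =>
    have h := intervalIntegral.integral_comp_sub_left (a := 0) (b := 1)
      (fun x : ℝ => x ^ (N / 2 - 1) * (w : ℝ × ℝ → ℝ) (t, x) ^ 2) 1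
    rw [sub_self, sub_zero] at h
    exact h

/-- The `L²` grading of index `μ` is the one of `Λ_a` on `vanishX T`, with `a = expo N μ`. -/
theorem l2Grading_eq {N : ℝ} (hN : 4 < N) (μ : Fin 2) (n : ℕ) (u : E T μ) :
    l2Grading T N μ n u = l2G (one_le_expo hN μ) n (toVanish μ u).1 := by
  rw [l2Grading, l2G_apply]
  congr 1
  refine Finset.sum_congr rfl fun i _ => ?_
  rw [l2Form_self]
  refine intervalIntegral.integral_congr fun t ht => ?_
  rw [uIcc_of_le hT.out.le] at ht
  exact sq_weightedNorm_powOp N μ i.1 i.2 u ht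

/-! ### The topology of `𝔈_[μ]` -/

/-- The seminorms `sup |∂_t ^ j ∂ₓ ^ k u|` on `𝔈_[μ]`. -/
def derivFamily (μ : Fin 2) : SeminormFamily ℝ (E T μ) (ℕ × ℕ) := fun i =>
  (derivN i).comp (incl μ)

theorem iterate_eqOn (μ : Fin 2) (i : ℕ × ℕ) (u : E T μ) :
    EqOn ((dt T)^[i.1] (dx^[i.2] u.toFun)) (derivOp i (incl μ u)) (rect T) := by
  have h1 : ∀ k : ℕ, EqOn (dx^[k] u.toFun) ((Dx ^ k) (incl μ u)) (rect T) := by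
    intro k
    induction k with
    | zero => exact fun p _ => rfl
    | succ k ih =>
      rw [Function.iterate_succ_apply', pow_succ', Module.End.mul_apply]
      exact dx_eqOn ih
  have h2 : ∀ j : ℕ, EqOn ((dt T)^[j] (dx^[i.2] u.toFun)) ((Dt ^ j) ((Dx ^ i.2) (incl μ u))) (rect T) := by
    intro j
    induction j with
    | zero => exact h1 i.2
    | succ j ih =>
      rw [Function.iterate_succ_apply', pow_succ' Dt, Module.End.mul_apply]
      exact dt_eqOn ih
  exact h2 i.1

/-- The derivatives of an element of `𝔈_[μ]`, as functions on the rectangle with the uniform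
structure of uniform convergence. -/
def derivMap (μ : Fin 2) : E T μ →+ (ℕ × ℕ → UniformFun (rect T) ℝ) where
  toFun u i := UniformFun.ofFun fun p => (derivOp i (incl μ u) : ℝ × ℝ → ℝ) p
  map_zero' := by funext i; simp; rfl
  map_add' u v := by funext i; simp; rfl

/-- The topology of `𝔈_[μ]` is that of uniform convergence of all derivatives. -/
theorem isInducing_derivMap (μ : Fin 2) : IsInducing (derivMap (T := T) μ) := by
  have e : (fun (u : E T μ) (i : ℕ × ℕ) =>
      UniformFun.ofFun fun p : rect T => (dt T)^[i.1] (dx^[i.2] u.toFun) (p : ℝ × ℝ)) = derivMap μ := by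
    funext u i
    exact congrArg UniformFun.ofFun (funext fun p => iterate_eqOn μ i u p.2)
  refine ⟨?_⟩
  rw [← e]
  rfl

theorem withSeminorms_derivFamily (μ : Fin 2) : WithSeminorms (derivFamily (T := T) μ) := by
  have := (isInducing_derivMap (T := T) μ).topologicalAddGroup
  rw [SeminormFamily.withSeminorms_iff_nhds_eq_iInf, (isInducing_derivMap μ).nhds_eq_comap, nhds_pi, Filter.pi, Filter.comap_iInf]
  refine iInf_congr fun i => ?_
  rw [Filter.comap_comap]
  have hb := (UniformFun.hasBasis_nhds_of_basis (rect T) ℝ (derivMap μ 0 i)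
    Metric.uniformity_basis_dist).comap (Function.eval i ∘ derivMap (T := T) μ)
  have hb' := (Metric.nhds_basis_ball (x := (0 : ℝ))).comap (derivFamily (T := T) μ i)
  have key : ∀ (u : E T μ) (p : rect T), dist (UniformFun.toFun (derivMap μ 0 i) p)
      (UniformFun.toFun (derivMap μ u i) p) = |(derivOp i (incl μ u) : ℝ × ℝ → ℝ) p| := by
    intro u p
    change dist ((derivOp i (incl μ 0) : ℝ × ℝ → ℝ) p) _ = _
    rw [map_zero, map_zero, dist_comm]
    exact Real.dist_0_eq_abs _
  refine hb.ext hb' (fun ε hε => ⟨ε, hε, fun u hu p => ?_⟩) (fun ε hε => ⟨ε / 2, half_pos hε, fun u hu => ?_⟩)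
  · have h1 : derivFamily μ i u < ε := by
      have := mem_ball_zero_iff.1 hu
      rwa [Real.norm_of_nonneg (apply_nonneg _ _)] at this
    exact (key u p).trans_lt ((abs_apply_le (derivOp i (incl μ u)) p.2).trans_lt h1)
  · refine mem_ball_zero_iff.2 ?_
    rw [Real.norm_of_nonneg (apply_nonneg _ _)]
    refine lt_of_le_of_lt (supN_le fun p hp => ?_) (half_lt_self hε)
    exact ((key u ⟨p, hp⟩).symm.trans_lt (hu ⟨p, hp⟩)).le

end Transfer

section Conclusion

variable {T : ℝ} [hT : Fact (0 < T)]

/-! ### Tame spaces -/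

theorem derivFamily_apply (μ : Fin 2) (i : ℕ × ℕ) (u : E T μ) :
    derivFamily μ i u = derivN i (toVanish μ u).1 := by
  rw [toVanish_val, derivN_side]
  rfl

/-- A grading equivalent, with loss of finitely many degrees, to the supremum grading for `a = 1/2`
defines the topology of `𝔈_[μ]`. -/
theorem withSeminorms_of_equiv (μ : Fin 2) (P : ℕ → Seminorm ℝ (Smooth T)) (r : ℕ)
    (h₁ : ∀ n, ∃ C : ℝ, 0 ≤ C ∧ ∀ u ∈ vanishX T, P n u ≤ C * supG (1 / 2) (n + r) u)
    (h₂ : ∀ n, ∃ C : ℝ, 0 ≤ C ∧ ∀ u ∈ vanishX T, supG (1 / 2) n u ≤ C * P (n + r) u) :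
    WithSeminorms (E := E T μ) (𝕜 := ℝ) fun n =>
      (P n).comp ((vanishX T).subtype ∘ₗ (toVanish μ).toLinearMap) := by
  refine (withSeminorms_derivFamily μ).congr (.of_real fun n => ?_) (.of_real fun i => ?_)
  · obtain ⟨C₁, hC₁, h₁⟩ := h₁ n
    obtain ⟨s, C, hC, h⟩ := exists_supG_le_derivN (T := T) (1 / 2) (n + r)
    refine ⟨s, C₁ * (C * s.card), fun u => (h₁ _ (toVanish μ u).2).trans ?_⟩
    rw [mul_assoc, mul_assoc]
    refine mul_le_mul_of_nonneg_left ((h _).trans (mul_le_mul_of_nonneg_left ?_ hC)) hC₁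
    rw [← nsmul_eq_mul]
    refine Finset.sum_le_card_nsmul _ _ _ fun i hi => ?_
    rw [← derivFamily_apply]
    exact Seminorm.le_def.1 (Finset.le_sup (f := derivFamily μ) hi) u
  · obtain ⟨C, hC, h⟩ := exists_derivN_le (T := T) (a := 1 / 2) (by norm_num) i
    obtain ⟨C₂, hC₂, h₂⟩ := h₂ (i.1 / 2 + i.2 + 1)
    refine ⟨{i.1 / 2 + i.2 + 1 + r}, C * C₂, fun u => ?_⟩
    rw [Finset.sup_singleton, LinearMap.id_apply, derivFamily_apply, mul_assoc]
    exact (h _).trans (mul_le_mul_of_nonneg_left (h₂ _ (toVanish μ u).2) hC)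

/-- A grading of `𝔈_[μ]` which is tamely equivalent to the one by the supremum norms for `a = 1/2`
makes `𝔈_[μ]` a tame space. -/
theorem isTameSpace_of_equiv (μ : Fin 2) (P : ℕ → Seminorm ℝ (Smooth T))
    (hmono : ∀ (m n : ℕ) (u : Smooth T), m ≤ n → P m u ≤ P n u) (r : ℕ)
    (h₁ : ∀ n, ∃ C : ℝ, 0 ≤ C ∧ ∀ u ∈ vanishX T, P n u ≤ C * supG (1 / 2) (n + r) u)
    (h₂ : ∀ n, ∃ C : ℝ, 0 ≤ C ∧ ∀ u ∈ vanishX T, supG (1 / 2) n u ≤ C * P (n + r) u) :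
    IsTameSpace fun n (u : E T μ) => P n (toVanish μ u).1 := by
  have hw := withSeminorms_of_equiv μ P r h₁ h₂
  refine ⟨⟨⟨_, fun _ _ => rfl, hw⟩, fun m n u h => hmono m n _ h, ?_, fun f hf => ?_⟩,
    (ℝ × ℝ →ᵇ ℝ) × (ℝ × ℝ →ᵇ ℝ), inferInstance, inferInstance, inferInstance, ?_⟩
  · have := (withSeminorms_derivFamily (T := T) μ).topologicalAddGroup
    have : T1Space (E T μ) := (withSeminorms_derivFamily μ).T1_of_separating fun u hu => ⟨(0, 0), fun h => hu ?_⟩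
    · infer_instance
    · rw [derivFamily_apply] at h
      have h0 : (toVanish μ u).1 = 0 := eq_zero_of_supN_eq_zero (by simpa [derivN, derivOp] using h)
      exact (LinearEquiv.map_eq_zero_iff _).1 (Subtype.ext h0)
  · obtain ⟨v, hv⟩ := exists_limit_vanishX (T := T) (a := 1 / 2) (by norm_num) (fun i => toVanish μ (f i))
      fun n ε hε => by
        obtain ⟨C, hC, h⟩ := h₂ n
        obtain ⟨K, hK⟩ := hf (n + r) (ε / (C + 1)) (by positivity)
        refine ⟨K, fun i hi j hj => ?_⟩
        have e := hK i hi j hj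
        rw [lt_div_iff₀ (by positivity), map_sub] at e
        have e2 := h _ (toVanish μ (f i) - toVanish μ (f j)).2
        have e3 : 0 ≤ P (n + r) ((toVanish μ (f i) - toVanish μ (f j) : vanishX T) : Smooth T) :=
          apply_nonneg _ _
        refine lt_of_le_of_lt e2 ?_
        linarith
    refine ⟨(toVanish μ).symm v, fun n => ?_⟩
    obtain ⟨C, hC, h⟩ := h₁ n
    have hlim := (hv (n + r)).const_mul C
    rw [mul_zero] at hlim
    refine squeeze_zero (fun i => apply_nonneg _ _) (fun i => ?_) hlim
    rw [map_sub, LinearEquiv.apply_symm_apply]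
    exact h _ (toVanish μ (f i) - v).2
  · obtain ⟨L, M, ⟨s, b, hL⟩, ⟨s', b', hM⟩, hML⟩ := isTameDirectSummand_supG_half (T := T)
    refine ⟨L ∘ₗ (toVanish μ).toLinearMap, (toVanish μ).symm.toLinearMap ∘ₗ M,
      ⟨s + r, b, fun n hn => ?_⟩, ⟨r + s', b', fun n hn => ?_⟩, ?_⟩
    · obtain ⟨C, hC⟩ := hL n hn
      obtain ⟨C₂, -, h₂⟩ := h₂ (n + s)
      refine ⟨|C| * C₂, fun u => (hC _).trans ?_⟩
      rw [mul_assoc, ← add_assoc]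
      refine (mul_le_mul_of_nonneg_right (le_abs_self C) (apply_nonneg _ _)).trans ?_
      exact mul_le_mul_of_nonneg_left (h₂ _ (toVanish μ u).2) (abs_nonneg C)
    · obtain ⟨C₁, hC₁, h₁⟩ := h₁ n
      obtain ⟨C, hC⟩ := hM (n + r) (by omega)
      refine ⟨C₁ * C, fun f => ?_⟩
      simp only [LinearMap.comp_apply, LinearEquiv.coe_coe, LinearEquiv.apply_symm_apply]
      rw [mul_assoc, ← add_assoc]
      exact (h₁ _ (M f).2).trans (mul_le_mul_of_nonneg_left (hC f) hC₁)
    · refine LinearMap.ext fun u => ?_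
      have e := LinearMap.congr_fun hML (toVanish μ u)
      simp only [LinearMap.comp_apply, LinearMap.id_apply, LinearEquiv.coe_coe] at e ⊢
      rw [e, LinearEquiv.symm_apply_apply]

end Conclusion

end SingularGrading

end

theorem proposition1 (T N : ℝ) (hT : 0 < T) (hN : 4 < N) (μ : Fin 2) :
    HamiltonTame.TamelyEquivalent
        (SingularGrading.supGrading T N μ) (SingularGrading.l2Grading T N μ) ∧
      HamiltonTame.IsTameSpace (SingularGrading.supGrading T N μ) ∧
      HamiltonTame.IsTameSpace (SingularGrading.l2Grading T N μ) := by
  open SingularGrading in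
  have : Fact (0 < T) := ⟨hT⟩
  have ha := one_le_expo hN μ
  have ha0 : 0 < expo N μ := by linarith
  have e₁ : supGrading T N μ = fun n u => supG (expo N μ) n (toVanish μ u).1 :=
    funext fun n => funext fun u => supGrading_eq N μ n u
  have e₂ : l2Grading T N μ = fun n u => l2G ha n (toVanish μ u).1 :=
    funext fun n => funext fun u => l2Grading_eq hN μ n u
  obtain ⟨r, hr⟩ := exists_supG_le_l2G (T := T) ha
  rw [e₁, e₂]
  refine ⟨⟨r, 0, fun n _ => ?_⟩, ?_, ?_⟩
  · obtain ⟨C, hC, h⟩ := hr n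
    obtain ⟨C', hC', h'⟩ := exists_l2G_le_supG (T := T) ha n
    refine ⟨C + C', fun u => ⟨(h _ (toVanish μ u).2).trans ?_, (h' _).trans ?_⟩⟩
    · exact mul_le_mul_of_nonneg_right (by linarith) (apply_nonneg _ _)
    · exact mul_le_mul (by linarith) (supG_mono _ (by omega) _) (apply_nonneg _ _) (by positivity)
  · refine isTameSpace_of_equiv μ (supG (expo N μ)) (fun m n u h => supG_mono _ h u) 0 (fun n => ?_)
      fun n => ?_
    · obtain ⟨C, hC, h⟩ := exists_supG_le (T := T) n (a := 1 / 2) (b := expo N μ) (by norm_num) ha0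
      exact ⟨C, hC, fun u _ => h u⟩
    · obtain ⟨C, hC, h⟩ := exists_supG_le (T := T) n (b := 1 / 2) (a := expo N μ) ha0 (by norm_num)
      exact ⟨C, hC, fun u _ => h u⟩
  · refine isTameSpace_of_equiv μ (l2G ha) (fun m n u h => l2G_mono ha h u) r (fun n => ?_) fun n => ?_
    · obtain ⟨C, hC, h⟩ := exists_l2G_le_supG (T := T) ha n
      obtain ⟨C', hC', h'⟩ := exists_supG_le (T := T) n (a := 1 / 2) (b := expo N μ) (by norm_num) ha0
      refine ⟨C * C', by positivity, fun u _ => (h u).trans ?_⟩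
      rw [mul_assoc]
      exact mul_le_mul_of_nonneg_left ((h' u).trans
        (mul_le_mul_of_nonneg_left (supG_mono _ (by omega) u) hC')) hC
    · obtain ⟨C, hC, h⟩ := hr n
      obtain ⟨C', hC', h'⟩ := exists_supG_le (T := T) n (b := 1 / 2) (a := expo N μ) ha0 (by norm_num)
      refine ⟨C' * C, by positivity, fun u hu => (h' u).trans ?_⟩
      rw [mul_assoc]
      exact mul_le_mul_of_nonneg_left (h u hu) hC'
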